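/- Let $m\in\mathbb C$ with $\operatorname{Re} m>-1$. On the Hilbert space $L^2[0,\infty[$ consider: - the self-adjoint generator of dilations $A=\frac1{2\mathrm i}(x\partial_x+\partial_x x)$ (on its maximal domain, derivatives in the sense of distributions on $]0,\infty[$); functions of $A$ are understood in the sense of the Borel functional calculus; - the inversion $(\mathcal I f)(x)=x^{-1}f(x^{-1})$, and the operator $X^{-2}$ of multiplication by $x^{-2}$ with its maximal domain; - the Hankel transformation $(\mathcal F_m f)(k)=\int_0^\infty J_m(kx)\sqrt{kx}\,f(x)\,\mathrm dx$, where $J_m$ is the Bessel function and the integral is the $L^2$-limit of $\int_0^R$ as $R\to\infty$ (its domain being the set of $f\in L^2[0,\infty[$ for which $\int_0^R J_m(kx)\sqrt{kx}\,f(x)\,\mathrm dx$ converges absolutely for all $R,k>0$, is square integrable in $k$ for every $R$, and converges in $L^2$ as $R\to\infty$); - the homogeneous Schrödinger operator $H_m$: let $L_{\alpha}=-\partial_x^2+(-\frac14+\alpha)\frac1{x^2}$, let $L_{\alpha}^{\max}$ be its restriction to $\{f\in L^2[0,\infty[\,:\,L_\alpha f\in L^2[0,\infty[\}$ (in the sense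 of distributions on $]0,\infty[$) and $L_\alpha^{\min}$ the closure of its restriction to $C_{\mathrm c}^\infty]0,\infty[$; then $H_m$ is the restriction of $L_{m^2}^{\max}$ to $\operatorname{Dom}L_{m^2}^{\min}+\mathbb C\,x^{\frac12+m}\xi$, where $\xi$ is any smooth compactly supported cutoff equal to $1$ near $0$. Set $$\Xi_m(t)=\mathrm e^{\mathrm i\ln(2)t}\,\frac{\Gamma\big(\frac{m+1+\mathrm it}{2}\big)}{\Gamma\big(\frac{m+1-\mathrm it}{2}\big)},\qquad t\in\mathbb R .$$ Then $\Xi_m(A)$ is a well-defined bounded operator with bounded inverse $\Xi_m^{-1}(A)$ (where $\Xi_m^{-1}=1/\Xi_m$), $\mathcal F_m$ is defined on all of $L^2[0,\infty[$, and $$\mathcal F_m=\mathcal I\,\Xi_m(A)=\Xi_m^{-1}(A)\,\mathcal I .$$ Moreover, as an equality of unbounded operators (including domains), $$H_m=\Xi_m^{-1}(A)\,X^{-2}\,\Xi_m(A).$$ -/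

import Mathlib

open MeasureTheory Set Filter Topology
open scoped ContDiff

noncomputable section

/-! ### The Hilbert space and multiplication operators -/

/-- Lebesgue measure on the half-line `]0, ∞[`. -/
abbrev halfLine : Measure ℝ := volume.restrict (Ioi 0)

/-- The Hilbert space `L²[0, ∞[` of complex-valued functions. -/
abbrev HalfLineL2 : Type := Lp ℂ 2 halfLine

/-- The graph of the operator of multiplication by `a` on `L²(ν)`, with its maximal domain. -/
def mulGraph {α : Type*} [MeasurableSpace α] (ν : Measure α) (a : α → ℂ) :
    Submodule ℂ (Lp ℂ 2 ν × Lp ℂ 2 ν) where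
  carrier := {p | ⇑p.2 =ᵐ[ν] fun x => a x * p.1 x}
  zero_mem' := by
    show ⇑(0 : Lp ℂ 2 ν) =ᵐ[ν] fun x => a x * (0 : Lp ℂ 2 ν) x
    filter_upwards [Lp.coeFn_zero ℂ 2 ν] with x hx
    rw [hx]; simp
  add_mem' := by
    rintro ⟨f, g⟩ ⟨f', g'⟩ h h'
    show ⇑(g + g') =ᵐ[ν] fun x => a x * (f + f') x
    filter_upwards [Lp.coeFn_add f f', Lp.coeFn_add g g', h, h'] with x h1 h2 h3 h4
    simp only [h1, h2, Pi.add_apply] at *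
    rw [h3, h4]; ring
  smul_mem' := by
    rintro c ⟨f, g⟩ h
    show ⇑(c • g) =ᵐ[ν] fun x => a x * (c • f) x
    filter_upwards [Lp.coeFn_smul c f, Lp.coeFn_smul c g, h] with x h1 h2 h3
    simp only [h1, h2, Pi.smul_apply, smul_eq_mul] at *
    rw [h3]; ring

/-- The operator of multiplication by `a` on `L²(ν)`, with domain `{f | a f ∈ L²(ν)}`. -/
def mulOp {α : Type*} [MeasurableSpace α] (ν : Measure α) (a : α → ℂ) :
    Lp ℂ 2 ν →ₗ.[ℂ] Lp ℂ 2 ν :=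
  (mulGraph ν a).toLinearPMap

theorem mulOp_graph {α : Type*} [MeasurableSpace α] (ν : Measure α) (a : α → ℂ) :
    (mulOp ν a).graph = mulGraph ν a := by
  refine Submodule.toLinearPMap_graph_eq _ ?_
  rintro ⟨f, g⟩ h (rfl : f = 0)
  change ⇑g =ᵐ[ν] fun x => a x * (0 : Lp ℂ 2 ν) x at h
  refine Lp.ext ?_
  filter_upwards [h, Lp.coeFn_zero ℂ 2 ν] with x h1 h2
  rw [h1, h2]; simp

/-- The operator `W⁻¹ T W`, with domain `{f | W f ∈ Dom T}`. -/
def conjOp {E F : Type*} [AddCommGroup E] [Module ℂ E] [AddCommGroup F] [Module ℂ F]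
    (W : E ≃ₗ[ℂ] F) (T : F →ₗ.[ℂ] F) : E →ₗ.[ℂ] E where
  domain := T.domain.comap W.toLinearMap
  toFun := W.symm.toLinearMap ∘ₗ T.toFun ∘ₗ
    (W.toLinearMap.restrict (p := T.domain.comap W.toLinearMap) (q := T.domain) fun _ h => h)

/-! ### Functions of a self-adjoint operator -/

/-- `B = φ(T)` in the sense of the Borel functional calculus of a self-adjoint operator `T`:
some unitary `W` onto an `L²(ν)` turns `T` into multiplication by a real measurable function `h`
(the spectral theorem), and the same `W` turns `B` into multiplication by `φ ∘ h`. -/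
def IsFunctionOf {E : Type*} [NormedAddCommGroup E] [InnerProductSpace ℂ E]
    (T : E →ₗ.[ℂ] E) (φ : ℝ → ℂ) (B : E →L[ℂ] E) : Prop :=
  Measurable φ ∧
  ∃ (α : Type) (_ : MeasurableSpace α) (ν : Measure α) (W : E ≃ₗᵢ[ℂ] Lp ℂ 2 ν) (h : α → ℝ),
    Measurable h ∧
    T = conjOp W.toLinearEquiv (mulOp ν fun s => (h s : ℂ)) ∧
    ∀ f : E, ⇑(W (B f)) =ᵐ[ν] fun s => φ (h s) * W f s

/-! ### Differential operators on the half-line, in the sense of distributions -/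

/-- Test functions: elements of `C_c^∞ ]0, ∞[`. -/
structure IsTest (φ : ℝ → ℂ) : Prop where
  contDiff : ContDiff ℝ ∞ φ
  compact : HasCompactSupport φ
  supp : tsupport φ ⊆ Ioi 0

theorem IsTest.memLp {φ : ℝ → ℂ} (h : IsTest φ) : MemLp φ 2 halfLine :=
  (h.contDiff.continuous.memLp_of_hasCompactSupport h.compact).restrict _

theorem IsTest.integrable_mul {φ : ℝ → ℂ} (h : IsTest φ) (f : HalfLineL2) :
    Integrable (fun x => f x * φ x) halfLine :=
  (Lp.memLp f).integrable_mul h.memLp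

theorem IsTest.zero : IsTest 0 where
  contDiff := contDiff_const
  compact := HasCompactSupport.zero
  supp := by simp

theorem IsTest.add {φ ψ : ℝ → ℂ} (h : IsTest φ) (h' : IsTest ψ) : IsTest (φ + ψ) where
  contDiff := h.contDiff.add h'.contDiff
  compact := h.compact.add h'.compact
  supp := (tsupport_add φ ψ).trans (union_subset h.supp h'.supp)

theorem IsTest.mul_of_smooth {φ a : ℝ → ℂ} (h : IsTest φ)
    (ha : ∀ x, 0 < x → ContDiffAt ℝ ∞ a x) : IsTest (fun x => a x * φ x) where
  contDiff := by
    rw [contDiff_iff_contDiffAt]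
    intro x
    by_cases hx : x ∈ tsupport φ
    · exact (ha x (h.supp hx)).mul h.contDiff.contDiffAt
    · have h0 : (fun x => a x * φ x) =ᶠ[𝓝 x] fun _ => 0 := by
        filter_upwards [notMem_tsupport_iff_eventuallyEq.mp hx] with y hy
        simp [hy]
      exact contDiffAt_const.congr_of_eventuallyEq h0
  compact := h.compact.mul_left
  supp := (tsupport_mul_subset_right (f := a) (g := φ)).trans h.supp

theorem IsTest.deriv {φ : ℝ → ℂ} (h : IsTest φ) : IsTest (deriv φ) where
  contDiff := (contDiff_infty_iff_deriv.mp h.contDiff).2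
  compact := h.compact.deriv
  supp := tsupport_deriv_subset.trans h.supp

/-- `C_c^∞ ]0, ∞[` as a subspace of `L²[0, ∞[`. -/
def testSubmodule : Submodule ℂ HalfLineL2 where
  carrier := {f | ∃ φ : ℝ → ℂ, IsTest φ ∧ ⇑f =ᵐ[halfLine] φ}
  zero_mem' := ⟨0, IsTest.zero, Lp.coeFn_zero ℂ 2 halfLine⟩
  add_mem' := by
    rintro f g ⟨φ, hφ, hf⟩ ⟨ψ, hψ, hg⟩
    exact ⟨φ + ψ, hφ.add hψ, (Lp.coeFn_add f g).trans (hf.add hg)⟩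
  smul_mem' := by
    rintro c f ⟨φ, hφ, hf⟩
    refine ⟨fun x => c * φ x, hφ.mul_of_smooth fun x _ => contDiffAt_const, ?_⟩
    filter_upwards [Lp.coeFn_smul c f, hf] with x h1 h2
    simp [h1, h2]

/-- Given the formal transpose `P` of a differential expression `D`, the graph of its maximal
realization: all `(f, g)` in `L² × L²` with `D f = g` in the sense of distributions, that is
`∫ g φ = ∫ f (P φ)` for all test functions `φ`. -/
def weakGraph (P : (ℝ → ℂ) → ℝ → ℂ) (hP : ∀ φ, IsTest φ → IsTest (P φ)) :
    Submodule ℂ (HalfLineL2 × HalfLineL2) where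
  carrier := {p | ∀ φ : ℝ → ℂ, IsTest φ →
    ∫ x in Ioi (0 : ℝ), p.2 x * φ x = ∫ x in Ioi (0 : ℝ), p.1 x * P φ x}
  zero_mem' := by
    intro φ _
    have h : ∀ ψ : ℝ → ℂ, ∫ x in Ioi (0 : ℝ), (0 : HalfLineL2) x * ψ x = 0 := by
      intro ψ
      rw [← integral_zero ℝ ℂ (μ := halfLine)]
      refine integral_congr_ae ?_
      filter_upwards [Lp.coeFn_zero ℂ 2 halfLine] with x hx
      rw [hx]; simp
    exact (h φ).trans (h (P φ)).symm
  add_mem' := by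
    rintro ⟨f, g⟩ ⟨f', g'⟩ h h' φ hφ
    have key : ∀ (u v : HalfLineL2) (ψ : ℝ → ℂ), IsTest ψ →
        ∫ x in Ioi (0 : ℝ), (u + v) x * ψ x =
          (∫ x in Ioi (0 : ℝ), u x * ψ x) + ∫ x in Ioi (0 : ℝ), v x * ψ x := by
      intro u v ψ hψ
      rw [← integral_add (hψ.integrable_mul u) (hψ.integrable_mul v)]
      refine integral_congr_ae ?_
      filter_upwards [Lp.coeFn_add u v] with x hx
      rw [hx, Pi.add_apply, add_mul]
    have h1 := h φ hφ
    have h2 := h' φ hφ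
    show ∫ x in Ioi (0 : ℝ), (g + g') x * φ x = ∫ x in Ioi (0 : ℝ), (f + f') x * P φ x
    rw [key g g' φ hφ, key f f' _ (hP φ hφ)]
    exact congrArg₂ (· + ·) h1 h2
  smul_mem' := by
    rintro c ⟨f, g⟩ h φ hφ
    have key : ∀ (u : HalfLineL2) (ψ : ℝ → ℂ),
        ∫ x in Ioi (0 : ℝ), (c • u) x * ψ x = c * ∫ x in Ioi (0 : ℝ), u x * ψ x := by
      intro u ψ
      rw [← integral_const_mul]
      refine integral_congr_ae ?_
      filter_upwards [Lp.coeFn_smul c u] with x hx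
      simp [hx, mul_assoc]
    have h1 := h φ hφ
    show ∫ x in Ioi (0 : ℝ), (c • g) x * φ x = ∫ x in Ioi (0 : ℝ), (c • f) x * P φ x
    rw [key, key]
    exact congrArg (c * ·) h1

/-- The maximal realization on `L²[0, ∞[` of the differential expression with formal
transpose `P`. -/
def weakOp (P : (ℝ → ℂ) → ℝ → ℂ) (hP : ∀ φ, IsTest φ → IsTest (P φ)) :
    HalfLineL2 →ₗ.[ℂ] HalfLineL2 :=
  (weakGraph P hP).toLinearPMap

theorem weakOp_graph (P : (ℝ → ℂ) → ℝ → ℂ) (hP : ∀ φ, IsTest φ → IsTest (P φ)) :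
    (weakOp P hP).graph = weakGraph P hP := by
  refine Submodule.toLinearPMap_graph_eq _ ?_
  rintro ⟨f, g⟩ h (rfl : f = 0)
  have hg : ∀ᵐ x ∂(volume : Measure ℝ), x ∈ Ioi (0 : ℝ) → g x = 0 := by
    have hloc : LocallyIntegrable (⇑g) halfLine :=
      (Lp.memLp g).locallyIntegrable (by norm_num)
    refine isOpen_Ioi.ae_eq_zero_of_integral_contDiff_smul_eq_zero
      ((locallyIntegrableOn_iff isOpen_Ioi.isLocallyClosed).mpr ?_) ?_
    · intro k hk hkc
      have := hloc.integrableOn_isCompact hkc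
      rwa [IntegrableOn, Measure.restrict_restrict hkc.measurableSet,
        inter_eq_left.mpr hk] at this
    · intro ψ h1 h2 h3
      have hsub : tsupport (fun x => (ψ x : ℂ)) ⊆ tsupport ψ :=
        closure_mono fun x hx => by simpa using hx
      have hψ : IsTest (fun x => (ψ x : ℂ)) :=
        ⟨Complex.ofRealCLM.contDiff.comp h1,
          h2.comp_left (g := fun t : ℝ => (t : ℂ)) (by simp), hsub.trans h3⟩
      have h4 := h _ hψ
      have h5 : ∫ x in Ioi (0 : ℝ), (0 : HalfLineL2) x * P (fun x => (ψ x : ℂ)) x = 0 := by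
        rw [← integral_zero ℝ ℂ (μ := halfLine)]
        refine integral_congr_ae ?_
        filter_upwards [Lp.coeFn_zero ℂ 2 halfLine] with x hx
        rw [hx]; simp
      have h6 : ∫ x, ψ x • g x = ∫ x in Ioi (0 : ℝ), ψ x • g x := by
        rw [setIntegral_eq_integral_of_forall_compl_eq_zero]
        intro x hx
        rw [image_eq_zero_of_notMem_tsupport fun h => hx (h3 h), zero_smul]
      rw [h6, ← h5, ← h4]
      refine integral_congr_ae (ae_of_all _ fun x => ?_)
      simp [Complex.real_smul, mul_comm]
  refine Lp.ext ?_
  have hg' : ∀ᵐ x ∂halfLine, g x = 0 := (ae_restrict_iff' measurableSet_Ioi).mpr hg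
  filter_upwards [hg', Lp.coeFn_zero ℂ 2 halfLine] with x h1 h2
  rw [h1, h2, Pi.zero_apply]

/-- The formal transpose of `(1/2i) (x ∂ + ∂ x) = -i (x ∂ + 1/2)`, which is `i (x ∂ + 1/2)`. -/
def dilationTranspose (φ : ℝ → ℂ) (x : ℝ) : ℂ := Complex.I * (x * deriv φ x + φ x / 2)

theorem dilationTranspose_isTest (φ : ℝ → ℂ) (h : IsTest φ) : IsTest (dilationTranspose φ) := by
  have h1 : IsTest (fun x : ℝ => (Complex.I * x) * deriv φ x) :=
    h.deriv.mul_of_smooth fun x _ =>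
      contDiffAt_const.mul Complex.ofRealCLM.contDiff.contDiffAt
  have h2 : IsTest (fun x : ℝ => (Complex.I / 2) * φ x) :=
    h.mul_of_smooth fun x _ => contDiffAt_const
  convert h1.add h2 using 1
  funext x
  simp only [dilationTranspose, Pi.add_apply]
  ring

/-- The self-adjoint generator of dilations `A = (1/2i) (x ∂ + ∂ x)` on `L²[0, ∞[`. -/
def dilationGenerator : HalfLineL2 →ₗ.[ℂ] HalfLineL2 :=
  weakOp dilationTranspose dilationTranspose_isTest

/-- The differential expression `L_α = -∂² + (-1/4 + α) x⁻²`; it is its own formal transpose. -/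
def schrodingerExpr (α : ℂ) (φ : ℝ → ℂ) (x : ℝ) : ℂ :=
  -(deriv (deriv φ) x) + (-1 / 4 + α) / (x : ℂ) ^ 2 * φ x

theorem schrodingerExpr_isTest (α : ℂ) (φ : ℝ → ℂ) (h : IsTest φ) :
    IsTest (schrodingerExpr α φ) := by
  have h1 : IsTest (fun x : ℝ => (-1 : ℂ) * deriv (deriv φ) x) :=
    h.deriv.deriv.mul_of_smooth fun x _ => contDiffAt_const
  have h2 : IsTest (fun x : ℝ => ((-1 / 4 + α) / (x : ℂ) ^ 2) * φ x) :=
    h.mul_of_smooth fun x hx => by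
      have h3 : ContDiffAt ℝ ∞ (fun x : ℝ => (x : ℂ) ^ 2) x :=
        (Complex.ofRealCLM.contDiff.contDiffAt (x := x)).pow 2
      simp only [div_eq_mul_inv]
      exact contDiffAt_const.mul (h3.inv (pow_ne_zero 2 (Complex.ofReal_ne_zero.mpr hx.ne')))
  convert h1.add h2 using 1
  funext x
  simp [schrodingerExpr]

/-- The maximal operator `L_α^max`: all `f ∈ L²` with `L_α f ∈ L²`. -/
def LMax (α : ℂ) : HalfLineL2 →ₗ.[ℂ] HalfLineL2 :=
  weakOp (schrodingerExpr α) (schrodingerExpr_isTest α)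

/-- The minimal operator `L_α^min`: the closure of `L_α` on `C_c^∞ ]0, ∞[`. -/
def LMin (α : ℂ) : HalfLineL2 →ₗ.[ℂ] HalfLineL2 :=
  ((LMax α).domRestrict testSubmodule).closure

/-- The homogeneous Schrödinger operator `H_m`: the restriction of `L_{m²}^max` to
`Dom L_{m²}^min + ℂ x^{1/2+m} ξ`, where `ξ` is a cutoff. -/
def homogeneousSchrodinger (m : ℂ) (ξ : ℝ → ℝ) : HalfLineL2 →ₗ.[ℂ] HalfLineL2 :=
  (LMax (m ^ 2)).domRestrict ((LMin (m ^ 2)).domain ⊔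
    Submodule.span ℂ {f | ⇑f =ᵐ[halfLine] fun x => (x : ℂ) ^ (1 / 2 + m) * ξ x})

/-! ### The Hankel transformation -/

/-- The Bessel function `J_m` of complex order `m` on `]0, ∞[`. -/
def besselJ (m : ℂ) (x : ℝ) : ℂ :=
  ∑' n : ℕ, (-1) ^ n / (n.factorial * Complex.Gamma (n + m + 1)) * ((x / 2 : ℝ) : ℂ) ^ (2 * n + m)

/-- The truncated Hankel integral `k ↦ ∫_0^R J_m(kx) √(kx) f(x) dx`. -/
def hankelTrunc (m : ℂ) (R : ℝ) (f : ℝ → ℂ) (k : ℝ) : ℂ :=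
  ∫ x in Ioo 0 R, besselJ m (k * x) * (Real.sqrt (k * x) : ℂ) * f x

theorem ae_Ioo_of_halfLine (R : ℝ) {p : ℝ → Prop} (h : ∀ᵐ x ∂halfLine, p x) :
    ∀ᵐ x ∂volume.restrict (Ioo 0 R), p x :=
  ae_mono (Measure.restrict_mono (fun _ hx => hx.1) le_rfl) h

theorem hankelTrunc_congr (m : ℂ) (R : ℝ) {f g : ℝ → ℂ} (h : f =ᵐ[halfLine] g) :
    hankelTrunc m R f = hankelTrunc m R g := by
  funext k
  refine integral_congr_ae ?_
  filter_upwards [ae_Ioo_of_halfLine R h] with x hx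
  simp [hx]

/-- The graph of the Hankel transformation: `g = F_m f` when, for every `R`, the truncated
integrals converge absolutely and lie in `L²`, and they tend to `g` in `L²` as `R → ∞`. -/
def hankelGraph (m : ℂ) : Submodule ℂ (HalfLineL2 × HalfLineL2) where
  carrier := {p |
    (∀ R > 0, ∀ k > 0,
      IntegrableOn (fun x => besselJ m (k * x) * (Real.sqrt (k * x) : ℂ) * p.1 x) (Ioo 0 R)) ∧
    (∀ R > 0, MemLp (hankelTrunc m R p.1) 2 halfLine) ∧
    Tendsto (fun R => eLpNorm (hankelTrunc m R p.1 - ⇑p.2) 2 halfLine) atTop (𝓝 0)}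
  zero_mem' := by
    have h : ∀ R, hankelTrunc m R (0 : HalfLineL2) = 0 := fun R => by
      rw [hankelTrunc_congr m R (Lp.coeFn_zero ℂ 2 halfLine)]
      funext k
      simp [hankelTrunc]
    refine ⟨fun R _ k _ => ?_, fun R _ => ?_, ?_⟩
    · refine (integrable_zero ℝ ℂ (volume.restrict (Ioo 0 R))).congr ?_
      filter_upwards [ae_Ioo_of_halfLine R (Lp.coeFn_zero ℂ 2 halfLine)] with x hx
      show (0 : ℂ) = _ * (0 : HalfLineL2) x
      rw [hx]; simp
    · show MemLp (hankelTrunc m R (0 : HalfLineL2)) 2 halfLine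
      rw [h]; exact MemLp.zero
    · refine tendsto_const_nhds.congr fun R => ?_
      show 0 = eLpNorm (hankelTrunc m R (0 : HalfLineL2) - ⇑(0 : HalfLineL2)) 2 halfLine
      rw [h, eLpNorm_congr_ae ((ae_eq_refl _).sub (Lp.coeFn_zero ℂ 2 halfLine))]
      simp
  add_mem' := by
    rintro ⟨f, g⟩ ⟨f', g'⟩ ⟨h1, h2, h3⟩ ⟨h1', h2', h3'⟩
    have hint : ∀ R > 0, ∀ k > 0, IntegrableOn
        (fun x => besselJ m (k * x) * (Real.sqrt (k * x) : ℂ) * (f + f') x) (Ioo 0 R) := by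
      intro R hR k hk
      refine ((h1 R hR k hk).add (h1' R hR k hk)).congr ?_
      filter_upwards [ae_Ioo_of_halfLine R (Lp.coeFn_add f f')] with x hx
      rw [hx, Pi.add_apply, Pi.add_apply, mul_add]
    have hadd : ∀ R > 0,
        hankelTrunc m R ⇑(f + f') =ᵐ[halfLine] hankelTrunc m R f + hankelTrunc m R f' := by
      intro R hR
      filter_upwards [ae_restrict_mem measurableSet_Ioi] with k hk
      have e := integral_add (h1 R hR k hk) (h1' R hR k hk)
      rw [Pi.add_apply]
      refine Eq.trans ?_ e
      refine integral_congr_ae ?_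
      filter_upwards [ae_Ioo_of_halfLine R (Lp.coeFn_add f f')] with x hx
      rw [hx, Pi.add_apply, mul_add]
    refine ⟨hint, fun R hR => ((h2 R hR).add (h2' R hR)).ae_eq (hadd R hR).symm, ?_⟩
    have hlim := h3.add h3'
    rw [add_zero] at hlim
    refine tendsto_of_tendsto_of_tendsto_of_le_of_le' tendsto_const_nhds hlim
      (Eventually.of_forall fun _ => bot_le) ?_
    filter_upwards [eventually_gt_atTop (0 : ℝ)] with R hR
    have e : hankelTrunc m R ⇑(f + f') - ⇑(g + g') =ᵐ[halfLine]
        (hankelTrunc m R f - ⇑g) + (hankelTrunc m R f' - ⇑g') := by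
      filter_upwards [hadd R hR, Lp.coeFn_add g g'] with x hx hx'
      simp only [Pi.sub_apply, Pi.add_apply] at *
      rw [hx, hx']; ring
    show eLpNorm (hankelTrunc m R ⇑(f + f') - ⇑(g + g')) 2 halfLine ≤ _
    rw [eLpNorm_congr_ae e]
    exact eLpNorm_add_le ((h2 R hR).sub (Lp.memLp g)).1 ((h2' R hR).sub (Lp.memLp g')).1
      (by norm_num)
  smul_mem' := by
    rintro c ⟨f, g⟩ ⟨h1, h2, h3⟩
    have hint : ∀ R > 0, ∀ k > 0, IntegrableOn
        (fun x => besselJ m (k * x) * (Real.sqrt (k * x) : ℂ) * (c • f) x) (Ioo 0 R) := by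
      intro R hR k hk
      refine ((h1 R hR k hk).const_mul c).congr ?_
      filter_upwards [ae_Ioo_of_halfLine R (Lp.coeFn_smul c f)] with x hx
      simp only [hx, Pi.smul_apply, smul_eq_mul]
      ring
    have hsmul : ∀ R, hankelTrunc m R ⇑(c • f) = c • hankelTrunc m R f := by
      intro R
      rw [hankelTrunc_congr m R (Lp.coeFn_smul c f)]
      funext k
      simp only [hankelTrunc, Pi.smul_apply, smul_eq_mul]
      rw [← integral_const_mul]
      congr 1
      funext x
      ring
    refine ⟨hint, fun R hR => ?_, ?_⟩
    · show MemLp (hankelTrunc m R ⇑(c • f)) 2 halfLine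
      rw [hsmul]
      exact (h2 R hR).const_smul c
    · have hlim : Tendsto (fun R => ‖c‖ₑ * eLpNorm (hankelTrunc m R f - ⇑g) 2 halfLine)
          atTop (𝓝 (‖c‖ₑ * 0)) := ENNReal.Tendsto.const_mul h3 (Or.inr (by simp))
      rw [mul_zero] at hlim
      refine hlim.congr fun R => ?_
      show _ = eLpNorm (hankelTrunc m R ⇑(c • f) - ⇑(c • g)) 2 halfLine
      rw [eLpNorm_congr_ae ((ae_eq_refl _).sub (Lp.coeFn_smul c g)), hsmul, ← smul_sub,
        eLpNorm_const_smul]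

/-- The Hankel transformation `F_m f(k) = ∫_0^∞ J_m(kx) √(kx) f(x) dx` on `L²[0, ∞[`, the
integral being the limit in `L²` of the integrals over `]0, R[` as `R → ∞`. -/
def hankel (m : ℂ) : HalfLineL2 →ₗ.[ℂ] HalfLineL2 := (hankelGraph m).toLinearPMap

theorem hankel_graph (m : ℂ) : (hankel m).graph = hankelGraph m := by
  refine Submodule.toLinearPMap_graph_eq _ ?_
  rintro ⟨f, g⟩ ⟨_, _, h3⟩ (rfl : f = 0)
  have h : ∀ R, hankelTrunc m R (0 : HalfLineL2) = 0 := fun R => by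
    rw [hankelTrunc_congr m R (Lp.coeFn_zero ℂ 2 halfLine)]
    funext k
    simp [hankelTrunc]
  simp only [h, zero_sub, eLpNorm_neg] at h3
  have h4 : eLpNorm (⇑g) 2 halfLine = 0 := tendsto_nhds_unique tendsto_const_nhds h3
  rw [eLpNorm_eq_zero_iff (Lp.aestronglyMeasurable g) (by norm_num)] at h4
  exact (Lp.eq_zero_iff_ae_eq_zero).mpr h4

/-! ### The inversion and the function `Ξ_m` -/

theorem inversion_image : (fun x : ℝ => x⁻¹) '' Ioi 0 = Ioi 0 := by
  ext y
  constructor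
  · rintro ⟨x, hx, rfl⟩
    exact mem_Ioi.mpr (inv_pos.mpr (mem_Ioi.mp hx))
  · intro hy
    exact ⟨y⁻¹, mem_Ioi.mpr (inv_pos.mpr (mem_Ioi.mp hy)), inv_inv y⟩

theorem inversion_lintegral (u : ℝ → ENNReal) :
    ∫⁻ x in Ioi (0 : ℝ), ENNReal.ofReal (x⁻¹ ^ 2) * u x⁻¹ = ∫⁻ x in Ioi (0 : ℝ), u x := by
  have h := lintegral_image_eq_lintegral_abs_deriv_mul (s := Ioi (0 : ℝ))
    (f := fun x : ℝ => x⁻¹) (f' := fun x => -(x ^ 2)⁻¹) measurableSet_Ioi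
    (fun x hx => (hasDerivAt_inv (ne_of_gt hx)).hasDerivWithinAt)
    (inv_injective.injOn) u
  rw [inversion_image] at h
  rw [h]
  refine lintegral_congr fun x => ?_
  rw [abs_neg, abs_of_nonneg (by positivity), inv_pow]

theorem inversion_qmp : Measure.QuasiMeasurePreserving (fun x : ℝ => x⁻¹) halfLine halfLine := by
  refine ⟨measurable_inv, Measure.AbsolutelyContinuous.mk fun s hs h0 => ?_⟩
  rw [Measure.map_apply measurable_inv hs]
  have h := inversion_lintegral (s.indicator 1)
  rw [lintegral_indicator_one hs, h0, lintegral_eq_zero_iff (by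
    refine Measurable.mul (by fun_prop) ?_
    exact (measurable_one.indicator hs).comp measurable_inv)] at h
  refine measure_mono_null (t := {x | ¬ (x ∉ (fun x : ℝ => x⁻¹) ⁻¹' s)})
    (fun x hx => not_not.mpr hx) ?_
  refine ae_iff.mp ?_
  filter_upwards [h, ae_restrict_mem measurableSet_Ioi] with x hx hpos hxs
  have hpos' : 0 < x := hpos
  have hxs' : x⁻¹ ∈ s := hxs
  simp only [Pi.zero_apply, mul_eq_zero, indicator_of_mem hxs', Pi.one_apply, one_ne_zero,
    or_false, ENNReal.ofReal_eq_zero] at hx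
  exact absurd hx (not_le.mpr (by positivity))

theorem inversion_eLpNorm (f : ℝ → ℂ) :
    eLpNorm (fun x : ℝ => (x : ℂ)⁻¹ * f x⁻¹) 2 halfLine = eLpNorm f 2 halfLine := by
  rw [eLpNorm_eq_lintegral_rpow_enorm_toReal (by norm_num) (by norm_num),
    eLpNorm_eq_lintegral_rpow_enorm_toReal (by norm_num) (by norm_num)]
  congr 1
  rw [← inversion_lintegral fun x => ‖f x‖ₑ ^ (2 : ENNReal).toReal]
  refine setLIntegral_congr_fun measurableSet_Ioi fun x hx => ?_
  have hx' : 0 < x := hx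
  have h1 : ‖(x : ℂ)⁻¹‖ₑ = ENNReal.ofReal x⁻¹ := by
    rw [← ofReal_norm, norm_inv, Complex.norm_real, Real.norm_of_nonneg hx'.le]
  simp only [enorm_mul, h1]
  rw [ENNReal.mul_rpow_of_nonneg _ _ (by norm_num)]
  congr 1
  rw [ENNReal.ofReal_pow (by positivity)]
  simp

theorem inversion_memLp (f : HalfLineL2) :
    MemLp (fun x : ℝ => (x : ℂ)⁻¹ * f x⁻¹) 2 halfLine := by
  refine ⟨?_, ?_⟩
  · refine AEStronglyMeasurable.mul ?_ ?_
    · exact (Complex.measurable_ofReal.inv).aestronglyMeasurable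
    · exact (Lp.aestronglyMeasurable f).comp_quasiMeasurePreserving inversion_qmp
  · rw [inversion_eLpNorm]
    exact (Lp.memLp f).2

/-- The inversion `(I f)(x) = x⁻¹ f(x⁻¹)` on `L²[0, ∞[`. -/
def inversion : HalfLineL2 →ₗᵢ[ℂ] HalfLineL2 where
  toFun f := (inversion_memLp f).toLp _
  map_add' f g := by
    refine Lp.ext ?_
    filter_upwards [(inversion_memLp (f + g)).coeFn_toLp, (inversion_memLp f).coeFn_toLp,
      (inversion_memLp g).coeFn_toLp, inversion_qmp.ae (Lp.coeFn_add f g),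
      Lp.coeFn_add ((inversion_memLp f).toLp _) ((inversion_memLp g).toLp _)] with x h1 h2 h3 h4 h5
    rw [h1, h5, Pi.add_apply, h2, h3, h4, Pi.add_apply, mul_add]
  map_smul' c f := by
    refine Lp.ext ?_
    filter_upwards [(inversion_memLp (c • f)).coeFn_toLp, (inversion_memLp f).coeFn_toLp,
      inversion_qmp.ae (Lp.coeFn_smul c f),
      Lp.coeFn_smul c ((inversion_memLp f).toLp _)] with x h1 h2 h3 h4
    rw [RingHom.id_apply, h1, h4, Pi.smul_apply, h2, h3, Pi.smul_apply, smul_eq_mul, smul_eq_mul]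
    ring
  norm_map' f := by
    show ‖(inversion_memLp f).toLp _‖ = ‖f‖
    rw [Lp.norm_toLp, inversion_eLpNorm, Lp.norm_def]

/-- `Ξ_m(t) = e^{i ln(2) t} Γ((m+1+it)/2) / Γ((m+1-it)/2)`. -/
def Xi (m : ℂ) (t : ℝ) : ℂ :=
  Complex.exp (Complex.I * Real.log 2 * t) *
    (Complex.Gamma ((m + 1 + Complex.I * t) / 2) / Complex.Gamma ((m + 1 - Complex.I * t) / 2))

end

/-!
In the logarithmic coordinate `u = -ln x` the generator of dilations is a constant coefficient
operator, so that the Mellin transformation (the Fourier transformation in `u`) turns `A` into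
multiplication by a real variable `t`, `Ξ_m(A)` into multiplication by `Ξ_m(t)` and the inversion
into `t ↦ -t`. The Mellin transform of the Gaussian `x^{m+1/2} e^{-ax²/2}` is a Gamma function, and
the quotient of Gamma functions in `Ξ_m` is the one for which `I Ξ_m(A)` maps this Gaussian to
`a^{-m-1} x^{m+1/2} e^{-x²/(2a)}`. Integrating the Bessel series term by term shows that the Hankel
transformation does the same; since the Gaussians are total, the two operators agree.

Both `H_m` and `Ξ_m⁻¹(A) X⁻² Ξ_m(A)` map each Gaussian to the same function. The graph of the latter
operator is the closed span of these pairs, and it contains the minimal operator because `L_{m²}` is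
symmetric for the bilinear pairing `∫ f g`. A Gaussian differs from a multiple of `x^{1/2+m} ξ` by
an element of the minimal domain, hence the graph of `H_m` is closed, is contained in that of
`Ξ_m⁻¹(A) X⁻² Ξ_m(A)` and contains all the pairs that span it.
-/

noncomputable section

/-! ### Quotients of Gamma functions on vertical lines -/

lemma sum_one_div_add_sq_le {c : ℝ} (hc : 0 < c) (n : ℕ) :
    ∑ j ∈ Finset.range (n + 1), 1 / (c + j) ^ 2 ≤ 1 / c ^ 2 + 1 / c - 1 / (c + n) := by
  induction n with
  | zero => simp
  | succ n ih =>
    have hn : 0 < c + n := by positivity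
    have hn' : 0 < c + (n + 1 : ℕ) := by positivity
    have telescope : 1 / (c + (n + 1 : ℕ)) ^ 2 ≤ 1 / (c + n) - 1 / (c + (n + 1 : ℕ)) := by
      rw [div_sub_div _ _ hn.ne' hn'.ne', div_le_div_iff₀ (by positivity) (by positivity)]
      push_cast at *
      nlinarith
    rw [Finset.sum_range_succ]
    linarith

lemma sq_norm_add_mul_I_add_natCast (σ u : ℝ) (j : ℕ) :
    ‖(σ + u * Complex.I + j : ℂ)‖ ^ 2 = (σ + j) ^ 2 + u ^ 2 := by
  rw [Complex.sq_norm, Complex.normSq_apply]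
  simp
  ring

section GammaVertical

variable {σ : ℝ} (hσ : 0 < σ) (b y : ℝ)

include hσ

lemma norm_add_natCast_le_mul_exp (j : ℕ) :
    ‖(σ + (y - b : ℝ) * Complex.I + j : ℂ)‖ ≤ ‖(σ + y * Complex.I + j : ℂ)‖ *
      Real.exp (2 * (b ^ 2 + 2 * |b| * |y|) * (1 / (σ + |y| + j) ^ 2)) := by
  set e := 2 * (b ^ 2 + 2 * |b| * |y|) * (1 / (σ + |y| + j) ^ 2) with he
  have he0 : 0 ≤ e := by positivity
  have hcross : b ^ 2 + 2 * |b| * |y| ≤ ((σ + j) ^ 2 + y ^ 2) * e := by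
    have hden : (σ + |y| + j) ^ 2 ≤ 2 * ((σ + j) ^ 2 + y ^ 2) := by
      rw [← sq_abs y]
      nlinarith [sq_nonneg (σ + j - |y|)]
    have hnum : 0 ≤ b ^ 2 + 2 * |b| * |y| := by positivity
    rw [he, mul_one_div, mul_div_assoc', le_div_iff₀ (by positivity)]
    nlinarith
  have hexpand : (σ + j) ^ 2 + (y - b) ^ 2 ≤ ((σ + j) ^ 2 + y ^ 2) * (1 + e) := by
    have hyb : -(y * b) ≤ |b| * |y| := by
      rw [← abs_mul, mul_comm]
      exact neg_le_abs _
    nlinarith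
  have hexp : 1 + e ≤ Real.exp e ^ 2 := by
    nlinarith [Real.add_one_le_exp e, Real.one_le_exp he0]
  refine le_of_sq_le_sq ?_ (by positivity)
  rw [mul_pow, sq_norm_add_mul_I_add_natCast, sq_norm_add_mul_I_add_natCast]
  exact hexpand.trans (mul_le_mul_of_nonneg_left hexp (by positivity))

lemma mul_sum_one_div_sq_le (n : ℕ) :
    2 * (b ^ 2 + 2 * |b| * |y|) * ∑ j ∈ Finset.range (n + 1), 1 / (σ + |y| + j) ^ 2 ≤
      2 * (b ^ 2 / σ + 2 * |b|) * (1 / σ + 1) := by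
  have hc : 0 < σ + |y| := by positivity
  have hsum : ∑ j ∈ Finset.range (n + 1), 1 / (σ + |y| + j) ^ 2 ≤
      1 / (σ + |y|) ^ 2 + 1 / (σ + |y|) :=
    (sum_one_div_add_sq_le hc n).trans (sub_le_self _ (by positivity))
  have hquot : (b ^ 2 + 2 * |b| * |y|) / (σ + |y|) ≤ b ^ 2 / σ + 2 * |b| := by
    rw [add_div]
    refine add_le_add (by gcongr; simp) ?_
    rw [div_le_iff₀ hc]
    nlinarith [abs_nonneg b, abs_nonneg y, mul_nonneg (abs_nonneg b) hσ.le]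
  calc 2 * (b ^ 2 + 2 * |b| * |y|) * ∑ j ∈ Finset.range (n + 1), 1 / (σ + |y| + j) ^ 2
      ≤ 2 * (b ^ 2 + 2 * |b| * |y|) * (1 / (σ + |y|) ^ 2 + 1 / (σ + |y|)) := by gcongr
    _ = 2 * ((b ^ 2 + 2 * |b| * |y|) / (σ + |y|)) * (1 / (σ + |y|) + 1) := by field_simp
    _ ≤ 2 * (b ^ 2 / σ + 2 * |b|) * (1 / σ + 1) := by
      gcongr
      simp

lemma prod_norm_add_natCast_le (n : ℕ) :
    ∏ j ∈ Finset.range (n + 1), ‖(σ + (y - b : ℝ) * Complex.I + j : ℂ)‖ ≤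
      (∏ j ∈ Finset.range (n + 1), ‖(σ + y * Complex.I + j : ℂ)‖) *
        Real.exp (2 * (b ^ 2 / σ + 2 * |b|) * (1 / σ + 1)) := by
  refine (Finset.prod_le_prod (fun _ _ => norm_nonneg _)
    fun j _ => norm_add_natCast_le_mul_exp hσ b y j).trans ?_
  rw [Finset.prod_mul_distrib, ← Real.exp_sum, ← Finset.mul_sum]
  exact mul_le_mul_of_nonneg_left (Real.exp_le_exp.mpr (mul_sum_one_div_sq_le hσ b y n))
    (Finset.prod_nonneg fun _ _ => norm_nonneg _)

omit hσ in
lemma norm_GammaSeq {n : ℕ} (hn : 0 < n) :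
    ‖Complex.GammaSeq (σ + y * Complex.I) n‖ = (n : ℝ) ^ σ * n.factorial /
      ∏ j ∈ Finset.range (n + 1), ‖(σ + y * Complex.I + j : ℂ)‖ := by
  rw [Complex.GammaSeq, norm_div, norm_mul, norm_prod, Complex.norm_natCast,
    Complex.norm_natCast_cpow_of_pos hn]
  simp

/-- Euler's product gives `|Γ(σ + iy) / Γ(σ + i(y - b))|² = ∏ⱼ (1 + (b² - 2by) / ((σ + j)² + y²))`,
and `∑ⱼ |y| / ((σ + j)² + y²)` is bounded in `y`, so that Stirling's formula can be avoided. -/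
theorem norm_Gamma_vertical_le :
    ‖Complex.Gamma (σ + y * Complex.I)‖ ≤ Real.exp (2 * (b ^ 2 / σ + 2 * |b|) * (1 / σ + 1)) *
      ‖Complex.Gamma (σ + (y - b : ℝ) * Complex.I)‖ := by
  refine le_of_tendsto_of_tendsto (Complex.GammaSeq_tendsto_Gamma _).norm
    ((Complex.GammaSeq_tendsto_Gamma _).norm.const_mul _) ?_
  filter_upwards [eventually_gt_atTop 0] with n hn
  have hpos (u : ℝ) : 0 < ∏ j ∈ Finset.range (n + 1), ‖(σ + u * Complex.I + j : ℂ)‖ := by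
    refine Finset.prod_pos fun j _ => norm_pos_iff.mpr fun h => ?_
    have hre := congrArg Complex.re h
    simp only [Complex.add_re, Complex.ofReal_re, Complex.re_ofReal_mul, Complex.I_re, mul_zero,
      add_zero, Complex.natCast_re, Complex.zero_re] at hre
    linarith [(Nat.cast_nonneg j : (0 : ℝ) ≤ j)]
  rw [norm_GammaSeq _ hn, norm_GammaSeq _ hn, mul_div_assoc', div_le_div_iff₀ (hpos _) (hpos _),
    mul_comm (Real.exp _), mul_assoc _ (Real.exp _), mul_comm (Real.exp _)]
  exact mul_le_mul_of_nonneg_left (prod_norm_add_natCast_le hσ b y n) (by positivity)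

end GammaVertical

lemma continuous_Gamma_comp {X : Type*} [TopologicalSpace X] {f : X → ℂ} (hf : Continuous f)
    (hre : ∀ x, 0 < (f x).re) : Continuous fun x => Complex.Gamma (f x) := by
  refine continuous_iff_continuousAt.mpr fun x => ContinuousAt.comp (g := Complex.Gamma)
    (Complex.differentiableAt_Gamma _ fun n hn => ?_).continuousAt hf.continuousAt
  have := hre x
  rw [hn, Complex.neg_re, Complex.natCast_re] at this
  linarith [(Nat.cast_nonneg n : (0 : ℝ) ≤ n)]

/-! ### The function `Ξ_m` -/

section Xi

variable {m : ℂ} (hm : -1 < m.re)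

include hm

lemma Xi_numerator_re_pos (t : ℝ) : 0 < ((m + 1 + Complex.I * t) / 2).re := by
  simp
  linarith

lemma Xi_denominator_re_pos (t : ℝ) : 0 < ((m + 1 - Complex.I * t) / 2).re := by
  simpa [← sub_eq_add_neg] using Xi_numerator_re_pos hm (-t)

lemma Xi_denominator_ne_zero (t : ℝ) : Complex.Gamma ((m + 1 - Complex.I * t) / 2) ≠ 0 :=
  Complex.Gamma_ne_zero_of_re_pos (Xi_denominator_re_pos hm t)

lemma Xi_ne_zero (t : ℝ) : Xi m t ≠ 0 :=
  mul_ne_zero (Complex.exp_ne_zero _) <| div_ne_zero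
    (Complex.Gamma_ne_zero_of_re_pos (Xi_numerator_re_pos hm t)) (Xi_denominator_ne_zero hm t)

omit hm in
lemma inv_Xi (m : ℂ) (t : ℝ) : (Xi m t)⁻¹ = Xi m (-t) := by
  simp only [Xi, Complex.ofReal_neg, mul_neg, sub_neg_eq_add, ← sub_eq_add_neg, Complex.exp_neg]
  rw [mul_inv, inv_div]

lemma continuous_Xi : Continuous (Xi m) :=
  Continuous.mul (by fun_prop) <| Continuous.div
    (continuous_Gamma_comp (by fun_prop) (Xi_numerator_re_pos hm))
    (continuous_Gamma_comp (by fun_prop) (Xi_denominator_re_pos hm)) (Xi_denominator_ne_zero hm)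

lemma continuous_inv_Xi : Continuous fun t => (Xi m t)⁻¹ :=
  (continuous_Xi hm).inv₀ (Xi_ne_zero hm)

/-- The two arguments of the Gamma function are, up to conjugation, points of a vertical line
whose distance `m.im` does not depend on `t`. -/
theorem exists_norm_Xi_le : ∃ C : ℝ, ∀ t, ‖Xi m t‖ ≤ C := by
  have hσ : 0 < (m.re + 1) / 2 := by linarith
  refine ⟨Real.exp (2 * (m.im ^ 2 / ((m.re + 1) / 2) + 2 * |m.im|) * (1 / ((m.re + 1) / 2) + 1)),
    fun t => ?_⟩
  have hphase : ‖Complex.exp (Complex.I * Real.log 2 * t)‖ = 1 := by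
    rw [mul_assoc, ← Complex.ofReal_mul, Complex.norm_exp_I_mul_ofReal]
  have hnum : (m + 1 + Complex.I * t) / 2 =
      ((m.re + 1) / 2 : ℝ) + ((m.im + t) / 2 : ℝ) * Complex.I := by
    apply Complex.ext <;> simp
  have hden : (m + 1 - Complex.I * t) / 2 = (starRingEnd ℂ)
      (((m.re + 1) / 2 : ℝ) + ((m.im + t) / 2 - m.im : ℝ) * Complex.I) := by
    rw [Complex.ext_iff, Complex.conj_re, Complex.conj_im]
    constructor
    · simp
    · simp
      ring
  rw [Xi, norm_mul, hphase, one_mul, norm_div,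
    div_le_iff₀ (norm_pos_iff.mpr (Xi_denominator_ne_zero hm t)), hnum, hden, Complex.Gamma_conj,
    Complex.norm_conj]
  exact norm_Gamma_vertical_le hσ m.im _

end Xi

/-! ### Dominated convergence and multiplication operators in `L^p` -/

theorem tendsto_eLpNorm_zero_of_dominated {α ι E : Type*} [MeasurableSpace α] {ν : Measure α}
    [NormedAddCommGroup E] {p : ENNReal} (hp : p ≠ ⊤) {l : Filter ι} [l.IsCountablyGenerated]
    {F : ι → α → E} {bound : α → ℝ} (hbound : MemLp bound p ν)
    (hF : ∀ i, AEStronglyMeasurable (F i) ν) (hle : ∀ i, ∀ᵐ x ∂ν, ‖F i x‖ ≤ bound x)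
    (hlim : ∀ᵐ x ∂ν, Tendsto (fun i => F i x) l (𝓝 0)) :
    Tendsto (fun i => eLpNorm (F i) p ν) l (𝓝 0) := by
  rcases eq_or_ne p 0 with rfl | hp0
  · simpa using tendsto_const_nhds
  have hr : 0 < p.toReal := ENNReal.toReal_pos hp0 hp
  have hintegral : Tendsto (fun i => ∫⁻ x, ‖F i x‖ₑ ^ p.toReal ∂ν) l (𝓝 0) := by
    rw [← lintegral_zero (μ := ν)]
    refine tendsto_of_seq_tendsto fun i hi => tendsto_lintegral_of_dominated_convergence'
      (fun x => ‖bound x‖ₑ ^ p.toReal) (fun n => (hF (i n)).enorm.pow_const _) (fun n => ?_)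
      (lintegral_rpow_enorm_lt_top_of_eLpNorm_lt_top hp0 hp hbound.2).ne ?_
    · filter_upwards [hle (i n)] with x hx
      exact ENNReal.rpow_le_rpow (enorm_le_iff_norm_le.mpr (hx.trans (le_abs_self _))) hr.le
    · filter_upwards [hlim] with x hx
      simpa [hr] using ((hx.comp hi).enorm).ennrpow_const p.toReal
  simp only [eLpNorm_eq_lintegral_rpow_enorm_toReal hp0 hp]
  simpa [hr] using hintegral.ennrpow_const (1 / p.toReal)

section BoundedMul

variable {α : Type*} [MeasurableSpace α] {ν : Measure α}

/-- Multiplication by an essentially bounded function, as a bounded operator on `L²(ν)`. -/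
def boundedMul {a : α → ℂ} (ha : MemLp a ⊤ ν) : Lp ℂ 2 ν →L[ℂ] Lp ℂ 2 ν :=
  (ContinuousLinearMap.mul ℂ ℂ).holderL ν ⊤ 2 2 (ha.toLp a)

lemma boundedMul_coe {a : α → ℂ} (ha : MemLp a ⊤ ν) (f : Lp ℂ 2 ν) :
    ⇑(boundedMul ha f) =ᵐ[ν] fun s => a s * f s := by
  filter_upwards [(ContinuousLinearMap.mul ℂ ℂ).coeFn_holder (r := 2) (ha.toLp a) f,
    ha.coeFn_toLp] with s h hs
  exact h.trans (by rw [hs]; rfl)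

end BoundedMul

/-! ### The Cayley transform and uniqueness of the functional calculus -/

lemma mem_conjOp_graph {E F : Type*} [AddCommGroup E] [Module ℂ E] [AddCommGroup F] [Module ℂ F]
    (W : E ≃ₗ[ℂ] F) (T : F →ₗ.[ℂ] F) (p : E × E) :
    p ∈ (conjOp W T).graph ↔ (W p.1, W p.2) ∈ T.graph := by
  obtain ⟨x, y⟩ := p
  simp only [LinearPMap.mem_graph_iff]
  constructor
  · rintro ⟨z, rfl, rfl⟩
    exact ⟨⟨W z, z.2⟩, rfl, (W.apply_symm_apply _).symm⟩
  · rintro ⟨z, hz, hy⟩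
    have hx : W x ∈ T.domain := hz ▸ z.2
    obtain rfl : z = ⟨W x, hx⟩ := Subtype.ext hz
    exact ⟨⟨x, hx⟩, rfl, W.symm_apply_eq.mpr hy⟩

lemma ofReal_add_I_ne_zero (t : ℝ) : (t + Complex.I : ℂ) ≠ 0 := fun h => by
  simpa using congrArg Complex.im h

/-- The Cayley transform `t ↦ (t - i) / (t + i)`, which turns multiplication by an unbounded real
function into a unitary operator. -/
def cayley (t : ℝ) : Metric.sphere (0 : ℂ) 1 :=
  ⟨(t - Complex.I) / (t + Complex.I), by
    have hconj : ‖(t - Complex.I : ℂ)‖ = ‖(t + Complex.I : ℂ)‖ := by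
      rw [← Complex.norm_conj]
      simp
    rw [mem_sphere_zero_iff_norm, norm_div, hconj,
      div_self (norm_ne_zero_iff.mpr (ofReal_add_I_ne_zero t))]⟩

lemma continuous_cayley : Continuous cayley :=
  Continuous.subtype_mk (Continuous.div (by fun_prop) (by fun_prop) ofReal_add_I_ne_zero) _

lemma one_sub_cayley (t : ℝ) : 1 - (cayley t : ℂ) = 2 * Complex.I / (t + Complex.I) := by
  have := ofReal_add_I_ne_zero t
  simp only [cayley]
  field_simp
  ring

/-- A left inverse of the Cayley transform; its value at `1` is irrelevant. -/
def invCayley (z : Metric.sphere (0 : ℂ) 1) : ℝ := (Complex.I * (1 + z) / (1 - z)).re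

lemma invCayley_cayley (t : ℝ) : invCayley (cayley t) = t := by
  have := ofReal_add_I_ne_zero t
  have h : Complex.I * (1 + (cayley t : ℂ)) / (1 - cayley t) = t := by
    rw [one_sub_cayley]
    simp only [cayley]
    field_simp
    ring
  rw [invCayley, h, Complex.ofReal_re]

lemma continuousAt_invCayley {z : Metric.sphere (0 : ℂ) 1} (hz : (z : ℂ) ≠ 1) :
    ContinuousAt invCayley z :=
  Complex.continuous_re.continuousAt.comp <|
    ContinuousAt.div (by fun_prop) (by fun_prop) (sub_ne_zero.mpr hz.symm)

/-- The factor `1 / (t + i)` makes a bounded continuous function of `t` extend continuously to the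
point `1`, which the Cayley transform omits. -/
lemma exists_circle_resolvent {φ : ℝ → ℂ} (hφ : Continuous φ) {C : ℝ} (hC : ∀ t, ‖φ t‖ ≤ C) :
    ∃ c : C(Metric.sphere (0 : ℂ) 1, ℂ), ∀ t, c (cayley t) = φ t / (t + Complex.I) := by
  refine ⟨⟨fun z => (1 - z) / (2 * Complex.I) * φ (invCayley z),
    continuous_iff_continuousAt.mpr fun z => ?_⟩, fun t => ?_⟩
  · by_cases hz : (z : ℂ) = 1
    · have hbound : Tendsto (fun w : Metric.sphere (0 : ℂ) 1 =>
          ‖(1 - (w : ℂ)) / (2 * Complex.I)‖ * C) (𝓝 z) (𝓝 0) := by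
        have : Continuous fun w : Metric.sphere (0 : ℂ) 1 =>
          ‖(1 - (w : ℂ)) / (2 * Complex.I)‖ * C := by fun_prop
        simpa [hz] using this.tendsto z
      rw [ContinuousAt, hz, sub_self, zero_div, zero_mul]
      refine squeeze_zero_norm (fun w => ?_) hbound
      rw [norm_mul]
      gcongr
      exact hC _
    · exact ContinuousAt.mul (by fun_prop) (hφ.continuousAt.comp (continuousAt_invCayley hz))
  · rw [ContinuousMap.coe_mk, invCayley_cayley, one_sub_cayley]
    field_simp

section CircleMul

variable {α : Type*} [MeasurableSpace α] {h : α → ℝ}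

lemma memLp_circle (ν : Measure α) (hh : Measurable h) (c : C(Metric.sphere (0 : ℂ) 1, ℂ)) :
    MemLp (fun s => c (cayley (h s))) ⊤ ν :=
  memLp_top_of_bound
    ((c.continuous.comp continuous_cayley).measurable.comp hh).aestronglyMeasurable ‖c‖
    (ae_of_all _ fun _ => c.norm_coe_le_norm _)

/-- The continuous functional calculus `c ↦ c(u)`, where the unitary operator `u` on `L²(ν)` is the
Cayley transform of multiplication by `h`. -/
def circleMul (ν : Measure α) (hh : Measurable h) :
    C(Metric.sphere (0 : ℂ) 1, ℂ) →⋆ₐ[ℂ] (Lp ℂ 2 ν →L[ℂ] Lp ℂ 2 ν) where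
  toFun c := boundedMul (memLp_circle ν hh c)
  map_one' := by
    ext1 f
    refine Lp.ext ((boundedMul_coe (memLp_circle ν hh 1) f).trans (ae_of_all _ fun s => ?_))
    simp
  map_zero' := by
    ext1 f
    refine Lp.ext ((boundedMul_coe (memLp_circle ν hh 0) f).trans ?_)
    filter_upwards [Lp.coeFn_zero ℂ 2 ν] with s hs
    rw [ContinuousMap.zero_apply, zero_mul]
    exact hs.symm
  map_mul' c d := by
    ext1 f
    refine Lp.ext ((boundedMul_coe (memLp_circle ν hh (c * d)) f).trans ?_)
    filter_upwards [boundedMul_coe (memLp_circle ν hh d) f,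
      boundedMul_coe (memLp_circle ν hh c) (boundedMul (memLp_circle ν hh d) f)] with s hd hcd
    rw [mul_apply_eq_comp, hcd, hd, ContinuousMap.mul_apply, mul_assoc]
  map_add' c d := by
    ext1 f
    refine Lp.ext ((boundedMul_coe (memLp_circle ν hh (c + d)) f).trans ?_)
    filter_upwards [boundedMul_coe (memLp_circle ν hh c) f, boundedMul_coe (memLp_circle ν hh d) f,
      Lp.coeFn_add (boundedMul (memLp_circle ν hh c) f) (boundedMul (memLp_circle ν hh d) f)]
      with s hc hd hadd
    rw [ContinuousMap.add_apply, add_mul, ← hc, ← hd]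
    exact hadd.symm
  commutes' r := by
    ext1 f
    refine Lp.ext ((boundedMul_coe (memLp_circle ν hh (algebraMap ℂ _ r)) f).trans ?_)
    filter_upwards [Lp.coeFn_smul r f] with s hs
    rw [ContinuousLinearMap.algebraMap_apply, hs]
    simp
  map_star' c := by
    rw [ContinuousLinearMap.star_eq_adjoint, ContinuousLinearMap.eq_adjoint_iff]
    intro f g
    rw [L2.inner_def, L2.inner_def]
    refine integral_congr_ae ?_
    filter_upwards [boundedMul_coe (memLp_circle ν hh (star c)) f,
      boundedMul_coe (memLp_circle ν hh c) g] with s hf hg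
    refine (congrArg (inner ℂ · (g s)) hf).trans ?_
    simp only [hg, RCLike.inner_apply, ContinuousMap.star_apply, map_mul, RCLike.star_def,
      RCLike.conj_conj]
    ring

lemma circleMul_coe (ν : Measure α) (hh : Measurable h) (c : C(Metric.sphere (0 : ℂ) 1, ℂ))
    (f : Lp ℂ 2 ν) : ⇑(circleMul ν hh c f) =ᵐ[ν] fun s => c (cayley (h s)) * f s :=
  boundedMul_coe (memLp_circle ν hh c) f

/-- With `u` the Cayley transform of `T`, the identity `T (1 - u) = i (1 + u)`. -/
lemma mem_mulGraph_iff_cayley {ν : Measure α} (hh : Measurable h) (f g : Lp ℂ 2 ν) :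
    (f - g, Complex.I • (f + g)) ∈ mulGraph ν (fun s => (h s : ℂ)) ↔
      g = circleMul ν hh (.restrict _ (.id ℂ)) f := by
  have hpt (z w : ℂ) (t : ℝ) : Complex.I * (z + w) = t * (z - w) ↔ w = (cayley t : ℂ) * z := by
    have := ofReal_add_I_ne_zero t
    simp only [cayley]
    field_simp
    constructor <;> intro heq <;> linear_combination heq
  rw [Lp.ext_iff]
  refine eventually_congr (f := ae ν) ?_
  filter_upwards [circleMul_coe ν hh (.restrict _ (.id ℂ)) f, Lp.coeFn_sub f g, Lp.coeFn_add f g,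
    Lp.coeFn_smul Complex.I (f + g)] with s hu hsub hadd hsmul
  rw [hu, hsmul, Pi.smul_apply, hadd, hsub]
  exact hpt _ _ _

variable {β : Type*} [MeasurableSpace β] {k : β → ℝ}

open scoped CStarAlgebra in
lemma conj_circleMul {ν : Measure α} {ρ : Measure β} (hh : Measurable h) (hk : Measurable k)
    (U : Lp ℂ 2 ν ≃ₗᵢ[ℂ] Lp ℂ 2 ρ)
    (hU : ∀ p ∈ mulGraph ν (fun s => (h s : ℂ)), (U p.1, U p.2) ∈ mulGraph ρ (fun s => (k s : ℂ)))
    (c : C(Metric.sphere (0 : ℂ) 1, ℂ)) (f : Lp ℂ 2 ν) :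
    U (circleMul ν hh c f) = circleMul ρ hk c (U f) := by
  have heq : (U.conjStarAlgEquiv : _ →⋆ₐ[ℂ] _).comp (circleMul ν hh) = circleMul ρ hk := by
    refine ContinuousMap.UniqueHom.eq_of_continuous_of_map_id _ _ _ (map_continuous _)
      (map_continuous _) ?_
    ext1 g
    have hg := hU _ ((mem_mulGraph_iff_cayley hh (U.symm g) _).mpr rfl)
    rw [map_sub, map_smul, map_add, U.apply_symm_apply, mem_mulGraph_iff_cayley hk] at hg
    exact hg
  have := DFunLike.congr_fun (DFunLike.congr_fun heq c) (U f)
  simpa using this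

end CircleMul

/-- Both unitaries of the definition diagonalize `(T + i)⁻¹` and `φ(T) (T + i)⁻¹`, which are
continuous functions of the Cayley transform of `T`. -/
theorem IsFunctionOf.unique {E : Type*} [NormedAddCommGroup E] [InnerProductSpace ℂ E]
    {T : E →ₗ.[ℂ] E} {φ : ℝ → ℂ} (hφ : Continuous φ) {C : ℝ} (hC : ∀ t, ‖φ t‖ ≤ C)
    {B B' : E →L[ℂ] E} (hB : IsFunctionOf T φ B) (hB' : IsFunctionOf T φ B') : B = B' := by
  obtain ⟨-, α, _, ν, W, h, hh, hT, hWB⟩ := hB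
  obtain ⟨-, β, _, ρ, V, k, hk, hT', hVB'⟩ := hB'
  have hU : ∀ p ∈ mulGraph ν (fun s => (h s : ℂ)),
      ((W.symm.trans V) p.1, (W.symm.trans V) p.2) ∈ mulGraph ρ (fun s => (k s : ℂ)) := by
    intro p hp
    have hgraph : (W.symm p.1, W.symm p.2) ∈ T.graph := by
      rw [hT, mem_conjOp_graph, mulOp_graph]
      simpa using hp
    rwa [hT', mem_conjOp_graph, mulOp_graph] at hgraph
  have hconj (c : C(Metric.sphere (0 : ℂ) 1, ℂ)) (f : E) :
      V (W.symm (circleMul ν hh c (W f))) = circleMul ρ hk c (V f) := by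
    simpa using conj_circleMul hh hk (W.symm.trans V) hU c (W f)
  obtain ⟨c, hc⟩ := exists_circle_resolvent hφ hC
  obtain ⟨r, hr⟩ := exists_circle_resolvent (φ := fun _ => 1) continuous_const (C := 1) (by simp)
  ext f
  have hW : circleMul ν hh c (W f) = circleMul ν hh r (W (B f)) := by
    refine Lp.ext ?_
    filter_upwards [circleMul_coe ν hh c (W f), circleMul_coe ν hh r (W (B f)), hWB f]
      with s hcs hrs hBs
    rw [hcs, hrs, hBs, hc, hr]
    ring
  have hV : circleMul ρ hk c (V f) = circleMul ρ hk r (V (B f)) := by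
    rw [← hconj, ← hconj, hW]
  refine V.injective (Lp.ext ?_)
  filter_upwards [circleMul_coe ρ hk c (V f), circleMul_coe ρ hk r (V (B f)), hVB' f]
    with s hcs hrs hBs
  have hs := ofReal_add_I_ne_zero (k s)
  rw [← hV, hcs, hc, hr] at hrs
  rw [hBs]
  field_simp at hrs
  exact hrs.symm

open scoped FourierTransform SchwartzMap

/-! ### The Fourier transformation on `L²(ℝ)` -/

/-- The Hilbert space `L²(ℝ)` of complex-valued functions. -/
abbrev LineL2 : Type := Lp ℂ 2 (volume : Measure ℝ)

lemma LineL2.integrable_mul (f : LineL2) (χ : 𝓢(ℝ, ℂ)) : Integrable fun x => f x * χ x :=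
  (Lp.memLp f).integrable_mul (χ.memLp 2 volume)

lemma LineL2.locallyIntegrable (f : LineL2) : LocallyIntegrable f :=
  (Lp.memLp f).locallyIntegrable (by norm_num)

lemma ae_eq_of_integral_schwartz {f g : ℝ → ℂ} (hf : LocallyIntegrable f)
    (hg : LocallyIntegrable g) (h : ∀ χ : 𝓢(ℝ, ℂ), ∫ x, f x * χ x = ∫ x, g x * χ x) :
    f =ᵐ[volume] g := by
  refine ae_eq_of_integral_contDiff_smul_eq hf hg fun ψ hψ hψc => ?_
  have hc : HasCompactSupport fun x => (ψ x : ℂ) :=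
    hψc.comp_left (g := fun t : ℝ => (t : ℂ)) Complex.ofReal_zero
  have heq : ∫ x, f x * (ψ x : ℂ) = ∫ x, g x * (ψ x : ℂ) :=
    h (hc.toSchwartzMap (Complex.ofRealCLM.contDiff.comp hψ))
  simpa only [Complex.real_smul, mul_comm] using heq

lemma integral_fourier_mul_schwartz (f : LineL2) (χ : 𝓢(ℝ, ℂ)) :
    ∫ x, (𝓕 f : LineL2) x * χ x = ∫ x, f x * (𝓕 χ : 𝓢(ℝ, ℂ)) x := by
  have h := congrArg (fun T => T χ) (Lp.fourier_toTemperedDistribution_eq f)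
  simp only [TemperedDistribution.fourier_apply, Lp.toTemperedDistribution_apply] at h
  simpa [mul_comm] using h.symm

theorem fourier_toLp_of_integrable {f : ℝ → ℂ} (hf : Integrable f) (hf2 : MemLp f 2) :
    ⇑(𝓕 (hf2.toLp f) : LineL2) =ᵐ[volume] 𝓕 f := by
  have hcont : Continuous (𝓕 f) :=
    VectorFourier.fourierIntegral_continuous Real.continuous_fourierChar (innerSL ℝ).continuous₂ hf
  refine ae_eq_of_integral_schwartz (LineL2.locallyIntegrable _) hcont.locallyIntegrable fun χ => ?_
  have hself : ∫ x, 𝓕 f x * χ x = ∫ x, f x * 𝓕 χ x := by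
    have := VectorFourier.integral_fourierIntegral_smul_eq_flip (L := innerₗ ℝ)
      (μ := volume) (ν := volume) Real.continuous_fourierChar continuous_inner hf χ.integrable
    rwa [flip_innerₗ] at this
  rw [integral_fourier_mul_schwartz, hself]
  refine integral_congr_ae ?_
  filter_upwards [hf2.coeFn_toLp] with x hx
  rw [hx, SchwartzMap.fourier_coe]

lemma fourier_comp_neg {f g : LineL2} (h : ⇑g =ᵐ[volume] fun x => f (-x)) :
    ⇑(𝓕 g : LineL2) =ᵐ[volume] fun x => (𝓕 f : LineL2) (-x) := by
  have hneg := Measure.measurePreserving_neg (volume : Measure ℝ)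
  have hloc : LocallyIntegrable fun x => (𝓕 f : LineL2) (-x) :=
    ((Lp.memLp (𝓕 f : LineL2)).comp_measurePreserving hneg).locallyIntegrable (by norm_num)
  refine ae_eq_of_integral_schwartz (LineL2.locallyIntegrable _) hloc fun χ => ?_
  let χneg : 𝓢(ℝ, ℂ) := SchwartzMap.compCLMOfContinuousLinearEquiv ℂ
    (ContinuousLinearEquiv.neg ℝ (M := ℝ)) χ
  have hχneg (x : ℝ) : χneg x = χ (-x) := rfl
  have hfourier (x : ℝ) : (𝓕 χneg : 𝓢(ℝ, ℂ)) (-x) = (𝓕 χ : 𝓢(ℝ, ℂ)) x := by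
    rw [SchwartzMap.fourier_coe, SchwartzMap.fourier_coe, Real.fourier_real_eq,
      Real.fourier_real_eq, ← integral_neg_eq_self]
    simp [hχneg]
  calc ∫ x, (𝓕 g : LineL2) x * χ x
      = ∫ x, g x * (𝓕 χ : 𝓢(ℝ, ℂ)) x := integral_fourier_mul_schwartz g χ
    _ = ∫ x, f (-x) * (𝓕 χneg : 𝓢(ℝ, ℂ)) (-x) := by
      refine integral_congr_ae ?_
      filter_upwards [h] with x hx
      rw [hx, hfourier]
    _ = ∫ x, f x * (𝓕 χneg : 𝓢(ℝ, ℂ)) x :=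
      integral_neg_eq_self (fun x => f x * (𝓕 χneg : 𝓢(ℝ, ℂ)) x) volume
    _ = ∫ x, (𝓕 f : LineL2) x * χneg x := (integral_fourier_mul_schwartz f χneg).symm
    _ = ∫ x, (𝓕 f : LineL2) (-x) * χ x := by
      rw [← integral_neg_eq_self]
      simp only [hχneg, neg_neg]

/-! ### Logarithmic coordinates and the Mellin transformation -/

lemma image_exp_neg_univ : (fun u : ℝ => Real.exp (-u)) '' univ = Ioi 0 := by
  rw [image_univ, ← Real.range_exp]
  exact neg_surjective.range_comp Real.exp

lemma hasDerivAt_exp_neg (u : ℝ) :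
    HasDerivAt (fun u : ℝ => Real.exp (-u)) (-Real.exp (-u)) u := by
  simpa using (hasDerivAt_neg u).exp

lemma injOn_exp_neg : InjOn (fun u : ℝ => Real.exp (-u)) univ := fun a _ b _ h => by
  simpa using h

lemma lintegral_halfLine_exp (F : ℝ → ENNReal) :
    ∫⁻ x in Ioi (0 : ℝ), F x = ∫⁻ u, ENNReal.ofReal (Real.exp (-u)) * F (Real.exp (-u)) := by
  rw [← image_exp_neg_univ, lintegral_image_eq_lintegral_abs_deriv_mul MeasurableSet.univ
    (fun u _ => (hasDerivAt_exp_neg u).hasDerivWithinAt) injOn_exp_neg]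
  simp

lemma integral_halfLine_exp (F : ℝ → ℂ) :
    ∫ x in Ioi (0 : ℝ), F x = ∫ u, (Real.exp (-u) : ℂ) * F (Real.exp (-u)) := by
  rw [← image_exp_neg_univ, integral_image_eq_integral_abs_deriv_smul MeasurableSet.univ
    (fun u _ => (hasDerivAt_exp_neg u).hasDerivWithinAt) injOn_exp_neg]
  simp [Complex.real_smul]

lemma halfLine_apply_eq_zero_iff {s : Set ℝ} (hs : MeasurableSet s) :
    halfLine s = 0 ↔ ∀ᵐ u, Real.exp (-u) ∉ s := by
  rw [← lintegral_indicator_one hs, lintegral_halfLine_exp, lintegral_eq_zero_iff (by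
    exact Measurable.mul (by fun_prop) ((measurable_one.indicator hs).comp (by fun_prop)))]
  refine eventually_congr (Eventually.of_forall fun u => ?_)
  simp [Real.exp_pos]

lemma quasiMeasurePreserving_exp_neg :
    Measure.QuasiMeasurePreserving (fun u : ℝ => Real.exp (-u)) volume halfLine := by
  refine ⟨by fun_prop, Measure.AbsolutelyContinuous.mk fun s hs h => ?_⟩
  rw [Measure.map_apply (by fun_prop) hs]
  exact measure_eq_zero_iff_ae_notMem.mpr ((halfLine_apply_eq_zero_iff hs).mp h)

lemma quasiMeasurePreserving_neg_log :
    Measure.QuasiMeasurePreserving (fun x : ℝ => -Real.log x) halfLine volume := by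
  refine ⟨by fun_prop, Measure.AbsolutelyContinuous.mk fun s hs h => ?_⟩
  have hlog : Measurable fun x : ℝ => -Real.log x := by fun_prop
  rw [Measure.map_apply hlog hs, halfLine_apply_eq_zero_iff (hlog hs)]
  simpa using measure_eq_zero_iff_ae_notMem.mp h

/-- The function `u ↦ e^{-u/2} f(e^{-u})`: the function `f` in the logarithmic coordinate
`u = -ln x`, normalized so that `L²` norms are preserved. -/
def logPullback (f : ℝ → ℂ) (u : ℝ) : ℂ := (Real.exp (-u / 2) : ℂ) * f (Real.exp (-u))

lemma logPullback_mul (f g : ℝ → ℂ) (u : ℝ) :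
    logPullback f u * logPullback g u =
      (Real.exp (-u) : ℂ) * (f (Real.exp (-u)) * g (Real.exp (-u))) := by
  have : (Real.exp (-u) : ℂ) = Real.exp (-u / 2) * Real.exp (-u / 2) := by
    rw [← Complex.ofReal_mul, ← Real.exp_add]
    ring_nf
  rw [this, logPullback, logPullback]
  ring

lemma integral_logPullback_mul (f g : ℝ → ℂ) :
    ∫ u, logPullback f u * logPullback g u = ∫ x in Ioi (0 : ℝ), f x * g x := by
  rw [integral_halfLine_exp]
  simp only [logPullback_mul]

lemma eLpNorm_logPullback (f : ℝ → ℂ) : eLpNorm (logPullback f) 2 = eLpNorm f 2 halfLine := by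
  rw [eLpNorm_eq_lintegral_rpow_enorm_toReal (by norm_num) (by norm_num),
    eLpNorm_eq_lintegral_rpow_enorm_toReal (by norm_num) (by norm_num), lintegral_halfLine_exp]
  congr 1
  refine lintegral_congr fun u => ?_
  have hexp : ‖(Real.exp (-u / 2) : ℂ)‖ₑ = ENNReal.ofReal (Real.exp (-u / 2)) := by
    rw [← ofReal_norm, Complex.norm_real, Real.norm_of_nonneg (Real.exp_pos _).le]
  rw [logPullback, enorm_mul, hexp, ENNReal.mul_rpow_of_nonneg _ _ (by norm_num),
    ENNReal.ofReal_rpow_of_pos (Real.exp_pos _), ← Real.exp_mul]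
  simp

lemma logPullback_congr {f g : ℝ → ℂ} (h : f =ᵐ[halfLine] g) :
    logPullback f =ᵐ[volume] logPullback g := by
  filter_upwards [quasiMeasurePreserving_exp_neg.ae h] with u hu
  rw [logPullback, logPullback, hu]

lemma memLp_logPullback {f : ℝ → ℂ} (hf : MemLp f 2 halfLine) : MemLp (logPullback f) 2 :=
  ⟨AEStronglyMeasurable.mul (by fun_prop)
    (hf.1.comp_quasiMeasurePreserving quasiMeasurePreserving_exp_neg),
    (eLpNorm_logPullback f).trans_lt hf.2⟩

/-- The isometry `f ↦ (u ↦ e^{-u/2} f(e^{-u}))` from `L²[0, ∞[` to `L²(ℝ)`. -/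
def logIsometry : HalfLineL2 →ₗᵢ[ℂ] LineL2 where
  toFun f := (memLp_logPullback (Lp.memLp f)).toLp _
  map_add' f g := by
    refine Lp.ext ?_
    filter_upwards [(memLp_logPullback (Lp.memLp (f + g))).coeFn_toLp,
      (memLp_logPullback (Lp.memLp f)).coeFn_toLp, (memLp_logPullback (Lp.memLp g)).coeFn_toLp,
      logPullback_congr (Lp.coeFn_add f g),
      Lp.coeFn_add ((memLp_logPullback (Lp.memLp f)).toLp _)
        ((memLp_logPullback (Lp.memLp g)).toLp _)] with u hfg hf hg hadd hsum
    rw [hfg, hsum, Pi.add_apply, hf, hg, hadd]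
    simp only [logPullback, Pi.add_apply, mul_add]
  map_smul' c f := by
    refine Lp.ext ?_
    filter_upwards [(memLp_logPullback (Lp.memLp (c • f))).coeFn_toLp,
      (memLp_logPullback (Lp.memLp f)).coeFn_toLp, logPullback_congr (Lp.coeFn_smul c f),
      Lp.coeFn_smul c ((memLp_logPullback (Lp.memLp f)).toLp _)] with u hcf hf hsmul hprod
    rw [RingHom.id_apply, hcf, hprod, Pi.smul_apply, hf, hsmul]
    simp only [logPullback, Pi.smul_apply, smul_eq_mul]
    ring
  norm_map' f := by
    change ‖(memLp_logPullback (Lp.memLp f)).toLp _‖ = ‖f‖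
    rw [Lp.norm_toLp, eLpNorm_logPullback, Lp.norm_def]

lemma logIsometry_coe (f : HalfLineL2) : ⇑(logIsometry f) =ᵐ[volume] logPullback f :=
  (memLp_logPullback (Lp.memLp f)).coeFn_toLp

lemma logIsometry_toLp {f : ℝ → ℂ} (hf : MemLp f 2 halfLine) :
    logIsometry (hf.toLp f) = (memLp_logPullback hf).toLp _ :=
  Lp.ext <| (logIsometry_coe _).trans <|
    (logPullback_congr hf.coeFn_toLp).trans (memLp_logPullback hf).coeFn_toLp.symm

lemma logIsometry_surjective : Function.Surjective logIsometry := by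
  intro g
  let f (x : ℝ) : ℂ := (Real.exp (-Real.log x / 2) : ℂ) * g (-Real.log x)
  have hfg : logPullback f = g := by
    funext u
    simp only [logPullback, f, Real.log_exp, neg_neg]
    rw [← mul_assoc, ← Complex.ofReal_mul, ← Real.exp_add]
    simp [neg_div]
  have hf : MemLp f 2 halfLine := by
    refine ⟨AEStronglyMeasurable.mul (Measurable.aestronglyMeasurable (by fun_prop))
      ((Lp.aestronglyMeasurable g).comp_quasiMeasurePreserving quasiMeasurePreserving_neg_log), ?_⟩
    rw [← eLpNorm_logPullback, hfg]
    exact (Lp.memLp g).2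
  refine ⟨hf.toLp f, ?_⟩
  rw [logIsometry_toLp]
  exact Lp.ext ((memLp_logPullback hf).coeFn_toLp.trans (by rw [hfg]))

/-- The Mellin transformation, as a unitary operator from `L²[0, ∞[` onto `L²(ℝ)`. -/
def mellinL2 : HalfLineL2 ≃ₗᵢ[ℂ] LineL2 :=
  (LinearIsometryEquiv.ofSurjective logIsometry logIsometry_surjective).trans
    (Lp.fourierTransformₗᵢ ℝ ℂ)

lemma mellinL2_apply (f : HalfLineL2) : mellinL2 f = 𝓕 (logIsometry f) := rfl

theorem mellinL2_inversion (f : HalfLineL2) :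
    ⇑(mellinL2 (inversion f)) =ᵐ[volume] fun x => mellinL2 f (-x) := by
  refine fourier_comp_neg (f := logIsometry f) (g := logIsometry (inversion f)) ?_
  have hinv : ⇑(inversion f) =ᵐ[halfLine] fun x : ℝ => (x : ℂ)⁻¹ * f x⁻¹ :=
    (inversion_memLp f).coeFn_toLp
  have hneg := (Measure.measurePreserving_neg (volume : Measure ℝ)).quasiMeasurePreserving.ae
    (logIsometry_coe f)
  filter_upwards [logIsometry_coe (inversion f), logPullback_congr hinv, hneg] with u hu hinvu hnegu
  rw [hu, hinvu, hnegu, logPullback, logPullback, ← mul_assoc, ← Complex.ofReal_inv,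
    ← Complex.ofReal_mul, ← Real.exp_neg, ← Real.exp_add]
  ring_nf

open scoped LineDeriv

/-! ### Test functions in the logarithmic coordinate -/

theorem IsTest.of_comp_log {ψ : ℝ → ℂ} (hψ : ContDiff ℝ ∞ ψ) (hψc : HasCompactSupport ψ) :
    IsTest ((Ioi (0 : ℝ)).indicator fun x => ψ (Real.log x)) := by
  set φ := (Ioi (0 : ℝ)).indicator fun x => ψ (Real.log x)
  have hφ {x : ℝ} (hx : 0 < x) : φ x = ψ (Real.log x) := indicator_of_mem (mem_Ioi.mpr hx) _
  obtain ⟨R, hR⟩ := hψc.isCompact.isBounded.subset_closedBall 0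
  have hzero (x : ℝ) (hx : x ∉ Icc (Real.exp (-R)) (Real.exp R)) : φ x = 0 := by
    refine indicator_apply_eq_zero.mpr fun hpos => by_contra fun hne => hx ?_
    have hlog := hR (subset_tsupport ψ hne)
    rw [mem_closedBall_zero_iff, Real.norm_eq_abs, abs_le] at hlog
    exact ⟨(Real.le_log_iff_exp_le hpos).mp hlog.1, (Real.log_le_iff_le_exp hpos).mp hlog.2⟩
  have htsupport : tsupport φ ⊆ Icc (Real.exp (-R)) (Real.exp R) :=
    closure_minimal (fun x hx => by_contra fun hn => hx (hzero x hn)) isClosed_Icc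
  have hpos : tsupport φ ⊆ Ioi 0 := fun x hx => (Real.exp_pos _).trans_le (htsupport hx).1
  refine ⟨contDiff_iff_contDiffAt.mpr fun x => ?_, .intro isCompact_Icc hzero, hpos⟩
  by_cases hx : 0 < x
  · refine (hψ.contDiffAt.comp x (Real.contDiffAt_log.mpr hx.ne')).congr_of_eventuallyEq ?_
    filter_upwards [lt_mem_nhds hx] with y hy using hφ hy
  · exact contDiffAt_const.congr_of_eventuallyEq
      (notMem_tsupport_iff_eventuallyEq.mp fun h => hx (hpos h))

lemma contDiff_exp_neg_half : ContDiff ℝ ∞ fun u : ℝ => (Real.exp (-u / 2) : ℂ) :=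
  Complex.ofRealCLM.contDiff.comp
    (by fun_prop : ContDiff ℝ ∞ fun u : ℝ => Real.exp (-u / 2))

lemma IsTest.contDiff_logPullback {φ : ℝ → ℂ} (h : IsTest φ) : ContDiff ℝ ∞ (logPullback φ) :=
  contDiff_exp_neg_half.mul (h.contDiff.comp (by fun_prop))

lemma IsTest.hasCompactSupport_logPullback {φ : ℝ → ℂ} (h : IsTest φ) :
    HasCompactSupport (logPullback φ) := by
  have hK : IsCompact ((fun x => -Real.log x) '' tsupport φ) :=
    h.compact.isCompact.image_of_continuousOn
      (Real.continuousOn_log.mono fun x hx => (h.supp hx).ne').neg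
  refine HasCompactSupport.intro hK fun u hu => mul_eq_zero_of_right _ ?_
  exact image_eq_zero_of_notMem_tsupport fun hx => hu ⟨_, hx, by simp⟩

lemma exists_isTest_logPullback {ψ : ℝ → ℂ} (hψ : ContDiff ℝ ∞ ψ) (hψc : HasCompactSupport ψ) :
    ∃ φ, IsTest φ ∧ logPullback φ = ψ := by
  have hcont : ContDiff ℝ ∞ fun v : ℝ => (Real.exp (-v / 2) : ℂ) * ψ (-v) :=
    contDiff_exp_neg_half.mul (hψ.comp (by fun_prop))
  have hcomp : HasCompactSupport fun v : ℝ => (Real.exp (-v / 2) : ℂ) * ψ (-v) :=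
    HasCompactSupport.mul_left (hψc.comp_homeomorph (Homeomorph.neg ℝ))
  refine ⟨_, IsTest.of_comp_log hcont hcomp, funext fun u => ?_⟩
  rw [logPullback, indicator_of_mem (mem_Ioi.mpr (Real.exp_pos _)), Real.log_exp, neg_neg,
    ← mul_assoc, ← Complex.ofReal_mul, ← Real.exp_add]
  simp [neg_div]

lemma logPullback_dilationTranspose {φ : ℝ → ℂ} (h : Differentiable ℝ φ) (u : ℝ) :
    logPullback (dilationTranspose φ) u = -Complex.I * deriv (logPullback φ) u := by
  have hexp : HasDerivAt (fun u : ℝ => (Real.exp (-u / 2) : ℂ))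
      ((Real.exp (-u / 2) * (-1 / 2) : ℝ) : ℂ) u :=
    HasDerivAt.ofReal_comp ((((hasDerivAt_id u).neg).div_const 2).exp)
  have hφ : HasDerivAt (fun u : ℝ => φ (Real.exp (-u)))
      ((-Real.exp (-u)) • deriv φ (Real.exp (-u))) u :=
    (h _).hasDerivAt.scomp u (hasDerivAt_exp_neg u)
  have hderiv : deriv (logPullback φ) u = _ := (hexp.mul hφ).deriv
  rw [hderiv, logPullback, dilationTranspose, Complex.real_smul]
  push_cast
  ring

/-! ### Weak derivatives and the Fourier transformation -/

lemma tendsto_integral_dilate_mul {k : ℝ → ℝ} (hk : Continuous k) (hkc : HasCompactSupport k)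
    {g : ℝ → ℂ} (hg : Integrable g) :
    Tendsto (fun t : ℝ => ∫ u, (k (t * u) : ℂ) * g u) (𝓝 0) (𝓝 (k 0 * ∫ u, g u)) := by
  obtain ⟨D, hD⟩ := hkc.exists_bound_of_continuous hk
  rw [← integral_const_mul]
  refine tendsto_integral_filter_of_dominated_convergence (fun u => D * ‖g u‖)
    (.of_forall fun t => AEStronglyMeasurable.mul ?_ hg.1)
    (.of_forall fun t => ae_of_all _ fun u => ?_) (hg.norm.const_mul D) (ae_of_all _ fun u => ?_)
  · exact (Complex.continuous_ofReal.comp (by fun_prop)).aestronglyMeasurable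
  · rw [norm_mul, Complex.norm_real]
    gcongr
    exact hD _
  · have hlim : Continuous fun t : ℝ => (k (t * u) : ℂ) * g u :=
      (Complex.continuous_ofReal.comp (by fun_prop)).mul continuous_const
    simpa using hlim.tendsto 0

lemma integrable_dilate_mul {k : ℝ → ℝ} (hk : Continuous k) (hkc : HasCompactSupport k)
    {g : ℝ → ℂ} (hg : Integrable g) (t : ℝ) : Integrable fun u => (k (t * u) : ℂ) * g u := by
  obtain ⟨D, hD⟩ := hkc.exists_bound_of_continuous hk
  refine hg.bdd_mul (c := D) (Complex.continuous_ofReal.comp (by fun_prop)).aestronglyMeasurable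
    (ae_of_all _ fun u => ?_)
  rw [Complex.norm_real]
  exact hD _

lemma deriv_dilate_mul {θ : ℝ → ℝ} (hθ : Differentiable ℝ θ) {χ : ℝ → ℂ}
    (hχ : Differentiable ℝ χ) (t u : ℝ) :
    deriv (fun u => (θ (t * u) : ℂ) * χ u) u =
      θ (t * u) * deriv χ u + t * ((deriv θ (t * u) : ℝ) * χ u) := by
  have hdil : HasDerivAt (fun u => θ (t * u)) (deriv θ (t * u) * t) u :=
    HasDerivAt.comp (h₂ := θ) (h := fun u => t * u) u (hθ (t * u)).hasDerivAt
      (by simpa using (hasDerivAt_id u).const_mul t)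
  refine (hdil.ofReal_comp.mul (hχ u).hasDerivAt).deriv.trans ?_
  push_cast
  ring

lemma integral_dilate_mul_eq {F G χ : ℝ → ℂ} {c : ℂ}
    (hχ : ContDiff ℝ ∞ χ) (hF : Integrable fun u => F u * χ u)
    (hF' : Integrable fun u => F u * deriv χ u)
    (h : ∀ ψ : ℝ → ℂ, ContDiff ℝ ∞ ψ → HasCompactSupport ψ →
      ∫ u, G u * ψ u = c * ∫ u, F u * deriv ψ u)
    {θ : ℝ → ℝ} (hθ : ContDiff ℝ ∞ θ) (hθc : HasCompactSupport θ) {t : ℝ} (ht : t ≠ 0) :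
    ∫ u, (θ (t * u) : ℂ) * (G u * χ u) =
      c * ((∫ u, (θ (t * u) : ℂ) * (F u * deriv χ u)) +
        t * ∫ u, ((deriv θ (t * u) : ℝ) : ℂ) * (F u * χ u)) := by
  have hθ' : Continuous (deriv θ) := (contDiff_infty_iff_deriv.mp hθ).2.continuous
  have hsmooth : ContDiff ℝ ∞ fun u => (θ (t * u) : ℂ) * χ u :=
    (Complex.ofRealCLM.contDiff.comp (hθ.comp (by fun_prop))).mul hχ
  have hcompact : HasCompactSupport fun u => (θ (t * u) : ℂ) * χ u :=
    ((hθc.comp_homeomorph (Homeomorph.mulLeft₀ t ht)).comp_left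
      (g := fun r : ℝ => (r : ℂ)) Complex.ofReal_zero).mul_right
  calc ∫ u, (θ (t * u) : ℂ) * (G u * χ u)
      = ∫ u, G u * ((θ (t * u) : ℂ) * χ u) := by simp only [mul_left_comm]
    _ = c * ∫ u, F u * deriv (fun u => (θ (t * u) : ℂ) * χ u) u := h _ hsmooth hcompact
    _ = _ := by
      congr 1
      rw [← integral_const_mul, ← integral_add (integrable_dilate_mul hθ.continuous hθc hF' t)
        ((integrable_dilate_mul hθ' hθc.deriv hF t).const_mul _)]
      congr 1 with u
      rw [deriv_dilate_mul (hθ.differentiable (by simp)) (hχ.differentiable (by simp))]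
      ring

theorem integral_mul_eq_of_forall_hasCompactSupport {F G χ : ℝ → ℂ} {c : ℂ}
    (hχ : ContDiff ℝ ∞ χ) (hG : Integrable fun u => G u * χ u)
    (hF : Integrable fun u => F u * χ u) (hF' : Integrable fun u => F u * deriv χ u)
    (h : ∀ ψ : ℝ → ℂ, ContDiff ℝ ∞ ψ → HasCompactSupport ψ →
      ∫ u, G u * ψ u = c * ∫ u, F u * deriv ψ u) :
    ∫ u, G u * χ u = c * ∫ u, F u * deriv χ u := by
  let bump : ContDiffBump (0 : ℝ) := ⟨1, 2, one_pos, by norm_num⟩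
  obtain ⟨θ, hθ, hθc, hθ0⟩ : ∃ θ : ℝ → ℝ, ContDiff ℝ ∞ θ ∧ HasCompactSupport θ ∧ θ 0 = 1 :=
    ⟨bump, bump.contDiff, bump.hasCompactSupport, bump.one_of_mem_closedBall (by simp [bump])⟩
  have hθ' : Continuous (deriv θ) := (contDiff_infty_iff_deriv.mp hθ).2.continuous
  have hleft := tendsto_integral_dilate_mul hθ.continuous hθc hG
  have hright := ((tendsto_integral_dilate_mul hθ.continuous hθc hF').add
    ((Complex.continuous_ofReal.tendsto 0).mul
      (tendsto_integral_dilate_mul hθ' hθc.deriv hF))).const_mul c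
  simp only [hθ0, Complex.ofReal_one, one_mul, Complex.ofReal_zero, zero_mul, add_zero]
    at hleft hright
  refine tendsto_nhds_unique (hleft.mono_left (nhdsWithin_le_nhds (s := {0}ᶜ)))
    ((hright.mono_left nhdsWithin_le_nhds).congr' ?_)
  filter_upwards [self_mem_nhdsWithin] with t ht using
    (integral_dilate_mul_eq hχ hF hF' h hθ hθc ht).symm

lemma integral_mul_deriv_fourier (F : LineL2) (η : 𝓢(ℝ, ℂ)) :
    ∫ u, F u * deriv (𝓕 η : 𝓢(ℝ, ℂ)) u =
      ∫ x, (𝓕 F : LineL2) x * (-(2 * Real.pi * Complex.I) * (x * η x)) := by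
  have htemp : (fun x : ℝ => x).HasTemperateGrowth := by fun_prop
  have hderiv (u : ℝ) : deriv (𝓕 η : 𝓢(ℝ, ℂ)) u = (∂_{(1 : ℝ)} (𝓕 η) : 𝓢(ℝ, ℂ)) u := by
    rw [SchwartzMap.lineDerivOp_apply_eq_fderiv, fderiv_apply_one_eq_deriv]
  simp only [hderiv]
  rw [SchwartzMap.lineDerivOp_fourier_eq, ← integral_fourier_mul_schwartz]
  simp [SchwartzMap.smulLeftCLM_apply_apply htemp]

theorem fourier_eq_mul_iff_forall_integral_deriv (F G : LineL2) :
    ⇑(𝓕 G : LineL2) =ᵐ[volume] (fun x => ((-2 * Real.pi * x : ℝ) : ℂ) * (𝓕 F : LineL2) x) ↔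
      ∀ ψ : ℝ → ℂ, ContDiff ℝ ∞ ψ → HasCompactSupport ψ →
        ∫ u, G u * ψ u = -Complex.I * ∫ u, F u * deriv ψ u := by
  have hfourier (η : 𝓢(ℝ, ℂ)) : -Complex.I * ∫ u, F u * deriv (𝓕 η : 𝓢(ℝ, ℂ)) u =
      ∫ x, ((-2 * Real.pi * x : ℝ) : ℂ) * (𝓕 F : LineL2) x * η x := by
    rw [integral_mul_deriv_fourier, ← integral_const_mul]
    refine integral_congr_ae (ae_of_all _ fun x => ?_)
    push_cast
    linear_combination (2 * Real.pi * x * (𝓕 F : LineL2) x * η x) * Complex.I_sq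
  constructor
  · intro h ψ hψ hψc
    have hη : ⇑(𝓕 (𝓕⁻ (hψc.toSchwartzMap hψ)) : 𝓢(ℝ, ℂ)) = ψ := by
      rw [FourierTransform.fourier_fourierInv_eq]
      rfl
    rw [← hη, hfourier, ← integral_fourier_mul_schwartz]
    refine integral_congr_ae ?_
    filter_upwards [h] with x hx
    rw [hx]
  · intro h
    have hloc : LocallyIntegrable fun x : ℝ => ((-2 * Real.pi * x : ℝ) : ℂ) * (𝓕 F : LineL2) x := by
      have hcont : Continuous fun x : ℝ => ((-2 * Real.pi * x : ℝ) : ℂ) := by fun_prop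
      exact locallyIntegrableOn_univ.mp
        ((locallyIntegrableOn_univ.mpr (LineL2.locallyIntegrable (𝓕 F))).continuousOn_mul
          hcont.continuousOn isOpen_univ.isLocallyClosed)
    refine ae_eq_of_integral_schwartz (LineL2.locallyIntegrable _) hloc fun η => ?_
    rw [integral_fourier_mul_schwartz, ← hfourier]
    refine integral_mul_eq_of_forall_hasCompactSupport ((𝓕 η : 𝓢(ℝ, ℂ)).smooth ⊤)
      (LineL2.integrable_mul G _) (LineL2.integrable_mul F _) ?_ h
    exact LineL2.integrable_mul F (SchwartzMap.derivCLM ℂ ℂ (𝓕 η))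

/-! ### Functions of the generator of dilations -/

lemma integral_mul_eq_integral_logIsometry_mul (f : HalfLineL2) (φ : ℝ → ℂ) :
    ∫ x in Ioi (0 : ℝ), f x * φ x = ∫ u, logIsometry f u * logPullback φ u := by
  rw [← integral_logPullback_mul]
  refine integral_congr_ae ?_
  filter_upwards [logIsometry_coe f] with u hu
  rw [hu]

lemma integral_mul_dilationTranspose (f : HalfLineL2) {φ : ℝ → ℂ} (hφ : Differentiable ℝ φ) :
    ∫ x in Ioi (0 : ℝ), f x * dilationTranspose φ x =
      -Complex.I * ∫ u, logIsometry f u * deriv (logPullback φ) u := by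
  rw [integral_mul_eq_integral_logIsometry_mul, ← integral_const_mul]
  refine integral_congr_ae (ae_of_all _ fun u => ?_)
  simp only [logPullback_dilationTranspose hφ]
  ring

/-- The factor `-2π` combines the orientation of `u = -ln x` with the normalization of the Fourier
transformation. -/
theorem dilationGenerator_eq_conjOp : dilationGenerator =
    conjOp mellinL2.toLinearEquiv (mulOp volume fun x : ℝ => ((-2 * Real.pi * x : ℝ) : ℂ)) := by
  refine LinearPMap.eq_of_eq_graph (Submodule.ext fun p => ?_)
  rw [mem_conjOp_graph, mulOp_graph, dilationGenerator, weakOp_graph]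
  refine Iff.trans ?_
    (fourier_eq_mul_iff_forall_integral_deriv (logIsometry p.1) (logIsometry p.2)).symm
  have htranspose {φ : ℝ → ℂ} (hφ : IsTest φ) :=
    integral_mul_dilationTranspose p.1 (hφ.contDiff.differentiable (by simp))
  constructor
  · intro h ψ hψ hψc
    obtain ⟨φ, hφ, rfl⟩ := exists_isTest_logPullback hψ hψc
    rw [← integral_mul_eq_integral_logIsometry_mul, ← htranspose hφ]
    exact h φ hφ
  · intro h φ hφ
    rw [integral_mul_eq_integral_logIsometry_mul, htranspose hφ]
    exact h _ hφ.contDiff_logPullback hφ.hasCompactSupport_logPullback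

lemma memLp_top_comp_of_continuous {φ : ℝ → ℂ} (hφ : Continuous φ) {C : ℝ} (hC : ∀ t, ‖φ t‖ ≤ C) :
    MemLp (fun x : ℝ => φ (-2 * Real.pi * x)) ⊤ :=
  memLp_top_of_bound (hφ.comp (by fun_prop)).aestronglyMeasurable C (ae_of_all _ fun _ => hC _)

/-- `φ(A)` for a bounded continuous function `φ` of the generator of dilations `A`. -/
def dilationFunction (φ : ℝ → ℂ) (hφ : Continuous φ) {C : ℝ} (hC : ∀ t, ‖φ t‖ ≤ C) :
    HalfLineL2 →L[ℂ] HalfLineL2 :=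
  (mellinL2.symm.toContinuousLinearEquiv : LineL2 →L[ℂ] HalfLineL2) ∘L
    boundedMul (memLp_top_comp_of_continuous hφ hC) ∘L
    (mellinL2.toContinuousLinearEquiv : HalfLineL2 →L[ℂ] LineL2)

lemma mellinL2_dilationFunction {φ : ℝ → ℂ} (hφ : Continuous φ) {C : ℝ} (hC : ∀ t, ‖φ t‖ ≤ C)
    (f : HalfLineL2) : ⇑(mellinL2 (dilationFunction φ hφ hC f)) =ᵐ[volume]
      fun x => φ (-2 * Real.pi * x) * mellinL2 f x := by
  have h : mellinL2 (dilationFunction φ hφ hC f) =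
      boundedMul (memLp_top_comp_of_continuous hφ hC) (mellinL2 f) :=
    mellinL2.apply_symm_apply _
  rw [h]
  exact boundedMul_coe _ _

lemma isFunctionOf_dilationFunction {φ : ℝ → ℂ} (hφ : Continuous φ) {C : ℝ}
    (hC : ∀ t, ‖φ t‖ ≤ C) : IsFunctionOf dilationGenerator φ (dilationFunction φ hφ hC) :=
  ⟨hφ.measurable, ℝ, inferInstance, volume, mellinL2, fun x => -2 * Real.pi * x, by fun_prop,
    dilationGenerator_eq_conjOp, mellinL2_dilationFunction hφ hC⟩

theorem isFunctionOf_dilationGenerator_iff {φ : ℝ → ℂ} (hφ : Continuous φ) {C : ℝ}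
    (hC : ∀ t, ‖φ t‖ ≤ C) (B : HalfLineL2 →L[ℂ] HalfLineL2) :
    IsFunctionOf dilationGenerator φ B ↔ B = dilationFunction φ hφ hC :=
  ⟨fun h => h.unique hφ hC (isFunctionOf_dilationFunction _ _),
    fun h => h ▸ isFunctionOf_dilationFunction _ _⟩

lemma dilationFunction_dilationFunction_of_mul_eq_one {φ ψ : ℝ → ℂ} (hφ : Continuous φ) {C : ℝ}
    (hC : ∀ t, ‖φ t‖ ≤ C) (hψ : Continuous ψ) {C' : ℝ} (hC' : ∀ t, ‖ψ t‖ ≤ C')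
    (h : ∀ t, φ t * ψ t = 1) (f : HalfLineL2) :
    dilationFunction φ hφ hC (dilationFunction ψ hψ hC' f) = f := by
  refine mellinL2.injective (Lp.ext ?_)
  filter_upwards [mellinL2_dilationFunction hφ hC (dilationFunction ψ hψ hC' f),
    mellinL2_dilationFunction hψ hC' f] with x hφx hψx
  rw [hφx, hψx, ← mul_assoc, h, one_mul]

lemma inversion_inversion (f : HalfLineL2) : inversion (inversion f) = f := by
  refine mellinL2.injective (Lp.ext ?_)
  have hneg := (Measure.measurePreserving_neg (volume : Measure ℝ)).quasiMeasurePreserving.ae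
    (mellinL2_inversion f)
  filter_upwards [mellinL2_inversion (inversion f), hneg] with x hx hnegx
  rw [hx, hnegx, neg_neg]

section XiA

variable {m : ℂ} (hm : -1 < m.re)

include hm in
lemma norm_inv_Xi_le (t : ℝ) : ‖(Xi m t)⁻¹‖ ≤ (exists_norm_Xi_le hm).choose := by
  rw [inv_Xi]
  exact (exists_norm_Xi_le hm).choose_spec _

/-- The operator `Ξ_m(A)`, with its inverse `Ξ_m⁻¹(A)`. -/
def XiA : HalfLineL2 ≃L[ℂ] HalfLineL2 :=
  ContinuousLinearEquiv.equivOfInverse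
    (dilationFunction (Xi m) (continuous_Xi hm) (exists_norm_Xi_le hm).choose_spec)
    (dilationFunction (fun t => (Xi m t)⁻¹) (continuous_inv_Xi hm) (norm_inv_Xi_le hm))
    (dilationFunction_dilationFunction_of_mul_eq_one _ _ _ _
      fun t => inv_mul_cancel₀ (Xi_ne_zero hm t))
    (dilationFunction_dilationFunction_of_mul_eq_one _ _ _ _
      fun t => mul_inv_cancel₀ (Xi_ne_zero hm t))

theorem isFunctionOf_Xi_iff (B : HalfLineL2 →L[ℂ] HalfLineL2) :
    IsFunctionOf dilationGenerator (Xi m) B ↔ B = XiA hm :=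
  isFunctionOf_dilationGenerator_iff (continuous_Xi hm) (exists_norm_Xi_le hm).choose_spec B

theorem isFunctionOf_inv_Xi_iff (B : HalfLineL2 →L[ℂ] HalfLineL2) :
    IsFunctionOf dilationGenerator (fun t => (Xi m t)⁻¹) B ↔ B = (XiA hm).symm :=
  isFunctionOf_dilationGenerator_iff (continuous_inv_Xi hm) (norm_inv_Xi_le hm) B

lemma mellinL2_XiA (f : HalfLineL2) :
    ⇑(mellinL2 (XiA hm f)) =ᵐ[volume] fun x => Xi m (-2 * Real.pi * x) * mellinL2 f x :=
  mellinL2_dilationFunction (continuous_Xi hm) (exists_norm_Xi_le hm).choose_spec f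

lemma mellinL2_XiA_symm (f : HalfLineL2) :
    ⇑(mellinL2 ((XiA hm).symm f)) =ᵐ[volume]
      fun x => (Xi m (-2 * Real.pi * x))⁻¹ * mellinL2 f x :=
  mellinL2_dilationFunction (continuous_inv_Xi hm) (norm_inv_Xi_le hm) f

/-- The bounded operator `I Ξ_m(A)`, which turns out to be the Hankel transformation. -/
def hankelCLM : HalfLineL2 →L[ℂ] HalfLineL2 :=
  inversion.toContinuousLinearMap ∘L (XiA hm : HalfLineL2 →L[ℂ] HalfLineL2)

lemma hankelCLM_apply (f : HalfLineL2) : hankelCLM hm f = inversion (XiA hm f) := rfl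

lemma mellinL2_hankelCLM (f : HalfLineL2) :
    ⇑(mellinL2 (hankelCLM hm f)) =ᵐ[volume]
      fun x => Xi m (2 * Real.pi * x) * mellinL2 f (-x) := by
  have hneg := (Measure.measurePreserving_neg (volume : Measure ℝ)).quasiMeasurePreserving.ae
    (mellinL2_XiA hm f)
  filter_upwards [mellinL2_inversion (XiA hm f), hneg] with x hx hnegx
  rw [hankelCLM_apply, hx, hnegx]
  ring_nf

theorem hankelCLM_eq_XiA_symm_inversion (f : HalfLineL2) :
    hankelCLM hm f = (XiA hm).symm (inversion f) := by
  refine mellinL2.injective (Lp.ext ?_)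
  filter_upwards [mellinL2_hankelCLM hm f, mellinL2_XiA_symm hm (inversion f),
    mellinL2_inversion f] with x hhankel hsymm hinv
  rw [hhankel, hsymm, hinv, inv_Xi]
  ring_nf

theorem hankelCLM_hankelCLM (f : HalfLineL2) : hankelCLM hm (hankelCLM hm f) = f := by
  rw [hankelCLM_eq_XiA_symm_inversion hm (hankelCLM hm f), hankelCLM_apply, inversion_inversion,
    ContinuousLinearEquiv.symm_apply_apply]

end XiA

/-! ### Gaussians and their Mellin transforms -/

section Gauss

variable {m : ℂ} {a b : ℝ}

/-- The function `x^{m+1/2} e^{-a x²/2}`. The Gaussians are total in `L²[0, ∞[` and are permuted,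
up to scalars, by the Hankel transformation. -/
def gauss (m : ℂ) (a : ℝ) (x : ℝ) : ℂ :=
  (x : ℂ) ^ (m + 1 / 2) * Real.exp (-(a / 2) * x ^ 2)

lemma measurable_gauss (m : ℂ) (a : ℝ) : Measurable (gauss m a) :=
  (Complex.measurable_ofReal.pow_const _).mul (by fun_prop)

lemma norm_gauss (m : ℂ) (a : ℝ) {x : ℝ} (hx : 0 < x) :
    ‖gauss m a x‖ = x ^ (m.re + 1 / 2) * Real.exp (-(a / 2) * x ^ 2) := by
  rw [gauss, norm_mul, Complex.norm_cpow_eq_rpow_re_of_pos hx, Complex.norm_real,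
    Real.norm_of_nonneg (Real.exp_pos _).le]
  simp

lemma gauss_ne_zero (m : ℂ) (a : ℝ) {x : ℝ} (hx : 0 < x) : gauss m a x ≠ 0 := by
  rw [← norm_ne_zero_iff, norm_gauss m a hx]
  positivity

lemma gauss_add (m : ℂ) (a b x : ℝ) :
    gauss m (a + b) x = gauss m a x * Real.exp (-(b / 2) * x ^ 2) := by
  rw [gauss, gauss, mul_assoc, ← Complex.ofReal_mul, ← Real.exp_add]
  ring_nf

lemma gauss_add_two (m : ℂ) (a : ℝ) {x : ℝ} (hx : 0 < x) :
    gauss (m + 2) a x = (x : ℂ) ^ 2 * gauss m a x := by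
  have hx0 : (x : ℂ) ≠ 0 := Complex.ofReal_ne_zero.mpr hx.ne'
  have hexponent : m + 2 + 1 / 2 = m + 1 / 2 + (2 : ℕ) := by push_cast; ring
  rw [gauss, gauss, hexponent, Complex.cpow_add _ _ hx0, Complex.cpow_natCast]
  ring

lemma memLp_gauss (hm : -1 < m.re) (ha : 0 < a) : MemLp (gauss m a) 2 halfLine := by
  refine (memLp_two_iff_integrable_sq_norm (measurable_gauss m a).aestronglyMeasurable).mpr ?_
  refine (integrableOn_rpow_mul_exp_neg_mul_sq (s := 2 * m.re + 1) ha (by linarith)).congr ?_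
  filter_upwards [ae_restrict_mem measurableSet_Ioi] with x hx
  rw [norm_gauss m a hx, mul_pow, ← Real.rpow_mul_natCast (le_of_lt hx), ← Real.exp_nat_mul]
  push_cast
  ring_nf

lemma integrable_logPullback_gauss (hm : -1 < m.re) (ha : 0 < a) :
    Integrable (logPullback (gauss m a)) := by
  have hint := integrableOn_rpow_mul_exp_neg_mul_sq (b := a / 2) (by positivity) hm
  rw [← image_exp_neg_univ, integrableOn_image_iff_integrableOn_abs_deriv_smul MeasurableSet.univ
    (fun u _ => (hasDerivAt_exp_neg u).hasDerivWithinAt) injOn_exp_neg, integrableOn_univ] at hint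
  refine hint.mono' (memLp_logPullback (memLp_gauss hm ha)).1 (ae_of_all _ fun u => le_of_eq ?_)
  rw [logPullback, norm_mul, norm_gauss m a (Real.exp_pos _), Complex.norm_real,
    Real.norm_of_nonneg (Real.exp_pos _).le, abs_neg, abs_of_pos (Real.exp_pos _), smul_eq_mul]
  simp only [← Real.exp_mul, ← Real.exp_add]
  ring_nf

theorem mellin_gauss (m : ℂ) (ha : 0 < a) {s : ℂ} (hs : 0 < s.re + m.re + 1 / 2) :
    mellin (gauss m a) s = 1 / 2 * ((2 / a : ℝ) : ℂ) ^ ((s + m + 1 / 2) / 2) *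
      Complex.Gamma ((s + m + 1 / 2) / 2) := by
  have hgauss : gauss m a = fun x : ℝ => (x : ℂ) ^ (m + 1 / 2) •
      (fun y : ℝ => (fun t : ℝ => Complex.exp (-(((a / 2 : ℝ) : ℂ) * t))) (y ^ (2 : ℝ))) x := by
    funext x
    simp only [gauss, smul_eq_mul, Complex.ofReal_exp, Real.rpow_two]
    push_cast
    ring_nf
  have hexponent : (s + (m + 1 / 2)) / ((2 : ℝ) : ℂ) = (s + m + 1 / 2) / 2 := by push_cast; ring
  have hinv : 1 / ((a / 2 : ℝ) : ℂ) = ((2 / a : ℝ) : ℂ) := by push_cast; field_simp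
  rw [hgauss, mellin_cpow_smul,
    mellin_comp_rpow (fun t : ℝ => Complex.exp (-(((a / 2 : ℝ) : ℂ) * t))), hexponent, mellin]
  simp only [smul_eq_mul]
  rw [Complex.integral_cpow_mul_exp_neg_mul_Ioi (by simp; linarith) (by positivity), hinv,
    abs_of_pos two_pos, Complex.real_smul]
  push_cast
  ring

/-- The Gaussian `x^{m+1/2} e^{-a x²/2}` as an element of `L²[0, ∞[`. -/
def gaussL2 (hm : -1 < m.re) (ha : 0 < a) : HalfLineL2 := (memLp_gauss hm ha).toLp _

lemma gaussL2_coe (hm : -1 < m.re) (ha : 0 < a) : ⇑(gaussL2 hm ha) =ᵐ[halfLine] gauss m a :=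
  (memLp_gauss hm ha).coeFn_toLp

/-- The Mellin transform of `x^{m+1/2} e^{-a x²/2}` at the point `1/2 + i t` of the critical
line. -/
def gaussMellin (m : ℂ) (a t : ℝ) : ℂ :=
  1 / 2 * ((2 / a : ℝ) : ℂ) ^ ((m + 1 + Complex.I * t) / 2) *
    Complex.Gamma ((m + 1 + Complex.I * t) / 2)

theorem mellinL2_gaussL2 (hm : -1 < m.re) (ha : 0 < a) :
    ⇑(mellinL2 (gaussL2 hm ha)) =ᵐ[volume] fun x : ℝ => gaussMellin m a (2 * Real.pi * x) := by
  rw [mellinL2_apply, gaussL2, logIsometry_toLp]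
  refine (fourier_toLp_of_integrable (integrable_logPullback_gauss hm ha) _).trans
    (ae_of_all _ fun x => ?_)
  have hpullback : (fun u : ℝ => Real.exp (-(1 / 2) * u) • gauss m a (Real.exp (-u))) =
      logPullback (gauss m a) := by
    funext u
    rw [logPullback, Complex.real_smul]
    ring_nf
  have hre : (1 / 2 + Complex.I * (2 * Real.pi * x : ℝ) : ℂ).re = 1 / 2 := by simp
  have him : (1 / 2 + Complex.I * (2 * Real.pi * x : ℝ) : ℂ).im = 2 * Real.pi * x := by simp
  have hfourier := mellin_eq_fourier (gauss m a) (s := 1 / 2 + Complex.I * (2 * Real.pi * x : ℝ))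
  rw [hre, him, mellin_gauss m ha (by rw [hre]; linarith), hpullback,
    mul_div_cancel_left₀ x (by positivity)] at hfourier
  refine hfourier.symm.trans ?_
  simp only [gaussMellin]
  ring_nf

lemma Xi_mul_gaussMellin_neg (hm : -1 < m.re) (ha : 0 < a) (t : ℝ) :
    Xi m t * gaussMellin m a (-t) = (a : ℂ) ^ (-(m + 1)) * gaussMellin m a⁻¹ t := by
  have hden := Xi_denominator_ne_zero hm t
  have hneg : (m + 1 + Complex.I * ((-t : ℝ) : ℂ)) / 2 = (m + 1 - Complex.I * t) / 2 := by
    push_cast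
    ring
  have hcpow {b : ℝ} (hb : 0 < b) (z : ℂ) : (b : ℂ) ^ z = Complex.exp (Real.log b * z) := by
    rw [Complex.cpow_def_of_ne_zero (Complex.ofReal_ne_zero.mpr hb.ne'), Complex.ofReal_log hb.le]
  have hpower : Complex.exp (Complex.I * Real.log 2 * t) *
      ((2 / a : ℝ) : ℂ) ^ ((m + 1 - Complex.I * t) / 2) =
      (a : ℂ) ^ (-(m + 1)) * ((2 * a : ℝ) : ℂ) ^ ((m + 1 + Complex.I * t) / 2) := by
    rw [hcpow (b := 2 / a) (by positivity), hcpow (b := 2 * a) (by positivity), hcpow ha,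
      Real.log_div two_ne_zero ha.ne', Real.log_mul two_ne_zero ha.ne',
      ← Complex.exp_add, ← Complex.exp_add]
    congr 1
    push_cast
    ring
  rw [Xi, gaussMellin, gaussMellin, hneg, div_inv_eq_mul]
  field_simp
  linear_combination Complex.Gamma ((m + 1 + Complex.I * t) / 2) * hpower

lemma gaussMellin_add_two (hm : -1 < m.re) (ha : 0 < a) (t : ℝ) :
    gaussMellin (m + 2) a t = (m + 1 + Complex.I * t) / a * gaussMellin m a t := by
  have hne : (m + 1 + Complex.I * t) / 2 ≠ 0 := fun h => by
    have := congrArg Complex.re h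
    simp at this
    linarith
  have hshift : (m + 2 + 1 + Complex.I * t) / 2 = (m + 1 + Complex.I * t) / 2 + 1 := by ring
  have hbase : ((2 / a : ℝ) : ℂ) ≠ 0 := Complex.ofReal_ne_zero.mpr (by positivity)
  rw [gaussMellin, gaussMellin, hshift, Complex.Gamma_add_one _ hne, Complex.cpow_add _ _ hbase,
    Complex.cpow_one]
  push_cast
  ring

theorem hankelCLM_gaussL2 (hm : -1 < m.re) (ha : 0 < a) :
    hankelCLM hm (gaussL2 hm ha) = (a : ℂ) ^ (-(m + 1)) • gaussL2 hm (inv_pos.mpr ha) := by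
  refine mellinL2.injective (Lp.ext ?_)
  have hneg := (Measure.measurePreserving_neg (volume : Measure ℝ)).quasiMeasurePreserving.ae
    (mellinL2_gaussL2 hm ha)
  rw [map_smul]
  filter_upwards [mellinL2_hankelCLM hm (gaussL2 hm ha), hneg,
    mellinL2_gaussL2 hm (inv_pos.mpr ha),
    Lp.coeFn_smul ((a : ℂ) ^ (-(m + 1))) (mellinL2 (gaussL2 hm (inv_pos.mpr ha)))]
    with x hhankel hneg hinv hsmul
  rw [hhankel, hneg, hsmul, Pi.smul_apply, hinv, smul_eq_mul, ← Xi_mul_gaussMellin_neg hm ha,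
    mul_neg]

lemma neg_one_lt_add_two_re (hm : -1 < m.re) : -1 < (m + 2).re := by
  rw [Complex.add_re, Complex.re_ofNat]
  linarith

/-- The image of the Gaussian `x^{m+1/2} e^{-a x²/2}` under the differential expression
`L_{m²}`. -/
def schrodingerGauss (hm : -1 < m.re) (ha : 0 < a) : HalfLineL2 :=
  ((2 * m + 2) * a) • gaussL2 hm ha - ((a : ℂ) ^ 2) • gaussL2 (neg_one_lt_add_two_re hm) ha

lemma schrodingerGauss_coe (hm : -1 < m.re) (ha : 0 < a) :
    ⇑(schrodingerGauss hm ha) =ᵐ[halfLine]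
      fun x => ((2 * m + 2) * a - (a : ℂ) ^ 2 * (x : ℂ) ^ 2) * gauss m a x := by
  have hm2 := neg_one_lt_add_two_re hm
  filter_upwards [Lp.coeFn_sub (((2 * m + 2) * a) • gaussL2 hm ha) (((a : ℂ) ^ 2) • gaussL2 hm2 ha),
    Lp.coeFn_smul ((2 * m + 2) * a) (gaussL2 hm ha), gaussL2_coe hm ha,
    Lp.coeFn_smul ((a : ℂ) ^ 2) (gaussL2 hm2 ha), gaussL2_coe hm2 ha,
    ae_restrict_mem measurableSet_Ioi] with x hsub hsmul hgauss hsmul' hgauss' hx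
  rw [schrodingerGauss, hsub, Pi.sub_apply, hsmul, hsmul', Pi.smul_apply, Pi.smul_apply, hgauss,
    hgauss', gauss_add_two m a hx, smul_eq_mul, smul_eq_mul]
  ring

lemma mellinL2_schrodingerGauss (hm : -1 < m.re) (ha : 0 < a) :
    ⇑(mellinL2 (schrodingerGauss hm ha)) =ᵐ[volume] fun x : ℝ =>
      a * (m + 1 - Complex.I * (2 * Real.pi * x : ℝ)) * gaussMellin m a (2 * Real.pi * x) := by
  have hm2 := neg_one_lt_add_two_re hm
  have ha0 : (a : ℂ) ≠ 0 := Complex.ofReal_ne_zero.mpr ha.ne'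
  rw [schrodingerGauss, map_sub, map_smul, map_smul]
  filter_upwards [Lp.coeFn_sub (((2 * m + 2) * a) • mellinL2 (gaussL2 hm ha))
      (((a : ℂ) ^ 2) • mellinL2 (gaussL2 hm2 ha)),
    Lp.coeFn_smul ((2 * m + 2) * a) (mellinL2 (gaussL2 hm ha)), mellinL2_gaussL2 hm ha,
    Lp.coeFn_smul ((a : ℂ) ^ 2) (mellinL2 (gaussL2 hm2 ha)), mellinL2_gaussL2 hm2 ha]
    with x hsub hsmul hgauss hsmul' hgauss'
  rw [hsub, Pi.sub_apply, hsmul, hsmul', Pi.smul_apply, Pi.smul_apply, hgauss, hgauss',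
    gaussMellin_add_two hm ha, smul_eq_mul, smul_eq_mul]
  field_simp
  ring

theorem hankelCLM_schrodingerGauss (hm : -1 < m.re) (ha : 0 < a) :
    hankelCLM hm (schrodingerGauss hm ha) =
      (a : ℂ) ^ (-(m + 1)) • gaussL2 (neg_one_lt_add_two_re hm) (inv_pos.mpr ha) := by
  have hm2 := neg_one_lt_add_two_re hm
  refine mellinL2.injective (Lp.ext ?_)
  have hneg := (Measure.measurePreserving_neg (volume : Measure ℝ)).quasiMeasurePreserving.ae
    (mellinL2_schrodingerGauss hm ha)
  rw [map_smul]
  filter_upwards [mellinL2_hankelCLM hm (schrodingerGauss hm ha), hneg,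
    mellinL2_gaussL2 hm2 (inv_pos.mpr ha),
    Lp.coeFn_smul ((a : ℂ) ^ (-(m + 1))) (mellinL2 (gaussL2 hm2 (inv_pos.mpr ha)))]
    with x hhankel hneg hinv hsmul
  have hXi := Xi_mul_gaussMellin_neg hm ha (2 * Real.pi * x)
  rw [hhankel, hneg, hsmul, Pi.smul_apply, hinv, smul_eq_mul,
    gaussMellin_add_two hm (inv_pos.mpr ha), mul_neg]
  push_cast [div_inv_eq_mul] at hXi ⊢
  linear_combination (m + 1 + Complex.I * (2 * Real.pi * x)) * a * hXi

/-! ### Totality of the Gaussians -/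

lemma integrableOn_mul_exp_neg_sq_pow {E : ℝ → ℂ} (hE : IntegrableOn E (Ioi 0)) (n : ℕ) :
    IntegrableOn (fun x => E x * (Real.exp (-(1 / 2) * x ^ 2) ^ n : ℝ)) (Ioi 0) := by
  refine Integrable.mul_bdd (c := 1) hE (Continuous.aestronglyMeasurable (by fun_prop))
    (ae_of_all _ fun x => ?_)
  rw [Complex.norm_real, norm_pow, Real.norm_of_nonneg (Real.exp_pos _).le]
  exact pow_le_one₀ (Real.exp_pos _).le (Real.exp_le_one_iff.mpr (by nlinarith [sq_nonneg x]))

lemma integral_mul_polynomial_exp_eq_zero {E : ℝ → ℂ} (hE : IntegrableOn E (Ioi 0))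
    (h : ∀ n : ℕ, ∫ x in Ioi (0 : ℝ), E x * (Real.exp (-(1 / 2) * x ^ 2) ^ n : ℝ) = 0)
    (p : Polynomial ℝ) :
    IntegrableOn (fun x => E x * (p.eval (Real.exp (-(1 / 2) * x ^ 2)) : ℝ)) (Ioi 0) ∧
      ∫ x in Ioi (0 : ℝ), E x * (p.eval (Real.exp (-(1 / 2) * x ^ 2)) : ℝ) = 0 := by
  induction p using Polynomial.induction_on' with
  | add p q hp hq =>
    simp only [Polynomial.eval_add, Complex.ofReal_add, mul_add]
    exact ⟨hp.1.add hq.1, by rw [integral_add hp.1 hq.1, hp.2, hq.2, add_zero]⟩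
  | monomial n c =>
    simp only [Polynomial.eval_monomial, Complex.ofReal_mul, mul_left_comm (E _)]
    exact ⟨(integrableOn_mul_exp_neg_sq_pow hE n).const_mul _,
      by rw [integral_const_mul, h, mul_zero]⟩

/-- The variable `y = e^{-x²/2}` compactifies the half-line, so that continuous functions of `x` can
be approximated by polynomials in `y`. -/
lemma exists_continuousOn_comp_exp_neg_sq {ψ : ℝ → ℝ} (hψ : Continuous ψ)
    (hψc : HasCompactSupport ψ) :
    ∃ q : ℝ → ℝ, ContinuousOn q (Icc 0 1) ∧ ∀ x > 0, q (Real.exp (-(1 / 2) * x ^ 2)) = ψ x := by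
  obtain ⟨R, hR⟩ := hψc.isCompact.isBounded.subset_closedBall 0
  have hψ0 (x : ℝ) (hx : R < x) : ψ x = 0 := image_eq_zero_of_notMem_tsupport fun hmem => by
    have hle := hR hmem
    rw [mem_closedBall_zero_iff, Real.norm_eq_abs] at hle
    exact (hx.trans_le ((le_abs_self x).trans hle)).false
  have hlarge : ∀ᶠ y in 𝓝[≠] (0 : ℝ), ψ (Real.sqrt (-2 * Real.log y)) = 0 := by
    have htop : Tendsto (fun y => -2 * Real.log y) (𝓝[≠] 0) atTop :=
      Real.tendsto_log_nhdsNE_zero.const_mul_atBot_of_neg (by norm_num)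
    filter_upwards [htop.eventually_gt_atTop (R ^ 2)] with y hy using
      hψ0 _ (Real.lt_sqrt_of_sq_lt hy)
  refine ⟨Function.update (fun y => ψ (Real.sqrt (-2 * Real.log y))) 0 0, fun y hy => ?_,
    fun x hx => ?_⟩
  · refine ContinuousAt.continuousWithinAt ?_
    rcases eq_or_ne y 0 with rfl | hy0
    · rw [continuousAt_update_same]
      exact tendsto_const_nhds.congr' (hlarge.mono fun _ h => h.symm)
    · rw [continuousAt_update_of_ne hy0]
      exact hψ.continuousAt.comp (Real.continuous_sqrt.continuousAt.comp
        (continuousAt_const.mul (Real.continuousAt_log hy0)))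
  · rw [Function.update_of_ne (Real.exp_pos _).ne', Real.log_exp,
      show -2 * (-(1 / 2) * x ^ 2) = x ^ 2 by ring, Real.sqrt_sq hx.le]

lemma integral_mul_eq_zero_of_forall_exp_pow {E : ℝ → ℂ} (hE : IntegrableOn E (Ioi 0))
    (h : ∀ n : ℕ, ∫ x in Ioi (0 : ℝ), E x * (Real.exp (-(1 / 2) * x ^ 2) ^ n : ℝ) = 0)
    {ψ : ℝ → ℝ} (hψ : Continuous ψ) (hψc : HasCompactSupport ψ) :
    ∫ x in Ioi (0 : ℝ), E x * (ψ x : ℂ) = 0 := by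
  obtain ⟨q, hq, hqψ⟩ := exists_continuousOn_comp_exp_neg_sq hψ hψc
  have hψint : IntegrableOn (fun x => E x * (ψ x : ℂ)) (Ioi 0) := by
    obtain ⟨B, hB⟩ := hψc.exists_bound_of_continuous hψ
    refine Integrable.mul_bdd (c := B) hE
      (Complex.continuous_ofReal.comp hψ).aestronglyMeasurable (ae_of_all _ fun x => ?_)
    rw [Complex.norm_real]
    exact hB x
  have hle (ε : ℝ) (hε : 0 < ε) :
      ‖∫ x in Ioi (0 : ℝ), E x * (ψ x : ℂ)‖ ≤ ε * ∫ x in Ioi (0 : ℝ), ‖E x‖ := by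
    obtain ⟨p, hp⟩ := exists_polynomial_near_of_continuousOn 0 1 q hq ε hε
    obtain ⟨hpint, hp0⟩ := integral_mul_polynomial_exp_eq_zero hE h p
    rw [← sub_zero (∫ x in Ioi (0 : ℝ), E x * (ψ x : ℂ)), ← hp0, ← integral_sub hψint hpint,
      ← integral_const_mul]
    refine norm_integral_le_of_norm_le (hE.norm.const_mul ε) ?_
    filter_upwards [ae_restrict_mem measurableSet_Ioi] with x hx
    have hnear := hp (Real.exp (-(1 / 2) * x ^ 2))
      ⟨(Real.exp_pos _).le, Real.exp_le_one_iff.mpr (by nlinarith [sq_nonneg x])⟩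
    rw [hqψ x hx] at hnear
    rw [← mul_sub, ← Complex.ofReal_sub, norm_mul, Complex.norm_real, Real.norm_eq_abs,
      abs_sub_comm, mul_comm]
    gcongr
  have hlim : Tendsto (fun ε : ℝ => ε * ∫ x in Ioi (0 : ℝ), ‖E x‖) (𝓝[>] 0) (𝓝 0) := by
    have : Continuous fun ε : ℝ => ε * ∫ x in Ioi (0 : ℝ), ‖E x‖ := by fun_prop
    simpa using (this.tendsto 0).mono_left nhdsWithin_le_nhds
  exact norm_le_zero_iff.mp (ge_of_tendsto hlim (eventually_mem_nhdsWithin.mono hle))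

theorem ae_eq_zero_of_integral_mul_gauss {D : ℝ → ℂ} {a₀ : ℝ}
    (hD : IntegrableOn (fun x => D x * gauss m a₀ x) (Ioi 0))
    (h : ∀ a ≥ a₀, ∫ x in Ioi (0 : ℝ), D x * gauss m a x = 0) : D =ᵐ[halfLine] 0 := by
  have hpow (n : ℕ) : ∫ x in Ioi (0 : ℝ),
      D x * gauss m a₀ x * (Real.exp (-(1 / 2) * x ^ 2) ^ n : ℝ) = 0 := by
    rw [← h (a₀ + n) (by simp)]
    simp only [gauss_add, ← Real.exp_nat_mul, mul_assoc]
    ring_nf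
  have hzero : ∀ᵐ x, x ∈ Ioi (0 : ℝ) → D x * gauss m a₀ x = 0 := by
    refine isOpen_Ioi.ae_eq_zero_of_integral_contDiff_smul_eq_zero hD.locallyIntegrableOn
      fun ψ hψ hψc hψs => ?_
    rw [← setIntegral_eq_integral_of_forall_compl_eq_zero (s := Ioi 0) fun x hx => by
      rw [image_eq_zero_of_notMem_tsupport fun hmem => hx (hψs hmem), zero_smul]]
    simpa only [Complex.real_smul, mul_comm] using
      integral_mul_eq_zero_of_forall_exp_pow hD hpow hψ.continuous hψc
  filter_upwards [(ae_restrict_iff' measurableSet_Ioi).mpr hzero,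
    ae_restrict_mem measurableSet_Ioi] with x hx hpos
  exact (mul_eq_zero.mp hx).resolve_right (gauss_ne_zero m a₀ hpos)

theorem eq_top_of_mul_gauss_mem {w : ℝ → ℂ} (hw : ∀ x > 0, w x ≠ 0)
    {S : Submodule ℂ HalfLineL2} (hS : IsClosed (S : Set HalfLineL2))
    (h : ∀ b > 0, ∃ G ∈ S, ⇑G =ᵐ[halfLine] fun x => w x * gauss m b x) : S = ⊤ := by
  rw [← hS.submodule_topologicalClosure_eq, Submodule.topologicalClosure_eq_top_iff, eq_bot_iff]
  intro v hv
  rw [Submodule.mem_orthogonal'] at hv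
  have hpair (b : ℝ) (hb : 0 < b) :
      IntegrableOn (fun x => (w x * starRingEnd ℂ (v x)) * gauss m b x) (Ioi 0) ∧
        ∫ x in Ioi (0 : ℝ), (w x * starRingEnd ℂ (v x)) * gauss m b x = 0 := by
    obtain ⟨G, hG, hGw⟩ := h b hb
    have hinner : (fun x => inner ℂ (v x) (G x)) =ᵐ[halfLine]
        fun x => (w x * starRingEnd ℂ (v x)) * gauss m b x := by
      filter_upwards [hGw] with x hx
      rw [hx, RCLike.inner_apply]
      ring
    refine ⟨(L2.integrable_inner (𝕜 := ℂ) v G).congr hinner, ?_⟩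
    rw [← integral_congr_ae hinner, ← L2.inner_def]
    exact hv G hG
  have hzero := ae_eq_zero_of_integral_mul_gauss (hpair 1 one_pos).1
    fun a ha => (hpair a (one_pos.trans_le ha)).2
  refine Lp.eq_zero_iff_ae_eq_zero.mpr ?_
  filter_upwards [hzero, ae_restrict_mem measurableSet_Ioi] with x hx hpos
  simpa [hw x hpos] using hx

theorem ext_gaussL2 (hm : -1 < m.re) {S T : HalfLineL2 →L[ℂ] ℂ}
    (h : ∀ b (hb : 0 < b), S (gaussL2 hm hb) = T (gaussL2 hm hb)) : S = T := by
  have htop : LinearMap.eqLocus (S : HalfLineL2 →ₗ[ℂ] ℂ) (T : HalfLineL2 →ₗ[ℂ] ℂ) = ⊤ :=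
    eq_top_of_mul_gauss_mem (m := m) (w := fun _ => 1) (fun _ _ => one_ne_zero)
      (isClosed_eq S.continuous T.continuous)
      fun b hb => ⟨gaussL2 hm hb, h b hb, by simpa using gaussL2_coe hm hb⟩
  exact ContinuousLinearMap.ext fun f => htop.ge (Submodule.mem_top (x := f))

/-! ### The bilinear pairing -/

/-- The bilinear pairing `∫ f g` on `L²[0, ∞[`, for which the Hankel transformation is
symmetric even when `m` is not real. -/
def pairing (f : HalfLineL2) : HalfLineL2 →L[ℂ] ℂ := innerSL ℂ (star f)

lemma pairing_apply (f g : HalfLineL2) : pairing f g = ∫ x in Ioi (0 : ℝ), f x * g x := by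
  rw [pairing, innerSL_apply_apply, L2.inner_def]
  refine integral_congr_ae ?_
  filter_upwards [Lp.coeFn_star f] with x hx
  rw [hx, RCLike.inner_apply, Pi.star_apply]
  simp [mul_comm]

lemma pairing_comm (f g : HalfLineL2) : pairing f g = pairing g f := by
  rw [pairing_apply, pairing_apply]
  simp only [mul_comm]

lemma pairing_gaussL2 (hm : -1 < m.re) (ha : 0 < a) (hb : 0 < b) :
    pairing (gaussL2 hm ha) (gaussL2 hm hb) =
      1 / 2 * ((2 / (a + b) : ℝ) : ℂ) ^ (m + 1) * Complex.Gamma (m + 1) := by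
  have hmellin := mellin_gauss m (add_pos ha hb) (s := m + 3 / 2) (by simp; linarith)
  rw [show (m + 3 / 2 + m + 1 / 2) / 2 = m + 1 by ring] at hmellin
  rw [← hmellin, pairing_apply, mellin]
  refine integral_congr_ae ?_
  filter_upwards [gaussL2_coe hm ha, gaussL2_coe hm hb] with x hxa hxb
  rw [hxa, hxb, gauss_add, gauss, gauss, smul_eq_mul, show m + 3 / 2 - 1 = m + 1 / 2 by ring]
  ring

lemma pairing_hankelCLM_gaussL2_gaussL2 (hm : -1 < m.re) (ha : 0 < a) (hb : 0 < b) :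
    pairing (hankelCLM hm (gaussL2 hm ha)) (gaussL2 hm hb) =
      1 / 2 * ((2 / (1 + a * b) : ℝ) : ℂ) ^ (m + 1) * Complex.Gamma (m + 1) := by
  have ha0 : (a : ℂ) ^ (m + 1) ≠ 0 := by
    simp [Complex.cpow_eq_zero_iff, ha.ne']
  have hbase : 2 / (b + a⁻¹) = a * (2 / (1 + a * b)) := by field_simp; ring
  rw [hankelCLM_gaussL2, pairing_comm, map_smul, pairing_gaussL2, smul_eq_mul, hbase,
    Complex.ofReal_mul, Complex.mul_cpow_ofReal_nonneg ha.le (by positivity), Complex.cpow_neg]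
  field_simp

theorem pairing_hankelCLM (hm : -1 < m.re) (f g : HalfLineL2) :
    pairing (hankelCLM hm f) g = pairing f (hankelCLM hm g) := by
  have hgauss {a : ℝ} (ha : 0 < a) :
      pairing (hankelCLM hm (gaussL2 hm ha)) = pairing (gaussL2 hm ha) ∘L hankelCLM hm :=
    ext_gaussL2 hm fun b hb => by
      rw [ContinuousLinearMap.comp_apply, pairing_comm (gaussL2 hm ha),
        pairing_hankelCLM_gaussL2_gaussL2, pairing_hankelCLM_gaussL2_gaussL2, mul_comm b a]
  have hall : pairing g ∘L hankelCLM hm = pairing (hankelCLM hm g) :=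
    ext_gaussL2 hm fun b hb => by
      rw [ContinuousLinearMap.comp_apply, pairing_comm g, hgauss, pairing_comm (hankelCLM hm g)]
      rfl
  rw [pairing_comm, pairing_comm f, ← hall, ContinuousLinearMap.comp_apply]

end Gauss

/-! ### The Bessel kernel -/

section Bessel

variable {m : ℂ} {a x : ℝ}

lemma natCast_add_re_pos (hm : -1 < m.re) (n : ℕ) : 0 < (n + m + 1 : ℂ).re := by
  simp only [Complex.add_re, Complex.natCast_re, Complex.one_re]
  linarith [Nat.cast_nonneg (α := ℝ) n]

lemma exists_inv_norm_Gamma_le (hm : -1 < m.re) :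
    ∃ C : ℝ, ∀ n : ℕ, ‖Complex.Gamma (n + m + 1)‖⁻¹ ≤ C := by
  have hanti : Antitone fun n : ℕ => ‖Complex.Gamma ((n + 1 : ℕ) + m + 1)‖⁻¹ := by
    refine antitone_nat_of_succ_le fun n => ?_
    have hpos := natCast_add_re_pos hm (n + 1)
    have hre : 1 ≤ ((n + 1 : ℕ) + m + 1).re := by
      simp only [Complex.add_re, Complex.natCast_re, Complex.one_re]
      push_cast
      linarith [Nat.cast_nonneg (α := ℝ) n]
    have hshift : ((n + 1 + 1 : ℕ) + m + 1 : ℂ) = ((n + 1 : ℕ) + m + 1) + 1 := by push_cast; ring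
    rw [hshift, Complex.Gamma_add_one _ fun h => hpos.ne' (by rw [h, Complex.zero_re]), norm_mul]
    exact inv_anti₀ (norm_pos_iff.mpr (Complex.Gamma_ne_zero_of_re_pos hpos))
      (le_mul_of_one_le_left (norm_nonneg _) (hre.trans (Complex.re_le_norm _)))
  refine ⟨max ‖Complex.Gamma ((0 : ℕ) + m + 1)‖⁻¹ ‖Complex.Gamma ((1 : ℕ) + m + 1)‖⁻¹, fun n => ?_⟩
  rcases n with _ | n
  · exact le_max_left _ _
  · exact (hanti n.zero_le).trans (le_max_right _ _)

/-- The kernel `J_m(y) √y` of the Hankel transformation. -/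
def besselKernel (m : ℂ) (y : ℝ) : ℂ := besselJ m y * (Real.sqrt y : ℂ)

/-- The `n`-th term of the power series of `J_m(y) √y`. -/
def besselTerm (m : ℂ) (n : ℕ) (y : ℝ) : ℂ :=
  (-1) ^ n / (n.factorial * Complex.Gamma (n + m + 1)) * ((y / 2 : ℝ) : ℂ) ^ (2 * n + m) *
    (Real.sqrt y : ℂ)

lemma measurable_besselTerm (m : ℂ) (n : ℕ) : Measurable (besselTerm m n) := by
  refine Measurable.mul (Measurable.const_mul ?_ _) (by fun_prop)
  exact (Complex.measurable_ofReal.comp (by fun_prop)).pow_const _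

lemma measurable_besselKernel (m : ℂ) : Measurable (besselKernel m) := by
  refine Measurable.mul (Measurable.tsum fun n => Measurable.const_mul ?_ _) (by fun_prop)
  exact (Complex.measurable_ofReal.comp (by fun_prop)).pow_const _

lemma besselTerm_eq (m : ℂ) (n : ℕ) {y : ℝ} (hy : 0 < y) :
    besselTerm m n y = ((1 / 2 : ℝ) : ℂ) ^ m / Complex.Gamma (n + m + 1) * (y : ℂ) ^ (m + 1 / 2) *
      ((-(y ^ 2 / 4) : ℝ) ^ n / n.factorial : ℝ) := by
  have hy0 : (y : ℂ) ≠ 0 := Complex.ofReal_ne_zero.mpr hy.ne'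
  have hhalf : ((y / 2 : ℝ) : ℂ) ≠ 0 := Complex.ofReal_ne_zero.mpr (by positivity)
  have hsqrt : (Real.sqrt y : ℂ) = (y : ℂ) ^ (1 / 2 : ℂ) := by
    rw [Real.sqrt_eq_rpow, Complex.ofReal_cpow hy.le]
    norm_num
  have hpower : ((y / 2 : ℝ) : ℂ) ^ (2 * n + m) =
      ((y / 2 : ℝ) ^ 2 : ℂ) ^ n * ((y : ℂ) ^ m * ((1 / 2 : ℝ) : ℂ) ^ m) := by
    rw [Complex.cpow_add _ _ hhalf, ← Complex.mul_cpow_ofReal_nonneg hy.le (by norm_num),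
      ← Complex.ofReal_mul, mul_one_div, ← pow_mul, ← Complex.cpow_natCast _ (2 * n)]
    push_cast
    rfl
  have hsign : (-(y ^ 2 / 4)) ^ n = (-1) ^ n * ((y / 2) ^ 2) ^ n := by
    rw [← mul_pow]
    ring_nf
  rw [besselTerm, hpower, hsqrt, Complex.cpow_add _ _ hy0, hsign]
  push_cast
  ring

lemma exists_norm_besselTerm_le (hm : -1 < m.re) :
    ∃ C : ℝ, ∀ (n : ℕ) (y : ℝ), 0 < y →
      ‖besselTerm m n y‖ ≤ C * y ^ (m.re + 1 / 2) * ((y ^ 2 / 4) ^ n / n.factorial) := by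
  obtain ⟨C, hC⟩ := exists_inv_norm_Gamma_le hm
  refine ⟨(1 / 2) ^ m.re * C, fun n y hy => ?_⟩
  have hre : (m + 1 / 2).re = m.re + 1 / 2 := by simp
  rw [besselTerm_eq m n hy, norm_mul, norm_mul, norm_div, Complex.norm_real,
    Complex.norm_cpow_eq_rpow_re_of_pos (by norm_num), Complex.norm_cpow_eq_rpow_re_of_pos hy, hre,
    norm_div, norm_pow, norm_neg, Real.norm_of_nonneg (by positivity : 0 ≤ y ^ 2 / 4),
    Real.norm_natCast, div_eq_mul_inv]
  gcongr
  exact hC n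

lemma hasSum_besselTerm_bound (c y : ℝ) :
    HasSum (fun n : ℕ => c * ((y ^ 2 / 4) ^ n / n.factorial)) (c * Real.exp (y ^ 2 / 4)) := by
  rw [Real.exp_eq_exp_ℝ]
  exact (NormedSpace.expSeries_div_hasSum_exp (y ^ 2 / 4)).mul_left c

lemma hasSum_besselTerm (hm : -1 < m.re) {y : ℝ} (hy : 0 < y) :
    HasSum (fun n => besselTerm m n y) (besselKernel m y) := by
  obtain ⟨C, hC⟩ := exists_norm_besselTerm_le hm
  have hsummable : Summable fun n => besselTerm m n y :=
    Summable.of_norm_bounded (hasSum_besselTerm_bound _ y).summable fun n => hC n y hy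
  rw [besselKernel, besselJ, ← tsum_mul_right]
  exact hsummable.hasSum

lemma exists_norm_besselKernel_le (hm : -1 < m.re) :
    ∃ C : ℝ, 0 ≤ C ∧ ∀ y : ℝ, 0 < y →
      ‖besselKernel m y‖ ≤ C * y ^ (m.re + 1 / 2) * Real.exp (y ^ 2 / 4) := by
  obtain ⟨C, hC⟩ := exists_norm_besselTerm_le hm
  have hle (y : ℝ) (hy : 0 < y) :
      ‖besselKernel m y‖ ≤ C * y ^ (m.re + 1 / 2) * Real.exp (y ^ 2 / 4) := by
    rw [← (hasSum_besselTerm hm hy).tsum_eq]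
    exact tsum_of_norm_bounded (hasSum_besselTerm_bound _ y) fun n => hC n y hy
  refine ⟨|C|, abs_nonneg C, fun y hy => (hle y hy).trans ?_⟩
  gcongr
  exact le_abs_self C

lemma half_cpow_mul_two_div_cpow (m : ℂ) (ha : 0 < a) :
    ((1 / 2 : ℝ) : ℂ) ^ m * (1 / 2) * ((2 / a : ℝ) : ℂ) ^ (m + 1) = (a : ℂ) ^ (-(m + 1)) := by
  have hhalf : ((1 / 2 : ℝ) : ℂ) ^ m * (1 / 2) = ((1 / 2 : ℝ) : ℂ) ^ (m + 1) := by
    rw [Complex.cpow_add _ _ (by norm_num), Complex.cpow_one]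
    norm_num
  have harg : (a : ℂ).arg ≠ Real.pi := by
    rw [Complex.arg_ofReal_of_nonneg ha.le]
    exact Real.pi_ne_zero.symm
  rw [hhalf, ← Complex.mul_cpow_ofReal_nonneg (by norm_num) (by positivity), Complex.cpow_neg,
    ← Complex.inv_cpow _ _ harg]
  congr 1
  push_cast
  field_simp

lemma besselTerm_mul_gauss (m : ℂ) (a : ℝ) (n : ℕ) {k : ℝ} (hk : 0 < k) (hx : 0 < x) :
    besselTerm m n (k * x) * gauss m a k =
      ((1 / 2 : ℝ) : ℂ) ^ m / Complex.Gamma (n + m + 1) * (x : ℂ) ^ (m + 1 / 2) *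
        ((-(x ^ 2 / 4) : ℝ) ^ n / n.factorial : ℝ) *
          ((k : ℂ) ^ (2 * n + m + 3 / 2 - 1 : ℂ) • gauss m a k) := by
  rw [besselTerm_eq m n (mul_pos hk hx), Complex.ofReal_mul k x,
    Complex.mul_cpow_ofReal_nonneg hk.le hx.le,
    show (2 * n + m + 3 / 2 - 1 : ℂ) = (2 * n : ℕ) + (m + 1 / 2) by push_cast; ring,
    Complex.cpow_add (2 * n : ℕ) _ (Complex.ofReal_ne_zero.mpr hk.ne'), Complex.cpow_natCast,
    pow_mul, smul_eq_mul, mul_pow k x, ← neg_div, ← mul_neg, mul_div_assoc, mul_pow (k ^ 2)]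
  push_cast
  ring

lemma integral_besselTerm_mul_gauss (hm : -1 < m.re) (ha : 0 < a) (hx : 0 < x) (n : ℕ) :
    ∫ k in Ioi (0 : ℝ), besselTerm m n (k * x) * gauss m a k =
      (a : ℂ) ^ (-(m + 1)) * (x : ℂ) ^ (m + 1 / 2) *
        (((-(a⁻¹ / 2) * x ^ 2 : ℝ) : ℂ) ^ n / n.factorial) := by
  have hre := natCast_add_re_pos hm n
  have hGamma := Complex.Gamma_ne_zero_of_re_pos hre
  have ha0 : ((2 / a : ℝ) : ℂ) ≠ 0 := Complex.ofReal_ne_zero.mpr (by positivity)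
  have hmellin := mellin_gauss m ha (s := 2 * n + m + 3 / 2) (by simp at hre ⊢; linarith)
  rw [show (2 * n + m + 3 / 2 + m + 1 / 2 : ℂ) / 2 = n + (m + 1) by ring,
    Complex.cpow_add _ _ ha0, Complex.cpow_natCast, ← add_assoc] at hmellin
  have hpow : ((-(a⁻¹ / 2) * x ^ 2 : ℝ) : ℂ) ^ n =
      ((-(x ^ 2 / 4) : ℝ) : ℂ) ^ n * ((2 / a : ℝ) : ℂ) ^ n := by
    rw [← mul_pow, ← Complex.ofReal_mul]
    congr 2
    field_simp
    ring
  rw [setIntegral_congr_fun measurableSet_Ioi fun k hk => besselTerm_mul_gauss m a n hk hx,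
    integral_const_mul, ← mellin, hmellin, ← half_cpow_mul_two_div_cpow m ha, hpow,
    Complex.ofReal_div (_ ^ n) n.factorial, Complex.ofReal_pow, Complex.ofReal_natCast]
  field_simp

lemma rpow_mul_exp_mul_norm_gauss (m : ℂ) (a : ℝ) {k x : ℝ} (hk : 0 < k) (hx : 0 ≤ x) (R : ℝ) :
    (k * x) ^ (m.re + 1 / 2) * Real.exp ((k * R) ^ 2 / 4) * ‖gauss m a k‖ =
      x ^ (m.re + 1 / 2) * (k ^ (2 * m.re + 1) * Real.exp (-(a / 2 - R ^ 2 / 4) * k ^ 2)) := by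
  have hrpow : k ^ (2 * m.re + 1) = k ^ (m.re + 1 / 2) * k ^ (m.re + 1 / 2) := by
    rw [← Real.rpow_add hk]
    ring_nf
  have hexp : Real.exp (-(a / 2 - R ^ 2 / 4) * k ^ 2) =
      Real.exp ((k * R) ^ 2 / 4) * Real.exp (-(a / 2) * k ^ 2) := by
    rw [← Real.exp_add]
    ring_nf
  rw [norm_gauss m a hk, Real.mul_rpow hk.le hx, hrpow, hexp]
  ring

lemma integrableOn_rpow_mul_exp_sub (hm : -1 < m.re) {R : ℝ} (ha : R ^ 2 < 2 * a) :
    IntegrableOn (fun k => k ^ (2 * m.re + 1) * Real.exp (-(a / 2 - R ^ 2 / 4) * k ^ 2))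
      (Ioi 0) :=
  integrableOn_rpow_mul_exp_neg_mul_sq (by linarith) (by linarith)

theorem integral_besselKernel_mul_gauss (hm : -1 < m.re) (hx : 0 < x) (hxa : x ^ 2 < 2 * a) :
    ∫ k in Ioi (0 : ℝ), besselKernel m (k * x) * gauss m a k =
      (a : ℂ) ^ (-(m + 1)) * gauss m a⁻¹ x := by
  have ha : 0 < a := by nlinarith [sq_nonneg x]
  obtain ⟨C, hC⟩ := exists_norm_besselTerm_le hm
  have hbound (k : ℝ) := (hasSum_besselTerm_bound (C * (k * x) ^ (m.re + 1 / 2)) (k * x)).mul_right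
    ‖gauss m a k‖
  have hseries := hasSum_integral_of_dominated_convergence (μ := halfLine)
    (F := fun n k => besselTerm m n (k * x) * gauss m a k)
    (f := fun k => besselKernel m (k * x) * gauss m a k)
    (fun n k => C * (k * x) ^ (m.re + 1 / 2) * (((k * x) ^ 2 / 4) ^ n / n.factorial) *
      ‖gauss m a k‖)
    (fun n => (((measurable_besselTerm m n).comp (by fun_prop)).mul
      (measurable_gauss m a)).aestronglyMeasurable)
    (fun n => by
      filter_upwards [ae_restrict_mem measurableSet_Ioi] with k (hk : 0 < k)
      rw [norm_mul]
      gcongr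
      exact hC n _ (by positivity))
    (ae_of_all _ fun k => (hbound k).summable)
    (by
      simp only [fun k => (hbound k).tsum_eq]
      refine ((integrableOn_rpow_mul_exp_sub hm hxa).const_mul (C * x ^ (m.re + 1 / 2))).congr ?_
      filter_upwards [ae_restrict_mem measurableSet_Ioi] with k hk
      linear_combination -C * rpow_mul_exp_mul_norm_gauss m a hk hx.le x)
    (by
      filter_upwards [ae_restrict_mem measurableSet_Ioi] with k (hk : 0 < k)
      exact (hasSum_besselTerm hm (by positivity)).mul_right _)
  have hexp := (NormedSpace.expSeries_div_hasSum_exp ((-(a⁻¹ / 2) * x ^ 2 : ℝ) : ℂ)).mul_left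
    ((a : ℂ) ^ (-(m + 1)) * (x : ℂ) ^ (m + 1 / 2))
  simp only [integral_besselTerm_mul_gauss hm ha hx] at hseries
  rw [hseries.unique hexp, gauss, mul_assoc, Complex.ofReal_exp, Complex.exp_eq_exp_ℂ]

end Bessel

/-! ### The Hankel transformation -/

section Hankel

variable {m : ℂ} (hm : -1 < m.re) (f : HalfLineL2) {a k R : ℝ}

lemma aestronglyMeasurable_restrict_Ioo (f : HalfLineL2) (R : ℝ) :
    AEStronglyMeasurable f (volume.restrict (Ioo 0 R)) :=
  (Lp.aestronglyMeasurable f).mono_measure (Measure.restrict_mono (fun _ hx => hx.1) le_rfl)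

include hm in
lemma integrableOn_rpow_mul_norm (hR : 0 < R) :
    IntegrableOn (fun x => x ^ (m.re + 1 / 2) * ‖f x‖) (Ioo 0 R) := by
  have hrpow : MemLp (fun x : ℝ => x ^ (m.re + 1 / 2)) 2 (volume.restrict (Ioo 0 R)) := by
    refine (memLp_two_iff_integrable_sq (Measurable.aestronglyMeasurable (by fun_prop))).mpr ?_
    refine ((intervalIntegral.integrableOn_Ioo_rpow_iff (s := 2 * m.re + 1) hR).mpr
      (by linarith)).congr ?_
    filter_upwards [ae_restrict_mem measurableSet_Ioo] with x hx
    rw [← Real.rpow_mul_natCast hx.1.le]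
    push_cast
    ring_nf
  exact hrpow.integrable_mul
    ((Lp.memLp f).mono_measure (Measure.restrict_mono (fun _ hx => hx.1) le_rfl)).norm

include hm in
lemma integrableOn_besselKernel_mul (hR : 0 < R) (hk : 0 < k) :
    IntegrableOn (fun x => besselKernel m (k * x) * f x) (Ioo 0 R) := by
  obtain ⟨C, hC, hbound⟩ := exists_norm_besselKernel_le hm
  refine ((integrableOn_rpow_mul_norm hm f hR).const_mul
    (C * k ^ (m.re + 1 / 2) * Real.exp ((k * R) ^ 2 / 4))).mono'
    (((measurable_besselKernel m).comp (by fun_prop)).aestronglyMeasurable.mul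
      (aestronglyMeasurable_restrict_Ioo f R)) ?_
  filter_upwards [ae_restrict_mem measurableSet_Ioo] with x ⟨hx, hxR⟩
  calc ‖besselKernel m (k * x) * f x‖
      ≤ C * (k * x) ^ (m.re + 1 / 2) * Real.exp ((k * x) ^ 2 / 4) * ‖f x‖ := by
        rw [norm_mul]
        gcongr
        exact hbound _ (by positivity)
    _ ≤ C * (k * x) ^ (m.re + 1 / 2) * Real.exp ((k * R) ^ 2 / 4) * ‖f x‖ := by gcongr
    _ = _ := by rw [Real.mul_rpow hk.le hx.le]; ring

include hm in
lemma integrable_prod_besselKernel (hR : 0 < R) (ha : R ^ 2 < 2 * a) :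
    Integrable (fun p : ℝ × ℝ => besselKernel m (p.1 * p.2) * f p.2 * gauss m a p.1)
      (halfLine.prod (volume.restrict (Ioo 0 R))) := by
  obtain ⟨C, hC, hbound⟩ := exists_norm_besselKernel_le hm
  refine (((integrableOn_rpow_mul_exp_sub hm ha).const_mul C).mul_prod
    (integrableOn_rpow_mul_norm hm f hR)).mono' ?_ ?_
  · exact (((measurable_besselKernel m).comp (by fun_prop)).aestronglyMeasurable.mul
      (aestronglyMeasurable_restrict_Ioo f R).comp_snd).mul
        ((measurable_gauss m a).comp measurable_fst).aestronglyMeasurable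
  · rw [Measure.prod_restrict]
    filter_upwards [ae_restrict_mem (measurableSet_Ioi.prod measurableSet_Ioo)]
      with ⟨k, x⟩ ⟨(hk : 0 < k), (hx : 0 < x), (hxR : x < R)⟩
    calc ‖besselKernel m (k * x) * f x * gauss m a k‖
        ≤ C * (k * x) ^ (m.re + 1 / 2) * Real.exp ((k * x) ^ 2 / 4) * ‖f x‖ * ‖gauss m a k‖ := by
          rw [norm_mul, norm_mul]
          gcongr
          exact hbound _ (by positivity)
      _ ≤ C * (k * x) ^ (m.re + 1 / 2) * Real.exp ((k * R) ^ 2 / 4) * ‖f x‖ * ‖gauss m a k‖ := by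
          gcongr
      _ = _ := by linear_combination C * ‖f x‖ * rpow_mul_exp_mul_norm_gauss m a hk hx.le R

lemma hankelTrunc_mul_gauss (k : ℝ) : hankelTrunc m R f k * gauss m a k =
    ∫ x in Ioo 0 R, besselKernel m (k * x) * f x * gauss m a k :=
  (integral_mul_const _ _).symm

include hm in
lemma integrableOn_hankelTrunc_mul_gauss (hR : 0 < R) (ha : R ^ 2 < 2 * a) :
    IntegrableOn (fun k => hankelTrunc m R f k * gauss m a k) (Ioi 0) := by
  simp only [hankelTrunc_mul_gauss]
  exact (integrable_prod_besselKernel hm f hR ha).integral_prod_left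

include hm in
lemma integral_hankelTrunc_mul_gauss (hR : 0 < R) (ha : R ^ 2 < 2 * a) :
    ∫ k in Ioi (0 : ℝ), hankelTrunc m R f k * gauss m a k =
      ∫ x in Ioo 0 R, f x * ((a : ℂ) ^ (-(m + 1)) * gauss m a⁻¹ x) := by
  simp only [hankelTrunc_mul_gauss]
  rw [integral_integral_swap (f := fun k x => besselKernel m (k * x) * f x * gauss m a k)
    (integrable_prod_besselKernel hm f hR ha)]
  refine setIntegral_congr_fun measurableSet_Ioo fun x hx => ?_
  rw [← integral_besselKernel_mul_gauss hm hx.1 (by nlinarith [hx.1, hx.2]), ← integral_const_mul]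
  congr 1
  funext k
  ring

/-- The restriction of `f` to `]0, R[`. -/
def truncL2 (R : ℝ) (f : HalfLineL2) : HalfLineL2 :=
  ((Lp.memLp f).indicator (measurableSet_Ioo (a := (0 : ℝ)) (b := R))).toLp _

lemma truncL2_coe (R : ℝ) (f : HalfLineL2) :
    ⇑(truncL2 R f) =ᵐ[halfLine] (Ioo 0 R).indicator f := MemLp.coeFn_toLp _

lemma tendsto_truncL2 : Tendsto (fun R => truncL2 R f) atTop (𝓝 f) := by
  rw [Lp.tendsto_Lp_iff_tendsto_eLpNorm']
  refine (tendsto_eLpNorm_zero_of_dominated ENNReal.ofNat_ne_top (Lp.memLp f).norm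
    (F := fun R => (Ioo 0 R).indicator f - ⇑f) (fun R => ?_) (fun R => ae_of_all _ fun x => ?_)
    ?_).congr fun R => eLpNorm_congr_ae ((truncL2_coe R f).symm.sub (ae_eq_refl _))
  · exact ((Lp.aestronglyMeasurable f).indicator measurableSet_Ioo).sub (Lp.aestronglyMeasurable f)
  · by_cases hx : x ∈ Ioo 0 R <;> simp [hx]
  · filter_upwards [ae_restrict_mem measurableSet_Ioi] with x hx
    refine tendsto_const_nhds.congr' ?_
    filter_upwards [eventually_gt_atTop x] with R hR
    rw [Pi.sub_apply, indicator_of_mem (show x ∈ Ioo 0 R from ⟨hx, hR⟩), sub_self]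

lemma pairing_truncL2 (R : ℝ) (f g : HalfLineL2) :
    pairing (truncL2 R f) g = ∫ x in Ioo 0 R, f x * g x := by
  rw [← inter_eq_right.mpr (show Ioo 0 R ⊆ Ioi 0 from fun _ hx => hx.1),
    ← setIntegral_indicator measurableSet_Ioo, pairing_apply]
  refine integral_congr_ae ?_
  filter_upwards [truncL2_coe R f] with x hx
  rw [hx]
  by_cases hxR : x ∈ Ioo 0 R <;> simp [hxR]

lemma integral_hankelCLM_truncL2_mul_gauss (ha : 0 < a) :
    ∫ k in Ioi (0 : ℝ), hankelCLM hm (truncL2 R f) k * gauss m a k =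
      ∫ x in Ioo 0 R, f x * ((a : ℂ) ^ (-(m + 1)) * gauss m a⁻¹ x) := by
  have hpairing : ∫ k in Ioi (0 : ℝ), hankelCLM hm (truncL2 R f) k * gauss m a k =
      pairing (hankelCLM hm (truncL2 R f)) (gaussL2 hm ha) := by
    rw [pairing_apply]
    refine integral_congr_ae ?_
    filter_upwards [gaussL2_coe hm ha] with k hk
    rw [hk]
  rw [hpairing, pairing_hankelCLM, hankelCLM_gaussL2, pairing_truncL2]
  refine integral_congr_ae ?_
  filter_upwards [ae_Ioo_of_halfLine R (gaussL2_coe hm (inv_pos.mpr ha)),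
    ae_Ioo_of_halfLine R (Lp.coeFn_smul ((a : ℂ) ^ (-(m + 1))) (gaussL2 hm (inv_pos.mpr ha)))]
    with x hgauss hsmul
  rw [hsmul, Pi.smul_apply, hgauss, smul_eq_mul]

theorem hankelTrunc_ae_eq (hR : 0 < R) :
    hankelTrunc m R f =ᵐ[halfLine] hankelCLM hm (truncL2 R f) := by
  have hsq : 0 < R ^ 2 := by positivity
  have hint (a : ℝ) (ha : a ≥ R ^ 2) := integrableOn_hankelTrunc_mul_gauss hm f hR (a := a)
    (by linarith)
  have hint' (a : ℝ) (ha : a ≥ R ^ 2) :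
      IntegrableOn (fun k => hankelCLM hm (truncL2 R f) k * gauss m a k) (Ioi 0) :=
    (Lp.memLp _).integrable_mul (memLp_gauss hm (hsq.trans_le ha))
  have hzero : (fun k => hankelTrunc m R f k - hankelCLM hm (truncL2 R f) k) =ᵐ[halfLine] 0 := by
    refine ae_eq_zero_of_integral_mul_gauss (m := m) (a₀ := R ^ 2) ?_ fun a ha => ?_
    · simp only [sub_mul]
      exact (hint _ le_rfl).sub (hint' _ le_rfl)
    · simp only [sub_mul]
      rw [integral_sub (hint a ha) (hint' a ha),
        integral_hankelTrunc_mul_gauss hm f hR (by linarith),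
        integral_hankelCLM_truncL2_mul_gauss hm f (hsq.trans_le ha), sub_self]
  exact hzero.mono fun k hk => sub_eq_zero.mp hk

lemma mem_hankelGraph : (f, hankelCLM hm f) ∈ hankelGraph m := by
  refine ⟨fun R hR k hk => integrableOn_besselKernel_mul hm f hR hk, fun R hR =>
    (Lp.memLp _).ae_eq (hankelTrunc_ae_eq hm f hR).symm, ?_⟩
  have hlim := ((hankelCLM hm).continuous.tendsto f).comp (tendsto_truncL2 f)
  refine ((Lp.tendsto_Lp_iff_tendsto_eLpNorm' _ _).mp hlim).congr' ?_
  filter_upwards [eventually_gt_atTop 0] with R hR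
  exact eLpNorm_congr_ae ((hankelTrunc_ae_eq hm f hR).symm.sub (ae_eq_refl _))

theorem hankel_eq_toPMap {L : HalfLineL2 →ₗ[ℂ] HalfLineL2} (hL : ∀ f, L f = hankelCLM hm f) :
    hankel m = L.toPMap ⊤ := by
  have hgraph (f : HalfLineL2) : (f, L f) ∈ (hankel m).graph := by
    rw [hankel_graph, hL]
    exact mem_hankelGraph hm f
  have hle : L.toPMap ⊤ ≤ hankel m := LinearPMap.le_of_le_graph fun ⟨f, g⟩ hfg => by
    obtain ⟨z, rfl, rfl⟩ := (LinearPMap.mem_graph_iff _).mp hfg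
    exact hgraph z
  exact (LinearPMap.eq_of_le_of_domain_eq hle
    (eq_top_iff.mpr fun f _ => LinearPMap.mem_domain_of_mem_graph (hgraph f)).symm).symm

end Hankel

/-! ### Minimal and maximal Schrödinger operators -/

lemma IsTest.integral_deriv {φ : ℝ → ℂ} (h : IsTest φ) :
    ∫ x in Ioi (0 : ℝ), _root_.deriv φ x = 0 := by
  rw [setIntegral_eq_integral_of_forall_compl_eq_zero fun x hx =>
    image_eq_zero_of_notMem_tsupport fun hn => hx (h.deriv.supp hn)]
  exact integral_eq_zero_of_hasDerivAt_of_integrable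
    (fun x => ((h.contDiff.differentiable (by simp)) x).hasDerivAt)
    (h.deriv.contDiff.continuous.integrable_of_hasCompactSupport h.deriv.compact)
    (h.contDiff.continuous.integrable_of_hasCompactSupport h.compact)

section Maximal

variable {α : ℂ} {f g : HalfLineL2}

theorem mem_LMax_graph_of_contDiffOn {w : ℝ → ℂ} (hw : ContDiffOn ℝ ∞ w (Ioi 0))
    (hf : ⇑f =ᵐ[halfLine] w) (hg : ⇑g =ᵐ[halfLine] schrodingerExpr α w) :
    (f, g) ∈ (LMax α).graph := by
  rw [LMax, weakOp_graph]
  intro φ hφ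
  change ∫ x in Ioi (0 : ℝ), g x * φ x = ∫ x in Ioi (0 : ℝ), f x * schrodingerExpr α φ x
  have hw' : ContDiffOn ℝ ∞ (deriv w) (Ioi 0) := hw.deriv_of_isOpen isOpen_Ioi le_rfl
  have hwronskian : IsTest ((fun x => w x * deriv φ x) + fun x => -deriv w x * φ x) :=
    (hφ.deriv.mul_of_smooth fun x hx => hw.contDiffAt (Ioi_mem_nhds hx)).add
      (hφ.mul_of_smooth fun x hx => (hw'.contDiffAt (Ioi_mem_nhds hx)).neg)
  rw [← sub_eq_zero, ← integral_sub (hφ.integrable_mul g)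
    ((schrodingerExpr_isTest α φ hφ).integrable_mul f), ← hwronskian.integral_deriv]
  refine integral_congr_ae ?_
  filter_upwards [hf, hg, ae_restrict_mem measurableSet_Ioi] with x hfx hgx hx
  have hderiv {v : ℝ → ℂ} (hv : ContDiffOn ℝ ∞ v (Ioi 0)) : HasDerivAt v (deriv v x) x :=
    ((hv.contDiffAt (Ioi_mem_nhds hx)).differentiableAt (by simp)).hasDerivAt
  have hderiv_wronskian : HasDerivAt ((fun x => w x * deriv φ x) + fun x => -deriv w x * φ x) _ x :=
    ((hderiv hw).mul (hderiv hφ.deriv.contDiff.contDiffOn)).add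
      ((hderiv hw').neg.mul (hderiv hφ.contDiff.contDiffOn))
  rw [hderiv_wronskian.deriv, hfx, hgx, schrodingerExpr, schrodingerExpr, Pi.neg_apply]
  ring

lemma pairing_toLp {φ : ℝ → ℂ} (hφ : MemLp φ 2 halfLine) (f : HalfLineL2) :
    pairing (hφ.toLp φ) f = ∫ x in Ioi (0 : ℝ), f x * φ x := by
  rw [pairing_comm, pairing_apply]
  exact integral_congr_ae (hφ.coeFn_toLp.mono fun x hx => congrArg (f x * ·) hx)

theorem mem_LMax_graph_iff : (f, g) ∈ (LMax α).graph ↔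
    ∀ φ (hφ : IsTest φ), pairing (hφ.memLp.toLp φ) g =
      pairing ((schrodingerExpr_isTest α φ hφ).memLp.toLp _) f := by
  rw [LMax, weakOp_graph]
  simp only [pairing_toLp]
  rfl

theorem LMax_isClosed (α : ℂ) : (LMax α).IsClosed := by
  have hgraph : ((LMax α).graph : Set (HalfLineL2 × HalfLineL2)) =
      ⋂ (φ : ℝ → ℂ) (hφ : IsTest φ), {p | pairing (hφ.memLp.toLp φ) p.2 =
        pairing ((schrodingerExpr_isTest α φ hφ).memLp.toLp _) p.1} := by
    ext ⟨f, g⟩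
    simpa using mem_LMax_graph_iff
  rw [LinearPMap.IsClosed, hgraph]
  exact isClosed_iInter fun φ => isClosed_iInter fun hφ =>
    isClosed_eq ((ContinuousLinearMap.continuous _).comp continuous_snd)
      ((ContinuousLinearMap.continuous _).comp continuous_fst)

end Maximal

lemma mem_domRestrict_graph {R E F : Type*} [Ring R] [AddCommGroup E] [Module R E]
    [AddCommGroup F] [Module R F] (T : E →ₗ.[R] F) (S : Submodule R E) (p : E × F) :
    p ∈ (T.domRestrict S).graph ↔ p.1 ∈ S ∧ p ∈ T.graph := by
  constructor
  · intro h
    exact ⟨(LinearPMap.mem_domain_of_mem_graph (f := T.domRestrict S) (x := p.1) (y := p.2) h).1,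
      LinearPMap.le_graph_of_le LinearPMap.domRestrict_le h⟩
  · rintro ⟨hS, hT⟩
    obtain ⟨z, hz, hTz⟩ := (LinearPMap.mem_graph_iff _).mp hT
    refine (LinearPMap.mem_graph_iff _).mpr ⟨⟨p.1, hS, hz ▸ z.2⟩, rfl, ?_⟩
    rw [← hTz]
    exact LinearPMap.domRestrict_apply hz.symm

section Minimal

variable {α : ℂ} {f g : HalfLineL2}

lemma LMin_graph (α : ℂ) :
    (LMin α).graph = ((LMax α).domRestrict testSubmodule).graph.topologicalClosure :=
  (((LMax_isClosed α).isClosable.leIsClosable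
    LinearPMap.domRestrict_le).graph_closure_eq_closure_graph).symm

lemma LMin_le_LMax (α : ℂ) : LMin α ≤ LMax α := by
  refine LinearPMap.le_of_le_graph ?_
  rw [LMin_graph]
  exact Submodule.topologicalClosure_minimal _
    (LinearPMap.le_graph_of_le LinearPMap.domRestrict_le) (LMax_isClosed α)

lemma isClosed_LMin_graph (α : ℂ) :
    IsClosed ((LMin α).graph : Set (HalfLineL2 × HalfLineL2)) := by
  rw [LMin_graph]
  exact Submodule.isClosed_topologicalClosure _

lemma mem_LMin_graph_of_isTest {φ : ℝ → ℂ} (hφ : IsTest φ) :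
    (hφ.memLp.toLp φ, (schrodingerExpr_isTest α φ hφ).memLp.toLp _) ∈ (LMin α).graph := by
  rw [LMin_graph]
  exact Submodule.le_topologicalClosure _ ((mem_domRestrict_graph _ _ _).mpr
    ⟨⟨φ, hφ, hφ.memLp.coeFn_toLp⟩, mem_LMax_graph_of_contDiffOn hφ.contDiff.contDiffOn
      hφ.memLp.coeFn_toLp (schrodingerExpr_isTest α φ hφ).memLp.coeFn_toLp⟩)

lemma mem_LMin_graph_of_tendsto {φ : ℕ → ℝ → ℂ} (hφ : ∀ n, IsTest (φ n))
    (hf : Tendsto (fun n => eLpNorm (φ n - ⇑f) 2 halfLine) atTop (𝓝 0))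
    (hg : Tendsto (fun n => eLpNorm (schrodingerExpr α (φ n) - ⇑g) 2 halfLine) atTop (𝓝 0)) :
    (f, g) ∈ (LMin α).graph := by
  have htoLp {ψ : ℕ → ℝ → ℂ} (hψ : ∀ n, MemLp (ψ n) 2 halfLine) {u : HalfLineL2}
      (hu : Tendsto (fun n => eLpNorm (ψ n - ⇑u) 2 halfLine) atTop (𝓝 0)) :
      Tendsto (fun n => (hψ n).toLp) atTop (𝓝 u) := by
    rw [Lp.tendsto_Lp_iff_tendsto_eLpNorm']
    exact hu.congr fun n => eLpNorm_congr_ae ((hψ n).coeFn_toLp.symm.sub (ae_eq_refl _))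
  exact (isClosed_LMin_graph α).mem_of_tendsto ((htoLp (fun n => (hφ n).memLp) hf).prodMk_nhds
    (htoLp (fun n => (schrodingerExpr_isTest α _ (hφ n)).memLp) hg))
    (Eventually.of_forall fun n => mem_LMin_graph_of_isTest (hφ n))

end Minimal

/-! ### Logarithmic cutoffs -/

section LogCutoff

variable {α : ℂ} {x : ℝ}

lemma schrodingerExpr_mul {χ w : ℝ → ℂ} (hχ : ContDiffOn ℝ ∞ χ (Ioi 0))
    (hw : ContDiffOn ℝ ∞ w (Ioi 0)) (hx : 0 < x) :
    schrodingerExpr α (fun x => χ x * w x) x =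
      χ x * schrodingerExpr α w x - 2 * deriv χ x * deriv w x - deriv (deriv χ) x * w x := by
  have hdiff {v : ℝ → ℂ} (hv : ContDiffOn ℝ ∞ v (Ioi 0)) {y : ℝ} (hy : 0 < y) :
      HasDerivAt v (deriv v y) y :=
    ((hv.contDiffAt (Ioi_mem_nhds hy)).differentiableAt (by simp)).hasDerivAt
  have hχ' : ContDiffOn ℝ ∞ (deriv χ) (Ioi 0) := hχ.deriv_of_isOpen isOpen_Ioi le_rfl
  have hw' : ContDiffOn ℝ ∞ (deriv w) (Ioi 0) := hw.deriv_of_isOpen isOpen_Ioi le_rfl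
  have hderiv : deriv (fun x => χ x * w x) =ᶠ[𝓝 x]
      fun y => deriv χ y * w y + χ y * deriv w y := by
    filter_upwards [Ioi_mem_nhds hx] with y hy using ((hdiff hχ hy).mul (hdiff hw hy)).deriv
  have hderiv₂ : HasDerivAt (fun y => deriv χ y * w y + χ y * deriv w y) _ x :=
    ((hdiff hχ' hx).mul (hdiff hw hx)).add ((hdiff hχ hx).mul (hdiff hw' hx))
  rw [schrodingerExpr, schrodingerExpr, hderiv.deriv_eq, hderiv₂.deriv]
  ring

lemma schrodingerExpr_congr {v w : ℝ → ℂ} (h : EqOn v w (Ioi 0)) (hx : 0 < x) :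
    schrodingerExpr α v x = schrodingerExpr α w x := by
  have heq : v =ᶠ[𝓝 x] w := h.eventuallyEq_of_mem (Ioi_mem_nhds hx)
  rw [schrodingerExpr, schrodingerExpr, heq.deriv.deriv_eq, heq.eq_of_nhds]

/-- The cutoff `x ↦ θ(ε log x)`, whose `k`-th derivative is `O(ε x⁻ᵏ)` uniformly in `x`. -/
def logCutoff (θ : ℝ → ℝ) (ε : ℝ) (x : ℝ) : ℂ := (θ (ε * Real.log x) : ℂ)

variable {θ : ℝ → ℝ} (hθ : ContDiff ℝ ∞ θ) (ε : ℝ)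

include hθ in
lemma contDiffOn_logCutoff : ContDiffOn ℝ ∞ (logCutoff θ ε) (Ioi 0) := fun x hx =>
  (Complex.ofRealCLM.contDiff.contDiffAt.comp x (hθ.contDiffAt.comp x
    (contDiffAt_const.mul (Real.contDiffAt_log.mpr (ne_of_gt hx))))).contDiffWithinAt

include hθ in
lemma hasDerivAt_logCutoff (hx : 0 < x) :
    HasDerivAt (logCutoff θ ε) (ε / x * logCutoff (deriv θ) ε x) x := by
  have hlog : HasDerivAt (fun x => ε * Real.log x) (ε * x⁻¹) x :=
    (Real.hasDerivAt_log hx.ne').const_mul ε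
  have hcomp : HasDerivAt (logCutoff θ ε) _ x := (HasDerivAt.comp (h₂ := θ) x
    (hθ.differentiable (by simp) (ε * Real.log x)).hasDerivAt hlog).ofReal_comp
  convert hcomp using 1
  rw [logCutoff]
  push_cast
  ring

include hθ in
lemma deriv_deriv_logCutoff (hx : 0 < x) : deriv (deriv (logCutoff θ ε)) x =
    ε * (ε * logCutoff (deriv (deriv θ)) ε x - logCutoff (deriv θ) ε x) / (x : ℂ) ^ 2 := by
  have hx' : (x : ℂ) ≠ 0 := Complex.ofReal_ne_zero.mpr hx.ne'
  have hderiv : deriv (logCutoff θ ε) =ᶠ[𝓝 x] fun y => ε / (y : ℂ) * logCutoff (deriv θ) ε y := by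
    filter_upwards [Ioi_mem_nhds hx] with y hy using (hasDerivAt_logCutoff hθ ε hy).deriv
  have hdiv : HasDerivAt (fun y : ℝ => (ε : ℂ) / (y : ℂ)) _ x :=
    (hasDerivAt_const x (ε : ℂ)).div (hasDerivAt_id x).ofReal_comp hx'
  have hderiv₂ : HasDerivAt (fun y : ℝ => ε / (y : ℂ) * logCutoff (deriv θ) ε y) _ x :=
    hdiv.mul (hasDerivAt_logCutoff (contDiff_infty_iff_deriv.mp hθ).2 ε hx)
  rw [hderiv.deriv_eq, hderiv₂.deriv]
  field_simp
  push_cast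
  ring

include hθ in
lemma IsTest.logCutoff_mul (hθc : HasCompactSupport θ) (hε : ε ≠ 0) {w : ℝ → ℂ}
    (hw : ContDiffOn ℝ ∞ w (Ioi 0)) :
    IsTest ((Ioi 0).indicator fun x => logCutoff θ ε x * w x) := by
  have hcut : IsTest ((Ioi 0).indicator (logCutoff θ ε)) :=
    IsTest.of_comp_log (ψ := fun u => (θ (ε * u) : ℂ))
      (Complex.ofRealCLM.contDiff.comp (hθ.comp (contDiff_const.mul contDiff_id)))
      ((hθc.comp_homeomorph (Homeomorph.mulLeft₀ ε hε)).comp_left Complex.ofReal_zero)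
  convert hcut.mul_of_smooth fun x hx => hw.contDiffAt (Ioi_mem_nhds hx) using 1
  funext x
  by_cases hx : x ∈ Ioi 0 <;> simp [hx, mul_comm]

lemma tendsto_logCutoff (hθ : Continuous θ) (x : ℝ) :
    Tendsto (fun ε => logCutoff θ ε x) (𝓝 0) (𝓝 (θ 0)) := by
  have hcont : Continuous fun ε => logCutoff θ ε x :=
    Complex.continuous_ofReal.comp (hθ.comp (continuous_id.mul continuous_const))
  simpa [logCutoff] using hcont.tendsto 0

/-- The effect on `L_α w` of multiplying `w` by a logarithmic cutoff. -/
def cutoffError (α : ℂ) (θ : ℝ → ℝ) (w : ℝ → ℂ) (ε x : ℝ) : ℂ :=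
  (logCutoff θ ε x - 1) * schrodingerExpr α w x
    - 2 * (ε * logCutoff (deriv θ) ε x) * (deriv w x / x)
    - ε * (ε * logCutoff (deriv (deriv θ)) ε x - logCutoff (deriv θ) ε x) * (w x / (x : ℂ) ^ 2)

include hθ in
lemma schrodingerExpr_logCutoff_mul {w : ℝ → ℂ} (hw : ContDiffOn ℝ ∞ w (Ioi 0)) (hx : 0 < x) :
    schrodingerExpr α (fun x => logCutoff θ ε x * w x) x - schrodingerExpr α w x =
      cutoffError α θ w ε x := by
  rw [schrodingerExpr_mul (contDiffOn_logCutoff hθ ε) hw hx, (hasDerivAt_logCutoff hθ ε hx).deriv,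
    deriv_deriv_logCutoff hθ ε hx, cutoffError]
  ring

lemma norm_cutoffError_le {C : ℝ} (hC : ∀ u, |θ u - 1| ≤ C) (hC' : ∀ u, |deriv θ u| ≤ C)
    (hC'' : ∀ u, |deriv (deriv θ) u| ≤ C) (hε : ε ∈ Icc 0 1) (w : ℝ → ℂ) :
    ‖cutoffError α θ w ε x‖ ≤
      C * ‖schrodingerExpr α w x‖ + 2 * C * ‖deriv w x / x‖ + 2 * C * ‖w x / (x : ℂ) ^ 2‖ := by
  have hnorm {v : ℝ → ℝ} (hv : ∀ u, |v u| ≤ C) : ‖logCutoff v ε x‖ ≤ C := by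
    simpa [logCutoff] using hv (ε * Real.log x)
  have hε_mul {z : ℂ} {B : ℝ} (hz : ‖z‖ ≤ B) : ‖ε * z‖ ≤ B := by
    rw [norm_mul, Complex.norm_real, Real.norm_of_nonneg hε.1]
    exact (mul_le_of_le_one_left (norm_nonneg z) hε.2).trans hz
  have hone : ‖logCutoff θ ε x - 1‖ ≤ C := by
    simpa [logCutoff, ← Complex.ofReal_one, ← Complex.ofReal_sub] using hC (ε * Real.log x)
  have htwo : ‖2 * (ε * logCutoff (deriv θ) ε x)‖ ≤ 2 * C := by
    rw [norm_mul, Complex.norm_ofNat]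
    gcongr
    exact hε_mul (hnorm hC')
  have hthree : ‖ε * (ε * logCutoff (deriv (deriv θ)) ε x - logCutoff (deriv θ) ε x)‖ ≤ 2 * C :=
    hε_mul ((norm_sub_le _ _).trans (by linarith [hε_mul (hnorm hC''), hnorm hC']))
  refine (norm_sub_le _ _).trans (add_le_add ((norm_sub_le _ _).trans (add_le_add ?_ ?_)) ?_) <;>
    rw [norm_mul] <;> gcongr

lemma tendsto_cutoffError (hθ : ContDiff ℝ ∞ θ) (hθ0 : θ 0 = 1) (w : ℝ → ℂ) (x : ℝ) :
    Tendsto (fun ε => cutoffError α θ w ε x) (𝓝 0) (𝓝 0) := by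
  have hθ' : ContDiff ℝ ∞ (deriv θ) := (contDiff_infty_iff_deriv.mp hθ).2
  have hε : Tendsto (fun ε : ℝ => (ε : ℂ)) (𝓝 0) (𝓝 0) := by
    simpa using Complex.continuous_ofReal.tendsto 0
  have hlim := tendsto_logCutoff hθ.continuous x
  have hlim' := tendsto_logCutoff hθ'.continuous x
  have hlim'' := tendsto_logCutoff (contDiff_infty_iff_deriv.mp hθ').2.continuous x
  simpa [cutoffError, hθ0] using
    (((hlim.sub_const 1).mul_const (schrodingerExpr α w x)).sub
      (((hε.mul hlim').const_mul 2).mul_const (deriv w x / x))).sub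
      ((hε.mul ((hε.mul hlim'').sub hlim')).mul_const (w x / (x : ℂ) ^ 2))

lemma exists_cutoff_profile : ∃ (θ : ℝ → ℝ) (C : ℝ), ContDiff ℝ ∞ θ ∧ HasCompactSupport θ ∧
    θ 0 = 1 ∧ (∀ u, |θ u - 1| ≤ C) ∧ (∀ u, |deriv θ u| ≤ C) ∧ ∀ u, |deriv (deriv θ) u| ≤ C := by
  let θ : ContDiffBump (0 : ℝ) := default
  have hθ : ContDiff ℝ ∞ θ := θ.contDiff
  have hθ' : ContDiff ℝ ∞ (deriv θ) := (contDiff_infty_iff_deriv.mp hθ).2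
  have hθ'' : ContDiff ℝ ∞ (deriv (deriv θ)) := (contDiff_infty_iff_deriv.mp hθ').2
  have hθc : HasCompactSupport (deriv θ) := θ.hasCompactSupport.deriv
  obtain ⟨C₁, hC₁⟩ := hθc.exists_bound_of_continuous hθ'.continuous
  obtain ⟨C₂, hC₂⟩ := hθc.deriv.exists_bound_of_continuous hθ''.continuous
  refine ⟨θ, max 1 (max C₁ C₂), hθ, θ.hasCompactSupport, θ.eventuallyEq_one.eq_of_nhds,
    fun u => ?_, fun u => ?_, fun u => ?_⟩
  · exact (abs_le.mpr ⟨by linarith [θ.nonneg (x := u)], by linarith [θ.le_one (x := u)]⟩).trans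
      (le_max_left _ _)
  · exact (hC₁ u).trans ((le_max_left _ _).trans (le_max_right _ _))
  · exact (hC₂ u).trans ((le_max_right _ _).trans (le_max_right _ _))

/-- The cutoffs are `x ↦ θ(ε log x)`; their commutators with `L_α`, applied to `w`, are of size
`ε |w'(x)| / x + ε |w(x)| / x²`. -/
theorem mem_LMin_graph_of_contDiffOn {f g : HalfLineL2} {w : ℝ → ℂ}
    (hw : ContDiffOn ℝ ∞ w (Ioi 0)) (hf : ⇑f =ᵐ[halfLine] w)
    (hg : ⇑g =ᵐ[halfLine] schrodingerExpr α w)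
    (hw_one : MemLp (fun x => deriv w x / x) 2 halfLine)
    (hw_two : MemLp (fun x => w x / (x : ℂ) ^ 2) 2 halfLine) : (f, g) ∈ (LMin α).graph := by
  obtain ⟨θ, C, hθ, hθc, hθ0, hC, hC', hC''⟩ := exists_cutoff_profile
  let ε : ℕ → ℝ := fun n => 1 / ((n : ℝ) + 1)
  have hε_pos (n : ℕ) : 0 < ε n := by positivity
  have hε_le (n : ℕ) : ε n ≤ 1 := div_le_one_of_le₀ (by simp) (by positivity)
  have hε_lim : Tendsto ε atTop (𝓝 0) := tendsto_one_div_add_atTop_nhds_zero_nat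
  have htest (n : ℕ) := IsTest.logCutoff_mul hθ (ε n) hθc (hε_pos n).ne' hw
  refine mem_LMin_graph_of_tendsto htest
    (tendsto_eLpNorm_zero_of_dominated ENNReal.ofNat_ne_top ((Lp.memLp f).norm.const_mul C)
      (fun n => (htest n).memLp.1.sub (Lp.aestronglyMeasurable f)) (fun n => ?_) ?_)
    (tendsto_eLpNorm_zero_of_dominated ENNReal.ofNat_ne_top
      ((((Lp.memLp g).norm.const_mul C).add (hw_one.norm.const_mul (2 * C))).add
        (hw_two.norm.const_mul (2 * C)))
      (fun n => (schrodingerExpr_isTest α _ (htest n)).memLp.1.sub (Lp.aestronglyMeasurable g))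
      (fun n => ?_) ?_)
  · filter_upwards [hf, ae_restrict_mem measurableSet_Ioi] with x hfx hx
    rw [Pi.sub_apply, indicator_of_mem hx, hfx, ← sub_one_mul, norm_mul]
    gcongr
    simpa [logCutoff, ← Complex.ofReal_one, ← Complex.ofReal_sub] using hC (ε n * Real.log x)
  · filter_upwards [hf, ae_restrict_mem measurableSet_Ioi] with x hfx hx
    have hlim := (((tendsto_logCutoff hθ.continuous x).comp hε_lim).sub_const 1).mul_const (w x)
    simpa [hθ0, hfx, indicator_of_mem hx, sub_one_mul] using hlim
  · filter_upwards [hg, ae_restrict_mem measurableSet_Ioi] with x hgx hx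
    rw [Pi.add_apply, Pi.add_apply, Pi.sub_apply, hgx,
      schrodingerExpr_congr (eqOn_indicator (s := Ioi 0)) hx,
      schrodingerExpr_logCutoff_mul hθ (ε n) hw hx]
    exact norm_cutoffError_le (ε n) hC hC' hC'' ⟨(hε_pos n).le, hε_le n⟩ w
  · filter_upwards [hg, ae_restrict_mem measurableSet_Ioi] with x hgx hx
    have hlim : Tendsto (fun n => cutoffError α θ w (ε n) x) atTop (𝓝 0) :=
      (tendsto_cutoffError hθ hθ0 w x).comp hε_lim
    refine hlim.congr fun n => ?_
    rw [Pi.sub_apply, hgx, schrodingerExpr_congr (eqOn_indicator (s := Ioi 0)) hx,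
      schrodingerExpr_logCutoff_mul hθ (ε n) hw hx]

end LogCutoff

/-! ### Functions of the form `x^{m+1/2} ψ(x)` -/

section PowerMul

variable {m : ℂ} {x : ℝ}

lemma contDiffOn_cpow (μ : ℂ) : ContDiffOn ℝ ∞ (fun x : ℝ => (x : ℂ) ^ μ) (Ioi 0) := by
  have hexp : ContDiffOn ℝ ∞ (fun x : ℝ => Complex.exp (Real.log x * μ)) (Ioi 0) := fun x hx =>
    (Complex.contDiff_exp.contDiffAt.comp x ((Complex.ofRealCLM.contDiff.contDiffAt.comp x
      (Real.contDiffAt_log.mpr (ne_of_gt hx))).mul contDiffAt_const)).contDiffWithinAt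
  refine hexp.congr fun x hx => ?_
  rw [Complex.cpow_def_of_ne_zero (Complex.ofReal_ne_zero.mpr (ne_of_gt hx)),
    Complex.ofReal_log (le_of_lt hx)]

lemma hasDerivAt_cpow (μ : ℂ) (hx : 0 < x) :
    HasDerivAt (fun x : ℝ => (x : ℂ) ^ μ) ((x : ℂ) ^ μ * (μ / x)) x := by
  have hx0 : (x : ℂ) ≠ 0 := Complex.ofReal_ne_zero.mpr hx.ne'
  have hpow : HasDerivAt (fun x : ℝ => (x : ℂ) ^ μ) _ x :=
    ((hasDerivAt_id (x : ℂ)).cpow_const (c := μ) (Or.inl (by simpa using hx))).comp_ofReal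
  convert hpow using 1
  simp only [id, Complex.cpow_sub _ _ hx0, Complex.cpow_one]
  field_simp

lemma deriv_cpow_mul (μ : ℂ) {v : ℝ → ℂ} (hv : DifferentiableAt ℝ v x) (hx : 0 < x) :
    deriv (fun x : ℝ => (x : ℂ) ^ μ * v x) x = (x : ℂ) ^ μ * (μ / x * v x + deriv v x) := by
  have hmul : HasDerivAt (fun x : ℝ => (x : ℂ) ^ μ * v x) _ x :=
    (hasDerivAt_cpow μ hx).mul hv.hasDerivAt
  rw [hmul.deriv]
  ring

theorem schrodingerExpr_cpow_mul (m : ℂ) {v : ℝ → ℂ} (hv : ContDiff ℝ ∞ v) (hx : 0 < x) :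
    schrodingerExpr (m ^ 2) (fun x => (x : ℂ) ^ (m + 1 / 2) * v x) x =
      (x : ℂ) ^ (m + 1 / 2) * -((2 * m + 1) * (deriv v x / x) + deriv (deriv v) x) := by
  have hx0 : (x : ℂ) ≠ 0 := Complex.ofReal_ne_zero.mpr hx.ne'
  have hv' : Differentiable ℝ (deriv v) :=
    (contDiff_infty_iff_deriv.mp hv).2.differentiable (by simp)
  have hderiv : deriv (fun x : ℝ => (x : ℂ) ^ (m + 1 / 2) * v x) =ᶠ[𝓝 x]
      fun y => (y : ℂ) ^ (m + 1 / 2) * ((m + 1 / 2) / y * v y + deriv v y) := by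
    filter_upwards [Ioi_mem_nhds hx] with y hy using
      deriv_cpow_mul _ (hv.differentiable (by simp) y) hy
  have hinner : HasDerivAt (fun y : ℝ => (m + 1 / 2) / (y : ℂ) * v y + deriv v y) _ x :=
    (((hasDerivAt_const x (m + 1 / 2)).div (hasDerivAt_id x).ofReal_comp hx0).mul
      (hv.differentiable (by simp) x).hasDerivAt).add (hv' x).hasDerivAt
  rw [schrodingerExpr, hderiv.deriv_eq, deriv_cpow_mul _ hinner.differentiableAt hx, hinner.deriv]
  simp only [Pi.div_apply, id, Complex.ofReal_one]
  field_simp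
  ring

theorem memLp_cpow_mul (hm : -1 < m.re) {η : ℝ → ℝ} (hη : ContinuousOn η (Ioi 0))
    (hzero : η =O[𝓝[>] 0] fun _ => (1 : ℝ))
    (hdecay : Asymptotics.SuperpolynomialDecay atTop id η) :
    MemLp (fun x : ℝ => (x : ℂ) ^ (m + 1 / 2) * η x) 2 halfLine := by
  have hmeas : AEStronglyMeasurable (fun x : ℝ => (x : ℂ) ^ (m + 1 / 2) * η x) halfLine :=
    ((contDiffOn_cpow _).continuousOn.mul
      (Complex.continuous_ofReal.comp_continuousOn hη)).aestronglyMeasurable measurableSet_Ioi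
  have htop : (fun x => η x ^ 2) =O[atTop] fun x : ℝ => x ^ (-(2 * m.re + 3)) := by
    obtain ⟨n, hn⟩ := exists_nat_ge (2 * m.re + 3)
    have hpow : (fun x => η x ^ 2) =O[atTop] fun x : ℝ => x ^ (-n : ℤ) := by
      simpa [sq] using ((Asymptotics.superpolynomialDecay_iff_isBigO η tendsto_id).mp hdecay
        (-n)).mul ((Asymptotics.superpolynomialDecay_iff_isBigO η tendsto_id).mp hdecay 0)
    refine hpow.trans (.of_bound 1 ?_)
    filter_upwards [eventually_ge_atTop 1] with x hx
    rw [← Real.rpow_intCast, one_mul, Real.norm_of_nonneg (by positivity),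
      Real.norm_of_nonneg (by positivity)]
    exact Real.rpow_le_rpow_of_exponent_le hx (by push_cast; linarith)
  have hbot : (fun x => η x ^ 2) =O[𝓝[>] 0] fun x : ℝ => x ^ (-(0 : ℝ)) := by
    simpa using hzero.pow 2
  refine (memLp_two_iff_integrable_sq_norm hmeas).mpr ((mellin_convergent_of_isBigO_scalar
    ((hη.pow 2).locallyIntegrableOn measurableSet_Ioi) htop (s := 2 * m.re + 2) (by linarith) hbot
    (by linarith)).congr ?_)
  have hexponent : (m + 1 / 2).re * (2 : ℕ) = 2 * m.re + 2 - 1 := by simp; ring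
  filter_upwards [ae_restrict_mem measurableSet_Ioi] with x hx
  rw [norm_mul, mul_pow, Complex.norm_cpow_eq_rpow_re_of_pos hx, Complex.norm_real,
    Real.norm_eq_abs, sq_abs, ← Real.rpow_mul_natCast (le_of_lt hx), hexponent,
    Pi.pow_apply]

lemma isBigO_sq_of_deriv_eq_zero {ψ : ℝ → ℝ} (hψ : ContDiff ℝ ∞ ψ) (hψ0 : ψ 0 = 0)
    (hψ0' : deriv ψ 0 = 0) : ψ =O[𝓝[>] 0] fun x => x ^ 2 := by
  obtain ⟨C, hC⟩ := exists_taylor_mean_remainder_bound (n := 1) zero_le_one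
    (contDiff_infty.mp hψ _).contDiffOn
  refine .of_bound C ?_
  filter_upwards [Ioc_mem_nhdsGT one_pos] with x hx
  have hderiv : derivWithin ψ (Icc 0 1) 0 = 0 := by
    rw [(hψ.differentiable (by simp) 0).derivWithin
      (uniqueDiffOn_Icc one_pos 0 (left_mem_Icc.mpr zero_le_one)), hψ0']
  simpa [taylorWithinEval_succ, hψ0, hderiv] using hC x ⟨hx.1.le, hx.2⟩

lemma memLp_cpow_mul_div (hm : -1 < m.re) {η : ℝ → ℝ} (hη : Differentiable ℝ η) (hη0 : η 0 = 0)
    (hdecay : Asymptotics.SuperpolynomialDecay atTop id η) :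
    MemLp (fun x : ℝ => (x : ℂ) ^ (m + 1 / 2) * (η x / x : ℝ)) 2 halfLine := by
  have hzero : η =O[𝓝[>] 0] fun x => x := by
    simpa [hη0] using (hη 0).isBigO_sub.mono (nhdsWithin_le_nhds (s := Ioi 0))
  exact memLp_cpow_mul hm (hη.continuous.continuousOn.div continuousOn_id fun x hx => ne_of_gt hx)
    ((Asymptotics.div_isBoundedUnder_of_isBigO hzero).isBigO_one ℝ)
    ((Asymptotics.SuperpolynomialDecay.param_zpow_mul tendsto_id hdecay (-1)).congr fun x => by
      simp [div_eq_inv_mul])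

lemma memLp_cpow_mul_div_sq (hm : -1 < m.re) {ψ : ℝ → ℝ} (hψ : ContDiff ℝ ∞ ψ)
    (hψ0 : ψ 0 = 0) (hψ0' : deriv ψ 0 = 0)
    (hdecay : Asymptotics.SuperpolynomialDecay atTop id ψ) :
    MemLp (fun x : ℝ => (x : ℂ) ^ (m + 1 / 2) * (ψ x / x ^ 2 : ℝ)) 2 halfLine :=
  memLp_cpow_mul hm (hψ.continuous.continuousOn.div (continuousOn_pow 2)
    fun x hx => pow_ne_zero 2 (ne_of_gt hx))
    ((Asymptotics.div_isBoundedUnder_of_isBigO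
      (isBigO_sq_of_deriv_eq_zero hψ hψ0 hψ0')).isBigO_one ℝ)
    ((hdecay.param_zpow_mul tendsto_id (-2)).congr fun x => by
      simp [zpow_neg, div_eq_inv_mul, zpow_ofNat])

lemma deriv_ofReal_comp {v : ℝ → ℝ} (hv : Differentiable ℝ v) :
    deriv (fun x => (v x : ℂ)) = fun x => ((deriv v x : ℝ) : ℂ) :=
  funext fun x => (hv x).hasDerivAt.ofReal_comp.deriv

theorem mem_LMin_domain_of_cpow_mul (hm : -1 < m.re) {ψ : ℝ → ℝ} (hψ : ContDiff ℝ ∞ ψ)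
    (hψ0 : ψ 0 = 0) (hψ0' : deriv ψ 0 = 0)
    (hdecay : Asymptotics.SuperpolynomialDecay atTop id ψ)
    (hdecay' : Asymptotics.SuperpolynomialDecay atTop id (deriv ψ))
    (hdecay'' : Asymptotics.SuperpolynomialDecay atTop id (deriv (deriv ψ))) {f : HalfLineL2}
    (hf : ⇑f =ᵐ[halfLine] fun x => (x : ℂ) ^ (m + 1 / 2) * ψ x) :
    f ∈ (LMin (m ^ 2)).domain := by
  have hψ' : ContDiff ℝ ∞ (deriv ψ) := (contDiff_infty_iff_deriv.mp hψ).2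
  have hψ'' : ContDiff ℝ ∞ (deriv (deriv ψ)) := (contDiff_infty_iff_deriv.mp hψ').2
  have hv : ContDiff ℝ ∞ fun x => (ψ x : ℂ) := Complex.ofRealCLM.contDiff.comp hψ
  have hderiv : deriv (fun x => (ψ x : ℂ)) = fun x => ((deriv ψ x : ℝ) : ℂ) :=
    deriv_ofReal_comp (hψ.differentiable (by simp))
  have hmem_zero : MemLp (fun x : ℝ => (x : ℂ) ^ (m + 1 / 2) * (deriv (deriv ψ) x : ℝ)) 2
      halfLine :=
    memLp_cpow_mul hm hψ''.continuous.continuousOn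
      (((hψ''.continuous.tendsto 0).isBigO_one ℝ).mono nhdsWithin_le_nhds) hdecay''
  have hmem_one := memLp_cpow_mul_div hm (hψ'.differentiable (by simp)) hψ0' hdecay'
  have hmem_two := memLp_cpow_mul_div_sq hm hψ hψ0 hψ0' hdecay
  have hLmem := ((hmem_one.const_mul (2 * m + 1)).add hmem_zero).neg
  refine LinearPMap.mem_domain_of_mem_graph (y := hLmem.toLp _)
    (mem_LMin_graph_of_contDiffOn ((contDiffOn_cpow (m + 1 / 2)).mul hv.contDiffOn) hf ?_
      (((hmem_two.const_mul (m + 1 / 2)).add hmem_one).ae_eq ?_) (hmem_two.ae_eq ?_))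
  · filter_upwards [hLmem.coeFn_toLp, ae_restrict_mem measurableSet_Ioi] with x hx hx0
    rw [hx, schrodingerExpr_cpow_mul m hv hx0, hderiv,
      deriv_ofReal_comp (hψ'.differentiable (by simp))]
    simp only [Pi.neg_apply, Pi.add_apply, Complex.ofReal_div]
    ring
  · filter_upwards [ae_restrict_mem measurableSet_Ioi] with x hx
    rw [deriv_cpow_mul _ (hv.differentiable (by simp) x) hx, hderiv]
    have : (x : ℂ) ≠ 0 := Complex.ofReal_ne_zero.mpr (ne_of_gt hx)
    simp only [Pi.add_apply, Complex.ofReal_div, Complex.ofReal_pow]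
    field_simp
  · refine ae_of_all _ fun x => ?_
    simp only [Complex.ofReal_div, Complex.ofReal_pow]
    ring

end PowerMul

/-! ### Gaussians near the origin -/

section GaussianCutoff

variable {m : ℂ} {a : ℝ}

lemma contDiff_gaussian (a : ℝ) : ContDiff ℝ ∞ fun x : ℝ => Real.exp (-(a / 2) * x ^ 2) :=
  Real.contDiff_exp.comp (by fun_prop)

lemma deriv_gaussian (a : ℝ) :
    deriv (fun x : ℝ => Real.exp (-(a / 2) * x ^ 2)) =
      fun x => -(a * x) * Real.exp (-(a / 2) * x ^ 2) := by
  funext x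
  rw [(((hasDerivAt_pow 2 x).const_mul (-(a / 2))).exp).deriv]
  push_cast
  ring

lemma deriv_deriv_gaussian (a : ℝ) :
    deriv (deriv (fun x : ℝ => Real.exp (-(a / 2) * x ^ 2))) =
      fun x => (-a + a ^ 2 * x ^ 2) * Real.exp (-(a / 2) * x ^ 2) := by
  rw [deriv_gaussian]
  funext x
  have hlinear : HasDerivAt (fun x : ℝ => -(a * x)) (-a) x := by
    simpa using! ((hasDerivAt_id x).const_mul a).neg
  refine (hlinear.mul ((hasDerivAt_pow 2 x).const_mul (-(a / 2))).exp).deriv.trans ?_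
  push_cast
  ring

lemma superpolynomialDecay_gaussian (ha : 0 < a) :
    Asymptotics.SuperpolynomialDecay atTop id fun x : ℝ => Real.exp (-(a / 2) * x ^ 2) := by
  refine (Asymptotics.superpolynomialDecay_iff_isBigO _ tendsto_id).mpr fun n => ?_
  simpa using (rexp_neg_quadratic_isLittleO_rpow_atTop
    (show -(a / 2) < 0 by linarith) 0 (n : ℝ)).isBigO

lemma superpolynomialDecay_deriv_gaussian (ha : 0 < a) :
    Asymptotics.SuperpolynomialDecay atTop id
      (deriv fun x : ℝ => Real.exp (-(a / 2) * x ^ 2)) := by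
  rw [deriv_gaussian]
  exact ((superpolynomialDecay_gaussian ha).param_mul.const_mul (-a)).congr fun x => by
    simp [mul_assoc]

lemma superpolynomialDecay_deriv_deriv_gaussian (ha : 0 < a) :
    Asymptotics.SuperpolynomialDecay atTop id
      (deriv (deriv fun x : ℝ => Real.exp (-(a / 2) * x ^ 2))) := by
  have hdecay := superpolynomialDecay_gaussian ha
  rw [deriv_deriv_gaussian]
  exact ((hdecay.const_mul (-a)).add ((hdecay.param_pow_mul 2).const_mul (a ^ 2))).congr
    fun x => by simp [add_mul, mul_assoc]

lemma superpolynomialDecay_of_hasCompactSupport {v : ℝ → ℝ} (hv : HasCompactSupport v) :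
    Asymptotics.SuperpolynomialDecay atTop id v :=
  (Asymptotics.superpolynomialDecay_zero atTop id).congr' <| by
    have hcocompact := hasCompactSupport_iff_eventuallyEq.mp hv
    rw [coclosedCompact_eq_cocompact] at hcocompact
    exact (hcocompact.filter_mono atTop_le_cocompact).symm

theorem gaussL2_mem_LMax_graph (hm : -1 < m.re) (ha : 0 < a) :
    (gaussL2 hm ha, schrodingerGauss hm ha) ∈ (LMax (m ^ 2)).graph := by
  have hv : ContDiff ℝ ∞ fun x : ℝ => (Real.exp (-(a / 2) * x ^ 2) : ℂ) :=
    Complex.ofRealCLM.contDiff.comp (contDiff_gaussian a)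
  refine mem_LMax_graph_of_contDiffOn ((contDiffOn_cpow (m + 1 / 2)).mul hv.contDiffOn)
    (gaussL2_coe hm ha) ?_
  have hgauss' : ContDiff ℝ ∞ (deriv fun x : ℝ => Real.exp (-(a / 2) * x ^ 2)) :=
    (contDiff_infty_iff_deriv.mp (contDiff_gaussian a)).2
  filter_upwards [schrodingerGauss_coe hm ha, ae_restrict_mem measurableSet_Ioi] with x hx hx0
  have : (x : ℂ) ≠ 0 := Complex.ofReal_ne_zero.mpr (ne_of_gt hx0)
  rw [hx, schrodingerExpr_cpow_mul m hv hx0,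
    deriv_ofReal_comp ((contDiff_gaussian a).differentiable (by simp)),
    deriv_ofReal_comp (hgauss'.differentiable (by simp)),
    deriv_deriv_gaussian, deriv_gaussian, gauss]
  push_cast
  field_simp
  ring

/-- The difference is `x^{m+1/2} ψ` where `ψ = e^{-ax²/2} - ξ` vanishes to second order at `0`. -/
theorem gaussL2_sub_mem_LMin_domain (hm : -1 < m.re) {ξ : ℝ → ℝ} (hξ : ContDiff ℝ ∞ ξ)
    (hξc : HasCompactSupport ξ) (hξ1 : ∀ᶠ x in 𝓝 (0 : ℝ), ξ x = 1) {u : HalfLineL2}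
    (hu : ⇑u =ᵐ[halfLine] fun x => (x : ℂ) ^ (m + 1 / 2) * ξ x) (ha : 0 < a) :
    gaussL2 hm ha - u ∈ (LMin (m ^ 2)).domain := by
  have hξ' : ContDiff ℝ ∞ (deriv ξ) := (contDiff_infty_iff_deriv.mp hξ).2
  have hgauss' : ContDiff ℝ ∞ (deriv fun x : ℝ => Real.exp (-(a / 2) * x ^ 2)) :=
    (contDiff_infty_iff_deriv.mp (contDiff_gaussian a)).2
  have hdecay_sub {v w : ℝ → ℝ} (hv : Asymptotics.SuperpolynomialDecay atTop id v)
      (hw : HasCompactSupport w) :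
      Asymptotics.SuperpolynomialDecay atTop id fun x => v x - w x := by
    simpa only [sub_eq_add_neg] using! hv.add (superpolynomialDecay_of_hasCompactSupport hw.neg)
  have hderiv : deriv (fun x => Real.exp (-(a / 2) * x ^ 2) - ξ x) =
      fun x => deriv (fun x => Real.exp (-(a / 2) * x ^ 2)) x - deriv ξ x := funext fun x =>
    deriv_sub ((contDiff_gaussian a).differentiable (by simp) x) (hξ.differentiable (by simp) x)
  have hderiv₂ : deriv (fun x => deriv (fun x => Real.exp (-(a / 2) * x ^ 2)) x - deriv ξ x) =
      fun x => deriv (deriv fun x => Real.exp (-(a / 2) * x ^ 2)) x - deriv (deriv ξ) x :=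
    funext fun x =>
      deriv_sub (hgauss'.differentiable (by simp) x) (hξ'.differentiable (by simp) x)
  refine mem_LMin_domain_of_cpow_mul hm ((contDiff_gaussian a).sub hξ) ?_ ?_
    (hdecay_sub (superpolynomialDecay_gaussian ha) hξc) ?_ ?_ ?_
  · simp [hξ1.self_of_nhds]
  · simp only [hderiv, deriv_gaussian, EventuallyEq.deriv_eq hξ1]
    simp
  · exact hderiv ▸ hdecay_sub (superpolynomialDecay_deriv_gaussian ha) hξc.deriv
  · exact hderiv ▸ hderiv₂ ▸
      hdecay_sub (superpolynomialDecay_deriv_deriv_gaussian ha) hξc.deriv.deriv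
  · filter_upwards [Lp.coeFn_sub (gaussL2 hm ha) u, gaussL2_coe hm ha, hu] with x hsub hgauss hux
    rw [hsub, Pi.sub_apply, hgauss, hux, gauss]
    push_cast
    ring

end GaussianCutoff

/-! ### Diagonalization of the homogeneous Schrödinger operator -/

theorem graph_domRestrict_sup_span {R E F : Type*} [Ring R] [AddCommGroup E] [Module R E]
    [AddCommGroup F] [Module R F] {S T : E →ₗ.[R] F} (hST : S ≤ T) {p : E × F}
    (hp : p ∈ T.graph) :
    (T.domRestrict (S.domain ⊔ Submodule.span R {p.1})).graph =
      S.graph ⊔ Submodule.span R {p} := by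
  refine le_antisymm (fun q hq => ?_) (sup_le (fun q hq => ?_)
    ((Submodule.span_singleton_le_iff_mem _ _).mpr ?_))
  · obtain ⟨hdom, hqT⟩ := (mem_domRestrict_graph _ _ q).mp hq
    obtain ⟨y, hy, z, hz, hyz⟩ := Submodule.mem_sup.mp hdom
    obtain ⟨c, rfl⟩ := Submodule.mem_span_singleton.mp hz
    have hyS := S.mem_graph ⟨y, hy⟩
    have hsum := T.graph.add_mem (LinearPMap.le_graph_of_le hST hyS) (T.graph.smul_mem c hp)
    have hsnd := LinearPMap.mem_graph_snd_inj T hqT hsum hyz.symm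
    exact Submodule.mem_sup.mpr ⟨_, hyS, _, Submodule.smul_mem _ c
      (Submodule.mem_span_singleton_self p), Prod.ext hyz hsnd.symm⟩
  · exact (mem_domRestrict_graph _ _ q).mpr
      ⟨Submodule.mem_sup_left (LinearPMap.mem_domain_of_mem_graph (x := q.1) (y := q.2) hq),
        LinearPMap.le_graph_of_le hST hq⟩
  · exact (mem_domRestrict_graph _ _ p).mpr
      ⟨Submodule.mem_sup_right (Submodule.mem_span_singleton_self _), hp⟩

/-- Since `L_α` is formally symmetric for the bilinear pairing, this is clear on test functions;
both sides are continuous in `p` for the graph norm. -/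
theorem pairing_of_mem_LMin_of_mem_LMax {α : ℂ} {p q : HalfLineL2 × HalfLineL2}
    (hp : p ∈ (LMin α).graph) (hq : q ∈ (LMax α).graph) :
    pairing q.1 p.2 = pairing q.2 p.1 := by
  have hclosed : IsClosed {p : HalfLineL2 × HalfLineL2 | pairing q.1 p.2 = pairing q.2 p.1} :=
    isClosed_eq ((pairing q.1).continuous.comp continuous_snd)
      ((pairing q.2).continuous.comp continuous_fst)
  rw [LMin_graph] at hp
  refine closure_minimal (fun p hp => ?_) hclosed hp
  obtain ⟨⟨φ, hφ, hpφ⟩, hpmax⟩ := (mem_domRestrict_graph _ _ p).mp hp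
  have hfst : p.1 = hφ.memLp.toLp φ := Lp.ext (hpφ.trans hφ.memLp.coeFn_toLp.symm)
  have hsnd : p.2 = (schrodingerExpr_isTest α φ hφ).memLp.toLp _ :=
    LinearPMap.mem_graph_snd_inj _ hpmax
      (LinearPMap.le_graph_of_le (LMin_le_LMax α) (mem_LMin_graph_of_isTest hφ)) hfst
  rw [mem_ofPred_eq, hfst, hsnd, pairing_comm q.1, pairing_comm q.2,
    mem_LMax_graph_iff.mp (show (q.1, q.2) ∈ (LMax α).graph from hq) φ hφ]

lemma homogeneousSchrodinger_eq_domRestrict {m : ℂ} {ξ : ℝ → ℝ} {u : HalfLineL2}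
    (hu : ⇑u =ᵐ[halfLine] fun x => (x : ℂ) ^ (m + 1 / 2) * ξ x) :
    homogeneousSchrodinger m ξ =
      (LMax (m ^ 2)).domRestrict ((LMin (m ^ 2)).domain ⊔ Submodule.span ℂ {u}) := by
  have hset : {f : HalfLineL2 | ⇑f =ᵐ[halfLine] fun x => (x : ℂ) ^ (1 / 2 + m) * ξ x} = {u} := by
    ext f
    rw [mem_ofPred_eq, mem_singleton_iff, add_comm (1 / 2 : ℂ) m]
    exact ⟨fun h => Lp.ext (h.trans hu.symm), fun h => h ▸ hu⟩
  rw [homogeneousSchrodinger, hset]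

section HankelConj

variable {m : ℂ} (hm : -1 < m.re)

/-- The operator `Ξ_m⁻¹(A) X⁻² Ξ_m(A)`. -/
def hankelConj : HalfLineL2 →ₗ.[ℂ] HalfLineL2 :=
  conjOp (XiA hm).toLinearEquiv (mulOp halfLine fun x => ((x : ℂ) ^ 2)⁻¹)

/-- Inversion turns multiplication by `x⁻²` into multiplication by `x²`, so the Hankel
transformation carries `Ξ_m⁻¹(A) X⁻² Ξ_m(A)` to the latter. -/
theorem mem_hankelConj_graph {f g : HalfLineL2} :
    (f, g) ∈ (hankelConj hm).graph ↔
      ⇑(hankelCLM hm g) =ᵐ[halfLine] fun x => (x : ℂ) ^ 2 * hankelCLM hm f x := by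
  have hcoe (f : HalfLineL2) : ⇑(inversion f) =ᵐ[halfLine] fun x => (x : ℂ)⁻¹ * f x⁻¹ :=
    (inversion_memLp f).coeFn_toLp
  have hXiA (f : HalfLineL2) : XiA hm f = inversion (hankelCLM hm f) :=
    (inversion_inversion _).symm
  rw [hankelConj, mem_conjOp_graph, mulOp_graph]
  change ⇑(XiA hm g) =ᵐ[halfLine] (fun x => ((x : ℂ) ^ 2)⁻¹ * XiA hm f x) ↔ _
  constructor <;> intro h
  · filter_upwards [hcoe (XiA hm f), hcoe (XiA hm g), inversion_qmp.ae h] with x hf hg hx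
    rw [hankelCLM_apply, hankelCLM_apply, hf, hg, hx]
    push_cast
    rw [inv_pow, inv_inv]
    ring
  · rw [hXiA f, hXiA g]
    filter_upwards [hcoe (hankelCLM hm f), hcoe (hankelCLM hm g), inversion_qmp.ae h]
      with x hf hg hx
    rw [hf, hg, hx]
    push_cast
    ring

theorem gaussL2_mem_hankelConj_graph {a : ℝ} (ha : 0 < a) :
    (gaussL2 hm ha, schrodingerGauss hm ha) ∈ (hankelConj hm).graph := by
  rw [mem_hankelConj_graph, hankelCLM_gaussL2, hankelCLM_schrodingerGauss]
  filter_upwards [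
    Lp.coeFn_smul ((a : ℂ) ^ (-(m + 1))) (gaussL2 (neg_one_lt_add_two_re hm) (inv_pos.mpr ha)),
    Lp.coeFn_smul ((a : ℂ) ^ (-(m + 1))) (gaussL2 hm (inv_pos.mpr ha)),
    gaussL2_coe hm (inv_pos.mpr ha), gaussL2_coe (neg_one_lt_add_two_re hm) (inv_pos.mpr ha),
    ae_restrict_mem measurableSet_Ioi] with x hsmul' hsmul hgauss hgauss' hx
  rw [hsmul, hsmul', Pi.smul_apply, Pi.smul_apply, hgauss, hgauss', gauss_add_two m _ hx,
    smul_eq_mul, smul_eq_mul]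
  ring

lemma ae_eq_sq_mul_of_pairing_gaussL2 {u v : HalfLineL2}
    (h : ∀ a (ha : 0 < a),
      pairing (gaussL2 hm ha) v = pairing (gaussL2 (neg_one_lt_add_two_re hm) ha) u) :
    ⇑v =ᵐ[halfLine] fun x => (x : ℂ) ^ 2 * u x := by
  have hm2 := neg_one_lt_add_two_re hm
  have hsplit {a : ℝ} : (fun x => (v x - (x : ℂ) ^ 2 * u x) * gauss m a x) =ᵐ[halfLine]
      (fun x => v x * gauss m a x) - fun x => u x * gauss (m + 2) a x := by
    filter_upwards [ae_restrict_mem measurableSet_Ioi] with x hx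
    rw [Pi.sub_apply, gauss_add_two m a hx]
    ring
  have hintegrable {a : ℝ} (ha : 0 < a) : IntegrableOn (fun x => v x * gauss m a x) (Ioi 0) :=
    (Lp.memLp v).integrable_mul (memLp_gauss hm ha)
  have hintegrable' {a : ℝ} (ha : 0 < a) :
      IntegrableOn (fun x => u x * gauss (m + 2) a x) (Ioi 0) :=
    (Lp.memLp u).integrable_mul (memLp_gauss hm2 ha)
  have hzero := ae_eq_zero_of_integral_mul_gauss (m := m) (a₀ := 1)
    (D := fun x => v x - (x : ℂ) ^ 2 * u x)
    (((hintegrable one_pos).sub (hintegrable' one_pos)).congr hsplit.symm) fun a ha => by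
      have ha0 : 0 < a := one_pos.trans_le ha
      rw [integral_congr_ae hsplit, integral_sub' (hintegrable ha0) (hintegrable' ha0), sub_eq_zero,
        ← pairing_toLp (memLp_gauss hm ha0), ← pairing_toLp (memLp_gauss hm2 ha0)]
      exact h a ha0
  exact hzero.mono fun x hx => sub_eq_zero.mp hx

lemma mem_hankelConj_graph_of_pairing {f g : HalfLineL2}
    (h : ∀ a (ha : 0 < a), pairing (gaussL2 hm ha) g = pairing (schrodingerGauss hm ha) f) :
    (f, g) ∈ (hankelConj hm).graph := by
  have hm2 := neg_one_lt_add_two_re hm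
  have hinv {a : ℝ} (ha : 0 < a) : pairing (gaussL2 hm (inv_pos.mpr ha)) (hankelCLM hm g) =
      pairing (gaussL2 hm2 (inv_pos.mpr ha)) (hankelCLM hm f) := by
    have ha0 : (a : ℂ) ^ (-(m + 1)) ≠ 0 := by simp [Complex.cpow_eq_zero_iff, ha.ne']
    refine smul_right_injective ℂ ha0 ?_
    simp only [pairing_comm _ (hankelCLM hm _), ← map_smul]
    rw [← hankelCLM_gaussL2 hm ha, ← hankelCLM_schrodingerGauss hm ha, pairing_hankelCLM,
      pairing_hankelCLM, hankelCLM_hankelCLM, hankelCLM_hankelCLM, pairing_comm, h a ha,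
      pairing_comm]
  exact (mem_hankelConj_graph hm).mpr (ae_eq_sq_mul_of_pairing_gaussL2 hm fun b hb => by
    simpa only [inv_inv] using hinv (inv_pos.mpr hb))

theorem LMin_graph_le_hankelConj_graph : (LMin (m ^ 2)).graph ≤ (hankelConj hm).graph :=
  fun _ hp => mem_hankelConj_graph_of_pairing hm fun _ ha =>
    pairing_of_mem_LMin_of_mem_LMax hp (gaussL2_mem_LMax_graph hm ha)

lemma memLp_top_inv_one_add_sq :
    MemLp (fun x : ℝ => (((1 + x ^ 2)⁻¹ : ℝ) : ℂ)) ⊤ halfLine := by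
  refine memLp_top_of_bound (Measurable.aestronglyMeasurable (by fun_prop)) 1
    (ae_of_all _ fun x => ?_)
  rw [Complex.norm_real, Real.norm_of_nonneg (by positivity)]
  exact inv_le_one_of_one_le₀ (by nlinarith)

lemma memLp_top_sq_div_one_add_sq :
    MemLp (fun x : ℝ => ((x ^ 2 / (1 + x ^ 2) : ℝ) : ℂ)) ⊤ halfLine := by
  refine memLp_top_of_bound (Measurable.aestronglyMeasurable (by fun_prop)) 1
    (ae_of_all _ fun x => ?_)
  rw [Complex.norm_real, Real.norm_of_nonneg (by positivity), div_le_one (by positivity)]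
  linarith

/-- The parametrization `h ↦ (F (h / (1 + x²)), F (x² h / (1 + x²)))` of the graph of
`Ξ_m⁻¹(A) X⁻² Ξ_m(A)` by `L²[0, ∞[`, where `F` is the Hankel transformation. -/
def hankelConjParam : HalfLineL2 →L[ℂ] HalfLineL2 × HalfLineL2 :=
  (hankelCLM hm ∘L boundedMul memLp_top_inv_one_add_sq).prod
    (hankelCLM hm ∘L boundedMul memLp_top_sq_div_one_add_sq)

lemma hankelConjParam_add {f g : HalfLineL2} (hfg : (f, g) ∈ (hankelConj hm).graph) :
    hankelConjParam hm (hankelCLM hm f + hankelCLM hm g) = (f, g) := by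
  rw [mem_hankelConj_graph] at hfg
  have hne (x : ℝ) : 1 + (x : ℂ) ^ 2 ≠ 0 := by
    exact_mod_cast (show (0 : ℝ) < 1 + x ^ 2 by positivity).ne'
  have hsum : ⇑(hankelCLM hm f + hankelCLM hm g) =ᵐ[halfLine]
      fun x => (1 + (x : ℂ) ^ 2) * hankelCLM hm f x := by
    filter_upwards [Lp.coeFn_add (hankelCLM hm f) (hankelCLM hm g), hfg] with x hadd hx
    rw [hadd, Pi.add_apply, hx]
    ring
  have hfst : boundedMul memLp_top_inv_one_add_sq (hankelCLM hm f + hankelCLM hm g) =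
      hankelCLM hm f := by
    refine Lp.ext ?_
    filter_upwards [boundedMul_coe memLp_top_inv_one_add_sq _, hsum] with x hmul hx
    rw [hmul, hx]
    push_cast
    field_simp [hne x]
  have hsnd : boundedMul memLp_top_sq_div_one_add_sq (hankelCLM hm f + hankelCLM hm g) =
      hankelCLM hm g := by
    refine Lp.ext ?_
    filter_upwards [boundedMul_coe memLp_top_sq_div_one_add_sq _, hsum, hfg] with x hmul hx hgx
    rw [hmul, hx, hgx]
    push_cast
    field_simp [hne x]
  refine Prod.ext ?_ ?_
  · exact (congrArg (hankelCLM hm) hfst).trans (hankelCLM_hankelCLM hm f)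
  · exact (congrArg (hankelCLM hm) hsnd).trans (hankelCLM_hankelCLM hm g)

lemma hankelCLM_gaussL2_add_schrodingerGauss_ae_eq {a : ℝ} (ha : 0 < a) :
    ⇑((a : ℂ) ^ (m + 1) •
      (hankelCLM hm (gaussL2 hm ha) + hankelCLM hm (schrodingerGauss hm ha))) =ᵐ[halfLine]
      fun x => (1 + (x : ℂ) ^ 2) * gauss m a⁻¹ x := by
  have ha0 : (a : ℂ) ^ (m + 1) ≠ 0 := by simp [Complex.cpow_eq_zero_iff, ha.ne']
  have hm2 := neg_one_lt_add_two_re hm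
  rw [hankelCLM_gaussL2, hankelCLM_schrodingerGauss, ← smul_add, smul_smul, Complex.cpow_neg,
    mul_inv_cancel₀ ha0, one_smul]
  filter_upwards [Lp.coeFn_add (gaussL2 hm (inv_pos.mpr ha)) (gaussL2 hm2 (inv_pos.mpr ha)),
    gaussL2_coe hm (inv_pos.mpr ha), gaussL2_coe hm2 (inv_pos.mpr ha),
    ae_restrict_mem measurableSet_Ioi] with x hadd hgauss hgauss' hx
  rw [hadd, Pi.add_apply, hgauss, hgauss', gauss_add_two m _ hx]
  ring

theorem hankelConj_graph_le_of_gaussL2_mem {S : Submodule ℂ (HalfLineL2 × HalfLineL2)}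
    (hS : IsClosed (S : Set (HalfLineL2 × HalfLineL2)))
    (h : ∀ a (ha : 0 < a), (gaussL2 hm ha, schrodingerGauss hm ha) ∈ S) :
    (hankelConj hm).graph ≤ S := by
  have htop : S.comap (hankelConjParam hm).toLinearMap = ⊤ := by
    refine eq_top_of_mul_gauss_mem (m := m) (w := fun x => 1 + (x : ℂ) ^ 2)
      (fun x _ => by exact_mod_cast (show (0 : ℝ) < 1 + x ^ 2 by positivity).ne')
      (hS.preimage (hankelConjParam hm).continuous) fun b hb => ?_
    have hb' : 0 < b⁻¹ := inv_pos.mpr hb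
    refine ⟨_, Submodule.smul_mem _ _ ?_,
      by simpa only [inv_inv] using hankelCLM_gaussL2_add_schrodingerGauss_ae_eq hm hb'⟩
    change hankelConjParam hm _ ∈ S
    rw [hankelConjParam_add hm (gaussL2_mem_hankelConj_graph hm hb')]
    exact h _ hb'
  rintro ⟨f, g⟩ hfg
  have hmem : hankelCLM hm f + hankelCLM hm g ∈ S.comap (hankelConjParam hm).toLinearMap :=
    htop ▸ Submodule.mem_top
  rwa [Submodule.mem_comap, ContinuousLinearMap.coe_coe, hankelConjParam_add hm hfg] at hmem

theorem homogeneousSchrodinger_eq {ξ : ℝ → ℝ} (hξ : ContDiff ℝ ∞ ξ)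
    (hξc : HasCompactSupport ξ) (hξ1 : ∀ᶠ x in 𝓝 (0 : ℝ), ξ x = 1) :
    homogeneousSchrodinger m ξ = hankelConj hm := by
  obtain ⟨u, hu⟩ : ∃ u : HalfLineL2, ⇑u =ᵐ[halfLine] fun x => (x : ℂ) ^ (m + 1 / 2) * ξ x :=
    let hmem := memLp_cpow_mul hm hξ.continuous.continuousOn
      (((hξ.continuous.tendsto 0).isBigO_one ℝ).mono nhdsWithin_le_nhds)
      (superpolynomialDecay_of_hasCompactSupport hξc)
    ⟨hmem.toLp _, hmem.coeFn_toLp⟩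
  have hdom := homogeneousSchrodinger_eq_domRestrict hu
  obtain ⟨v, hv⟩ : ∃ v, (gaussL2 hm one_pos - u, v) ∈ (LMin (m ^ 2)).graph :=
    ⟨_, (LMin (m ^ 2)).mem_graph ⟨_, gaussL2_sub_mem_LMin_domain hm hξ hξc hξ1 hu one_pos⟩⟩
  have hsub_sub {f g f' g' : HalfLineL2} : (f, g) - (f - f', g') = (f', g - g') := by simp
  have huLMax : (u, schrodingerGauss hm one_pos - v) ∈ (LMax (m ^ 2)).graph :=
    hsub_sub ▸ sub_mem (gaussL2_mem_LMax_graph hm one_pos)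
      (LinearPMap.le_graph_of_le (LMin_le_LMax _) hv)
  have hgraph : (homogeneousSchrodinger m ξ).graph = _ :=
    hdom ▸ graph_domRestrict_sup_span (LMin_le_LMax (m ^ 2)) huLMax
  refine LinearPMap.eq_of_eq_graph (le_antisymm ?_ ?_)
  · refine hgraph ▸ sup_le (LMin_graph_le_hankelConj_graph hm)
      ((Submodule.span_singleton_le_iff_mem _ _).mpr ?_)
    exact hsub_sub ▸ sub_mem (gaussL2_mem_hankelConj_graph hm one_pos)
      (LMin_graph_le_hankelConj_graph hm hv)
  · refine hankelConj_graph_le_of_gaussL2_mem hm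
      (hgraph ▸ Submodule.isClosed_sup_finiteDimensional _ _ (isClosed_LMin_graph _))
      fun a ha => ?_
    rw [hdom]
    refine (mem_domRestrict_graph _ _ _).mpr ⟨Submodule.mem_sup.mpr ⟨_,
      gaussL2_sub_mem_LMin_domain hm hξ hξc hξ1 hu ha, u, Submodule.mem_span_singleton_self u,
      sub_add_cancel _ _⟩, gaussL2_mem_LMax_graph hm ha⟩

end HankelConj

end

theorem mainTheorem8 (m : ℂ) (hm : -1 < m.re)
    (ξ : ℝ → ℝ) (hξ : ContDiff ℝ ∞ ξ) (hξc : HasCompactSupport ξ)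
    (hξ1 : ∀ᶠ x in 𝓝 (0 : ℝ), ξ x = 1) :
    ∃ ΞA : HalfLineL2 ≃L[ℂ] HalfLineL2,
      (∀ B : HalfLineL2 →L[ℂ] HalfLineL2,
        IsFunctionOf dilationGenerator (Xi m) B ↔ B = ΞA) ∧
      (∀ B : HalfLineL2 →L[ℂ] HalfLineL2,
        IsFunctionOf dilationGenerator (fun t => (Xi m t)⁻¹) B ↔ B = ΞA.symm) ∧
      hankel m = (inversion.toLinearMap ∘ₗ ΞA.toLinearEquiv.toLinearMap).toPMap ⊤ ∧
      hankel m = (ΞA.symm.toLinearEquiv.toLinearMap ∘ₗ inversion.toLinearMap).toPMap ⊤ ∧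
      homogeneousSchrodinger m ξ =
        conjOp ΞA.toLinearEquiv (mulOp halfLine fun x => ((x : ℂ) ^ 2)⁻¹) :=
  ⟨XiA hm, isFunctionOf_Xi_iff hm, isFunctionOf_inv_Xi_iff hm,
    hankel_eq_toPMap hm fun _ => rfl,
    hankel_eq_toPMap hm fun f => (hankelCLM_eq_XiA_symm_inversion hm f).symm,
    homogeneousSchrodinger_eq hm hξ hξc hξ1⟩
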